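/- Let $g>0$, $h>0$, $\gamma\in\mathbb R$, let $n\ge 1$ be an integer and $\alpha\in(0,1)$. **Definitions.** For $w\in C^{1,\alpha}(\mathbb R)$ let $\mathcal G_h(w)(x)=W_y(x,0)$, where $W$ is the bounded harmonic function in the strip $-h<y<0$ with $W(x,-h)=0$ and $W(x,0)=w(x)$. Consider $$\{\lambda+\gamma(\mathcal G_h(\tfrac{w^2}{2})-w-w\,\mathcal G_h(w))\}^2=(\lambda^2+\mu-2gw)\,(w'^2+\mathcal G_h(w)^2+2\mathcal G_h(w)+1).\qquad(*)$$ For a pair of frequency sequences $(\alpha_k),(\beta_k)$ let $E^n_0$ be the space of mean-zero functions in $C^{n,\alpha}(\mathbb R)$ of the form $c+\sum_k a_k\cos(\alpha_k x)+\sum_k b_k\sin(\beta_k x)$ with absolutely summable coefficients. The pair is admissible if some $\alpha_{k_0}$ differs from all $\beta_k$, and if for all $k,l$ the numbers $\alpha_k+\alpha_l$, $|\alpha_k-\alpha_l|$, $\beta_k+\beta_l$, $|\beta_k-\beta_l|$ occur among the $\alpha_j$ and the numbers $\alpha_k+\beta_l$, $|\alpha_k-\beta_l|$ occur among the $\beta_j$.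 A local bifurcation curve at $\lambda^*$ in direction $u$ is a continuous curve $s\mapsto(\lambda(s),(\mu(s),w(s)))\in\mathbb R\times(\mathbb R\times E_0^n)$, $|s|<\varepsilon$, of solutions of $(*)$ with $w(s)>-h$, with $(\lambda(0),\mu(0),w(0))=(\lambda^*,0,0)$, $w(s)\neq0$ for $s\ne0$, $\mu(s)=o(s)$ and $w(s)=su+o(s)$ in $C^{n,\alpha}$, such that every solution of $(*)$ with $(\mu,w)\ne(0,0)$ in some neighbourhood of $(\lambda^*,(0,0))$ in $\mathbb R\times(\mathbb R\times E_0^n)$ is $(\lambda(s),(\mu(s),w(s)))$ for some $0<|s|<\varepsilon$. The free-boundary problem with data $(\gamma,m,Q)$ is to find $\eta\in C^{1,\alpha}(\mathbb R)$, $\eta>0$, and $\psi\in C^2(\Omega)\cap C^{1,\alpha}(\overline\Omega)$, $\Omega=\{0<Y<\eta(X)\}$, with $$\Delta\psi=-\gamma\ \text{in }\Omega,\quad \psi=-m\ \text{on }Y=0,\quad \psi=0\ \text{and}\ |\nabla\psi|^2+2gY=Q\ \text{on }Y=\eta(X).$$ For mean-zero $w$, the surface $\eta$ has conformal mean depth $h$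 and elevation $h+w$ in the conformal variable if there is a conformal bijection $U+iV$ of the strip $-h<y<0$ onto $\Omega$, continuous up to the boundary and at bounded distance from the identity, with $V(x,-h)=0$, $V(x,0)=h+w(x)$ and $\eta(U(x,0))=h+w(x)$. **Statement.** Let $$\lambda^*=-\frac{\gamma\tanh h}{2}-\sqrt{\frac{\gamma^2\tanh^2 h}{4}+g\tanh h}.$$ The pair $\alpha_k=2k$, $\beta_k=2k+1$ $(k\ge0)$ is admissible, and there are $\varepsilon>0$, functions $\lambda(s),\mu(s)$ and two families $w(s),v(s)$, $|s|<\varepsilon$, such that 1. $(\lambda(s),(\mu(s),w(s)))$ is a local bifurcation curve at $\lambda^*$ in direction $\sin x$ for the pair $\alpha_k=2k$, $\beta_k=2k+1$; every $w(s)$ is $2\pi$-periodic, and $w(s)$ is not even for $s\ne0$; 2. $(\lambda(s),(\mu(s),v(s)))$, with the same $\lambda(s),\mu(s)$, is a local bifurcation curve at the same $\lambda^*$ in direction $\cos x$ for the pair $\alpha_k=k$, $\beta_k=0$; every $v(s)$ is $2\pi$-periodic and even; 3. for $0<|s|<\varepsilon$ and $m,Q$ determined by $\lambda(s)=\frac mh-\frac{\gamma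 h}{2}$ and $\mu(s)=Q-2gh-\lambda(s)^2$, the free-boundary problem with data $(\gamma,m,Q)$ and conformal mean depth $h$ has at least two distinct $2\pi$-periodic solutions: one with $\eta$ even and conformal elevation $h+v(s)$, and one with $\eta$ not even and conformal elevation $h+w(s)$. -/

import Mathlib

open Set Filter Topology
open scoped NNReal ENNReal

noncomputable section

namespace WaterWave

/-- The full `C^{n,α}(ℝ)` norm: sup norms of the derivatives up to order `n`, plus the
`α`-Hölder seminorm of the `n`-th derivative. It is infinite if one of these is. -/
def holderNorm (n : ℕ) (α : ℝ≥0) (f : ℝ → ℝ) : ℝ≥0∞ :=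
  (∑ j ∈ Finset.range (n + 1), ⨆ x : ℝ, ‖iteratedDeriv j f x‖ₑ) +
    eHolderNorm α (iteratedDeriv n f)

/-- Membership in the Hölder space `C^{n,α}(ℝ)`. -/
def IsHolder (n : ℕ) (α : ℝ≥0) (f : ℝ → ℝ) : Prop :=
  ContDiff ℝ n f ∧ holderNorm n α f < ⊤

/-- The mean value of `f` over the line is `c`. -/
def HasMean (f : ℝ → ℝ) (c : ℝ) : Prop :=
  Tendsto (fun R : ℝ => (1 / (2 * R)) * ∫ x in (-R)..R, f x) atTop (𝓝 c)

/-- Admissible pairs of frequency sequences. Differences are taken up to sign, since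
`cos` is even and `sin` is odd. -/
def IsAdmissible (a b : ℕ → ℝ) : Prop :=
  (∃ k₀, ∀ k, a k₀ ≠ b k) ∧
  ∀ k l,
    a k + a l ∈ range a ∧ |a k - a l| ∈ range a ∧
    b k + b l ∈ range a ∧ |b k - b l| ∈ range a ∧
    a k + b l ∈ range b ∧ |a k - b l| ∈ range b

/-- The space of mean-zero functions in `C^{n,α}(ℝ)`, `n ≥ 1`, of the form
`c + ∑ A_k cos (a_k x) + ∑ B_k sin (b_k x)`. -/
structure MemE0 (a b : ℕ → ℝ) (n : ℕ) (α : ℝ≥0) (f : ℝ → ℝ) : Prop where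
  holder : IsHolder n α f
  expansion : ∃ (c : ℝ) (A B : ℕ → ℝ), (Summable fun k => |A k|) ∧ (Summable fun k => |B k|) ∧
    ∀ x, f x = c + ∑' k, A k * Real.cos (a k * x) + ∑' k, B k * Real.sin (b k * x)
  mean_zero : HasMean f 0

/-- The open strip `-h < y < 0` in the plane `ℝ² = ℂ`. -/
def strip (h : ℝ) : Set ℂ := {z | -h < z.im ∧ z.im < 0}

/-- The closed strip `-h ≤ y ≤ 0`. -/
def closedStrip (h : ℝ) : Set ℂ := {z | -h ≤ z.im ∧ z.im ≤ 0}

/-- `W` is the bounded harmonic function in the strip with values `0` on the bottom and `w` on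
the top. -/
structure IsStripExtension (h : ℝ) (w : ℝ → ℝ) (W : ℂ → ℝ) : Prop where
  harmonic : InnerProductSpace.HarmonicOnNhd W (strip h)
  continuousOn : ContinuousOn W (closedStrip h)
  bounded : ∃ C, ∀ z ∈ closedStrip h, |W z| ≤ C
  bottom : ∀ x : ℝ, W ⟨x, -h⟩ = 0
  top : ∀ x : ℝ, W ⟨x, 0⟩ = w x

/-- `v = 𝒢_h(w)`, the Dirichlet-Neumann operator of the strip: `v x = W_y(x,0)`. -/
def HasDN (h : ℝ) (w v : ℝ → ℝ) : Prop :=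
  ∃ W : ℂ → ℝ, IsStripExtension h w W ∧
    ∀ x : ℝ, HasDerivWithinAt (fun y : ℝ => W ⟨x, y⟩) (v x) (Iic 0) 0

/-- The equation `F(λ,(μ,w)) = 0`, that is
`{λ + γ(𝒢(w²/2) - w - w𝒢(w))}² = (λ² + μ - 2gw)(w'² + 𝒢(w)² + 2𝒢(w) + 1)`. -/
def SolvesEq (g γ h lam μ : ℝ) (w : ℝ → ℝ) : Prop :=
  ∃ G G₂ : ℝ → ℝ, HasDN h w G ∧ HasDN h (fun x => w x ^ 2 / 2) G₂ ∧
    ∀ x, (lam + γ * (G₂ x - w x - w x * G x)) ^ 2 =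
      (lam ^ 2 + μ - 2 * g * w x) * ((deriv w x) ^ 2 + (G x) ^ 2 + 2 * G x + 1)

/-- `s ↦ (λ(s),(μ(s),w(s)))`, `|s| < ε`, is a local bifurcation curve of `F = 0` in
`ℝ × (ℝ × E₀ⁿ)` at `(λ*,(0,0))` with direction `(0,u)`: a continuous curve of solutions, nonzero
for `s ≠ 0`, with `(μ(s),w(s)) = s(0,u) + o(s)`, which contains all nonzero solutions in a
neighbourhood of `(λ*,(0,0))`. -/
structure IsBifurcationCurve (g γ h : ℝ) (a b : ℕ → ℝ) (n : ℕ) (α : ℝ≥0)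
    (lamStar : ℝ) (u : ℝ → ℝ) (ε : ℝ) (lam μ : ℝ → ℝ) (w : ℝ → ℝ → ℝ) : Prop where
  eps_pos : 0 < ε
  lam_zero : lam 0 = lamStar
  mu_zero : μ 0 = 0
  w_zero : w 0 = 0
  lam_cont : ContinuousOn lam (Ioo (-ε) ε)
  mu_cont : ContinuousOn μ (Ioo (-ε) ε)
  w_cont : ∀ s ∈ Ioo (-ε) ε, Tendsto (fun t => holderNorm n α (w t - w s)) (𝓝 s) (𝓝 0)
  mem : ∀ s ∈ Ioo (-ε) ε, MemE0 a b n α (w s)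
  solves : ∀ s ∈ Ioo (-ε) ε, SolvesEq g γ h (lam s) (μ s) (w s)
  above_bottom : ∀ s ∈ Ioo (-ε) ε, ∀ x, -h < w s x
  nontrivial : ∀ s ∈ Ioo (-ε) ε, s ≠ 0 → w s ≠ 0
  mu_little : μ =o[𝓝 0] (fun s : ℝ => s)
  w_little : Tendsto (fun s : ℝ => holderNorm n α (w s - s • u) / ‖s‖ₑ) (𝓝[≠] 0) (𝓝 0)
  complete : ∃ δ > 0, ∀ (l m : ℝ) (f : ℝ → ℝ), |l - lamStar| < δ → |m| < δ → MemE0 a b n α f →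
    holderNorm n α f < ENNReal.ofReal δ → (m ≠ 0 ∨ f ≠ 0) → SolvesEq g γ h l m f →
    ∃ s ∈ Ioo (-ε) ε, s ≠ 0 ∧ l = lam s ∧ m = μ s ∧ f = w s

/-- The fluid domain `0 < Y < η(X)`. -/
def fluidDomain (η : ℝ → ℝ) : Set ℂ := {z | 0 < z.im ∧ z.im < η z.re}

/-- Membership in `C^{1,α}(K)` for a closed region `K` of the plane (derivatives at boundary
points are taken within `K`). -/
structure IsC1Holder (α : ℝ≥0) (K : Set ℂ) (ψ : ℂ → ℝ) : Prop where
  diff : DifferentiableOn ℝ ψ K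
  bounded : ∃ C : ℝ, ∀ z ∈ K, |ψ z| ≤ C ∧ ‖fderivWithin ℝ ψ K z‖ ≤ C
  holder : ∃ C : ℝ≥0, HolderOnWith C α (fderivWithin ℝ ψ K) K

/-- `(η,ψ)` solves the free-boundary problem `Δψ = -γ` in `Ω = {0 < Y < η(X)}`, `ψ = -m` on
`Y = 0`, `ψ = 0` and `|∇ψ|² + 2gY = Q` on `Y = η(X)`. -/
structure SolvesFreeBoundary (g γ m Q : ℝ) (α : ℝ≥0) (η : ℝ → ℝ) (ψ : ℂ → ℝ) : Prop where
  eta_holder : IsHolder 1 α η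
  eta_pos : ∀ x, 0 < η x
  psi_holder : IsC1Holder α (closure (fluidDomain η)) ψ
  psi_smooth : ContDiffOn ℝ 2 ψ (fluidDomain η)
  poisson : ∀ z ∈ fluidDomain η, Laplacian.laplacian ψ z = -γ
  bottom : ∀ x : ℝ, ψ ⟨x, 0⟩ = -m
  top : ∀ x : ℝ, ψ ⟨x, η x⟩ = 0
  bernoulli : ∀ x : ℝ,
    ‖fderivWithin ℝ ψ (closure (fluidDomain η)) ⟨x, η x⟩‖ ^ 2 + 2 * g * η x = Q

/-- The domain below the graph of `η` is the image of the strip of height `h` under a conformal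
bijection `U + iV`, at bounded distance from the identity, mapping bottom to bottom and top to
free surface, with `V(x,0) = h + w(x)`. When `w` has mean zero, `h` is the conformal mean depth
and `h + w` is the surface elevation in the conformal variable. -/
def IsConformalElevation (h : ℝ) (w η : ℝ → ℝ) : Prop :=
  ∃ Φ : ℂ → ℂ, DifferentiableOn ℂ Φ (strip h) ∧ ContinuousOn Φ (closedStrip h) ∧
    BijOn Φ (strip h) (fluidDomain η) ∧
    (∃ C : ℝ, ∀ z ∈ closedStrip h, ‖Φ z - z‖ ≤ C) ∧
    (∀ x : ℝ, (Φ ⟨x, -h⟩).im = 0) ∧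
    ∀ x : ℝ, (Φ ⟨x, 0⟩).im = h + w x ∧ η (Φ ⟨x, 0⟩).re = h + w x

end WaterWave

end

noncomputable section

namespace WaterWave

/-! ### The maximum principle in the strip -/

/-! Equation (*) is invariant under translations, and translation by a quarter period turns cosine
series in all `k` into series in `cos (2k x)` and `sin ((2k+1) x)`, carrying `cos` to `sin`. So only
the even curve `v` has to be constructed: `w(s)` is `v(s)` shifted by `π/2`, with the same `λ(s)`
and `μ(s)`. Even about another point, `w(s)` is not even about `0`, because `v(s)` is close to `s
cos` and hence differs at `0` and `-π`.

Existence (`exists_branch`). Solutions are sought with exponentially decaying cosine coefficients,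
the unknown in `ℓ¹` being the weighted coefficients of the derivative of the wave. Then the
Dirichlet–Neumann operator, which costs one derivative, and all products occurring in (*) are
bounded operators on `ℓ¹`. Writing the wave as `s` times a profile whose `cos x` coefficient is `1`,
and `μ = sν`, one divides (*) by `s`. The implicit function theorem solves the quotient for `ν`, `λ`
and the modes `k ≥ 2`. The linearisation at `s = 0` is diagonal. Its entry at mode `0` comes from
`ν`, at mode `1` from transversality in `λ`, and at `k ≥ 2` it is nonzero because `k coth (kh)`
grows by at least `tanh h` per step (`dnSymbol_gap`).

Completeness (`exists_rigidity`). The `ℓ¹` space is much smaller than the Hölder space, so the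
implicit function theorem does not show that every small Hölder solution lies on the curve. Instead
an arbitrary solution is compared with the point of the curve having the same first cosine
coefficient `s`. The difference solves a linear constant-coefficient equation with a small
remainder. Bessel's inequality, mode by mode, bounds the differences of the waves, of `μ`, and of
`λ` (the last multiplied by `s`) by the remainder, which is absorbed. This needs Fourier
coefficients and Parseval's identity for the normal derivative of a Hölder solution (`dn_energy`).
They are limits of difference quotients of the harmonic extension; the uniform bound comes from a
barrier and a Phragmén–Lindelöf principle (`exists_linear_decay`, `strip_maximum_principle`), which
also makes the extension unique.

The free boundary (`IsConformalData.exists_freeBoundary`). The wave is the imaginary part on the top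
of a holomorphic `Θ` with small derivative, so `z + ih + Θ(z)` is a conformal bijection of the strip
onto the region below a graph. The stream function is the imaginary part of an explicit holomorphic
potential minus `γY²/2`, and (*) is exactly Bernoulli's law for it. -/

theorem deriv_deriv_line {u : ℂ → ℝ} {z : ℂ} (hu : ContDiffAt ℝ 2 u z) (v : ℂ) :
    deriv (deriv fun t : ℝ => u (z + t • v)) 0 = iteratedFDeriv ℝ 2 u z ![v, v] := by
  have hl : ∀ t : ℝ, HasDerivAt (fun t : ℝ => z + t • v) v t := fun t => by
    simpa using ((hasDerivAt_id t).smul_const v).const_add z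
  have hev : ∀ᶠ y in 𝓝 z, ContDiffAt ℝ 2 u y := hu.eventually (by simp)
  have hz : Tendsto (fun t : ℝ => z + t • v) (𝓝 0) (𝓝 z) := by
    have := (hl 0).continuousAt.tendsto
    simpa using this
  have h1 : (deriv fun t : ℝ => u (z + t • v)) =ᶠ[𝓝 0] fun t => fderiv ℝ u (z + t • v) v := by
    filter_upwards [hz.eventually hev] with t ht
    exact ((ht.differentiableAt (by norm_num)).hasFDerivAt.comp_hasDerivAt t (hl t)).deriv
  rw [h1.deriv_eq]
  have h2 : DifferentiableAt ℝ (fderiv ℝ u) (z + (0 : ℝ) • v) := by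
    have := (hu.fderiv_right (m := 1) (by norm_num)).differentiableAt (by norm_num)
    simpa using this
  have h3 := (h2.hasFDerivAt.comp_hasDerivAt 0 (hl 0))
  have h4 := ((ContinuousLinearMap.apply ℝ ℝ v).hasFDerivAt.comp_hasDerivAt 0 h3).deriv
  rw [iteratedFDeriv_two_apply]
  simpa [Function.comp_def] using h4

theorem laplacian_eq_lines {u : ℂ → ℝ} {z : ℂ} (hu : ContDiffAt ℝ 2 u z) :
    Laplacian.laplacian u z = deriv (deriv fun t : ℝ => u (z + t • (1 : ℂ))) 0 +
      deriv (deriv fun t : ℝ => u (z + t • Complex.I)) 0 := by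
  rw [InnerProductSpace.laplacian_eq_iteratedFDeriv_complexPlane, deriv_deriv_line hu,
    deriv_deriv_line hu]

/-- A positive second derivative would make the point a local minimum too. Then `f` would be
constant near it and its second derivative zero. -/
theorem deriv_deriv_nonpos_of_isLocalMax {f : ℝ → ℝ} {a : ℝ} (hf : IsLocalMax f a)
    (hc : ContinuousAt f a) : deriv (deriv f) a ≤ 0 := by
  by_contra! hpos
  have hmin := isLocalMin_of_deriv_deriv_pos hpos hf.deriv_eq_zero hc
  have hconst : f =ᶠ[𝓝 a] fun _ => f a := by
    filter_upwards [hf, hmin] with x h1 h2 using le_antisymm h1 h2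
  have : deriv f =ᶠ[𝓝 a] fun _ => 0 := by
    filter_upwards [hconst.eventuallyEq_nhds] with x hx
    rw [hx.deriv_eq]; simp
  rw [this.deriv_eq] at hpos
  simp at hpos

theorem laplacian_nonpos_of_isLocalMax {u : ℂ → ℝ} {z : ℂ} (hu : ContDiffAt ℝ 2 u z)
    (hm : IsLocalMax u z) : Laplacian.laplacian u z ≤ 0 := by
  have key : ∀ v : ℂ, deriv (deriv fun t : ℝ => u (z + t • v)) 0 ≤ 0 := by
    intro v
    have hl : Continuous (fun t : ℝ => z + t • v) := by fun_prop
    have h0 : z + (0 : ℝ) • v = z := by simp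
    have hz : Tendsto (fun t : ℝ => z + t • v) (𝓝 0) (𝓝 z) := by
      have := hl.tendsto 0
      rwa [h0] at this
    apply deriv_deriv_nonpos_of_isLocalMax
    · have := hz.eventually hm
      simpa [IsLocalMax, IsMaxFilter] using this
    · have h1 : ContinuousAt u (z + (0 : ℝ) • v) := by rw [h0]; exact hu.continuousAt
      exact ContinuousAt.comp (g := u) (f := fun t : ℝ => z + t • v) h1 hl.continuousAt
  rw [laplacian_eq_lines hu]
  linarith [key 1, key Complex.I]

theorem isOpen_strip (h : ℝ) : IsOpen (strip h) :=
  (isOpen_lt continuous_const Complex.continuous_im).inter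
    (isOpen_lt Complex.continuous_im continuous_const)

/-- A strictly superharmonic function, growing at infinity in the strip. -/
def growthBarrier (h : ℝ) (z : ℂ) : ℝ :=
  Real.cosh (z.re / h) * Real.cos (3 / (2 * h) * (z.im + h / 2))

theorem contDiff_re : ContDiff ℝ 2 Complex.re := Complex.reCLM.contDiff
theorem contDiff_im : ContDiff ℝ 2 Complex.im := Complex.imCLM.contDiff

theorem contDiff_growthBarrier (h : ℝ) : ContDiff ℝ 2 (growthBarrier h) := by
  unfold growthBarrier
  exact (Real.contDiff_cosh.comp (contDiff_re.div_const h)).mul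
    (Real.contDiff_cos.comp (contDiff_const.mul (contDiff_im.add contDiff_const)))

/-- The factor is `-5/(4h²)`: the frequency `3/(2h)` of the cosine beats the rate `1/h` of the
hyperbolic cosine. It is also small enough to keep the cosine argument within `[-3/4, 3/4]` on the
strip, where the barrier is positive. -/
theorem laplacian_growthBarrier (h : ℝ) (z : ℂ) :
    Laplacian.laplacian (growthBarrier h) z =
      (1 / h ^ 2 - (3 / (2 * h)) ^ 2) * growthBarrier h z := by
  rw [laplacian_eq_lines (contDiff_growthBarrier h).contDiffAt]
  have h1 : deriv (deriv fun t : ℝ => growthBarrier h (z + t • (1 : ℂ))) 0 =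
      1 / h ^ 2 * growthBarrier h z := by
    simp only [growthBarrier, Complex.add_re, Complex.add_im, Complex.real_smul, mul_one,
      Complex.ofReal_re, Complex.ofReal_im, add_zero]
    set c := Real.cos (3 / (2 * h) * (z.im + h / 2))
    have e1 : ∀ t : ℝ, HasDerivAt (fun t : ℝ => (z.re + t) / h) (1 / h) t := fun t =>
      ((hasDerivAt_id t).const_add z.re).div_const h
    have d1 : deriv (fun t : ℝ => Real.cosh ((z.re + t) / h) * c) =
        fun t => Real.sinh ((z.re + t) / h) * (1 / h) * c := by
      ext t; exact ((e1 t).cosh.mul_const c).deriv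
    rw [d1, (((e1 0).sinh.mul_const (1 / h)).mul_const c).deriv]
    simp; ring
  have h2 : deriv (deriv fun t : ℝ => growthBarrier h (z + t • Complex.I)) 0 =
      - (3 / (2 * h)) ^ 2 * growthBarrier h z := by
    simp only [growthBarrier, Complex.add_re, Complex.add_im, Complex.real_smul, Complex.mul_re,
      Complex.mul_im, Complex.I_re, Complex.I_im, mul_zero, mul_one,
      Complex.ofReal_re, Complex.ofReal_im, add_zero, sub_zero]
    set c := Real.cosh (z.re / h)
    set b := 3 / (2 * h)
    have e1 : ∀ t : ℝ, HasDerivAt (fun t : ℝ => b * (z.im + t + h / 2)) (b * 1) t := fun t =>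
      (((hasDerivAt_id t).const_add z.im).add_const (h / 2)).const_mul b
    have d1 : deriv (fun t : ℝ => c * Real.cos (b * (z.im + t + h / 2))) =
        fun t => c * (-Real.sin (b * (z.im + t + h / 2)) * (b * 1)) := by
      ext t; exact ((e1 t).cos.const_mul c).deriv
    have d2 : HasDerivAt (fun t : ℝ => c * (-Real.sin (b * (z.im + t + h / 2)) * (b * 1))) _ 0 :=
      ((e1 0).sin.neg.mul_const (b * 1)).const_mul c
    rw [d1, d2.deriv]
    simp; ring
  rw [h1, h2]; ring

theorem growthBarrier_ge {h : ℝ} (hh : 0 < h) {z : ℂ} (hz : z ∈ closedStrip h) :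
    Real.cos (3 / 4) * Real.cosh (z.re / h) ≤ growthBarrier h z := by
  unfold growthBarrier
  rw [mul_comm]
  refine mul_le_mul_of_nonneg_left ?_ (Real.cosh_pos _).le
  obtain ⟨h1, h2⟩ := hz
  rw [← Real.cos_abs (3 / (2 * h) * (z.im + h / 2))]
  apply Real.cos_le_cos_of_nonneg_of_le_pi (abs_nonneg _) (by linarith [Real.pi_gt_three])
  rw [abs_mul, abs_of_pos (by positivity : 0 < 3 / (2 * h))]
  have : |z.im + h / 2| ≤ h / 2 := abs_le.2 ⟨by linarith, by linarith⟩
  calc 3 / (2 * h) * |z.im + h / 2| ≤ 3 / (2 * h) * (h / 2) := by gcongr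
    _ = 3 / 4 := by field_simp; norm_num

theorem cos_three_quarters_pos : 0 < Real.cos (3 / 4) :=
  Real.cos_pos_of_mem_Ioo ⟨by linarith [Real.pi_gt_three], by linarith [Real.pi_gt_three]⟩

theorem isClosed_closedStrip (h : ℝ) : IsClosed (closedStrip h) :=
  (isClosed_le continuous_const Complex.continuous_im).inter
    (isClosed_le Complex.continuous_im continuous_const)

theorem strip_subset_closedStrip (h : ℝ) : strip h ⊆ closedStrip h :=
  fun _ hz => ⟨hz.1.le, hz.2.le⟩

/-- Phragmén–Lindelöf maximum principle for subharmonic functions in the strip. -/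
theorem strip_maximum_principle {h : ℝ} (hh : 0 < h) {u : ℂ → ℝ}
    (hu : ∀ z ∈ strip h, ContDiffAt ℝ 2 u z) (hΔ : ∀ z ∈ strip h, 0 ≤ Laplacian.laplacian u z)
    (hc : ContinuousOn u (closedStrip h)) {M : ℝ} (hM : ∀ z ∈ closedStrip h, u z ≤ M)
    (hbot : ∀ x : ℝ, u ⟨x, -h⟩ ≤ 0) (htop : ∀ x : ℝ, u ⟨x, 0⟩ ≤ 0) :
    ∀ z ∈ closedStrip h, u z ≤ 0 := by
  have hκ := cos_three_quarters_pos
  have key : ∀ ε > 0, ∀ z ∈ closedStrip h, u z - ε * growthBarrier h z ≤ 0 := by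
    intro ε hε z₀ hz₀
    by_contra! hpos
    set v : ℂ → ℝ := fun z => u z - ε * growthBarrier h z with hv
    have hvc : ContinuousOn v (closedStrip h) :=
      hc.sub ((contDiff_growthBarrier h).continuous.continuousOn.const_smul ε)
    obtain ⟨R, hR0, hR⟩ : ∃ R : ℝ, |z₀.re| ≤ R ∧ ∀ x : ℝ, R < |x| →
        M - ε * (Real.cos (3 / 4) * Real.cosh (x / h)) < 0 := by
      have hR1 : 0 ≤ h * (|M| / (ε * Real.cos (3 / 4))) := by positivity
      refine ⟨|z₀.re| + h * (|M| / (ε * Real.cos (3 / 4))), by linarith, ?_⟩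
      intro x hx
      have h1 : |M| / (ε * Real.cos (3 / 4)) < |x / h| := by
        rw [abs_div, abs_of_pos hh, lt_div_iff₀ hh]
        linarith [abs_nonneg z₀.re]
      have h2 : |x / h| ≤ Real.cosh (x / h) := by
        rw [← Real.cosh_abs]
        have h3 := Real.add_one_le_exp |x / h|
        have h4 := Real.self_le_sinh_iff.2 (abs_nonneg (x / h))
        exact h4.trans (Real.sinh_lt_cosh _).le
      rw [div_lt_iff₀ (by positivity)] at h1
      have : |M| < ε * (Real.cos (3 / 4) * Real.cosh (x / h)) := by
        calc |M| < |x / h| * (ε * Real.cos (3 / 4)) := h1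
          _ ≤ Real.cosh (x / h) * (ε * Real.cos (3 / 4)) := by gcongr
          _ = _ := by ring
      linarith [le_abs_self M]
    have hneg : ∀ z ∈ closedStrip h, R < |z.re| → v z < 0 := by
      intro z hz hzR
      have h1 := hM z hz
      have h2 := mul_le_mul_of_nonneg_left (growthBarrier_ge hh hz) hε.le
      have h3 := hR _ hzR
      simp only [hv]; linarith
    have hKc : IsCompact (closedStrip h ∩ {z : ℂ | |z.re| ≤ R}) := by
      apply Metric.isCompact_of_isClosed_isBounded
      · exact (isClosed_closedStrip h).inter
          (isClosed_le (continuous_abs.comp Complex.continuous_re) continuous_const)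
      · refine (Metric.isBounded_iff_subset_closedBall (0 : ℂ)).2 ⟨R + h, ?_⟩
        rintro z ⟨⟨h1, h2⟩, h3⟩
        rw [mem_closedBall_zero_iff]
        refine (Complex.norm_le_abs_re_add_abs_im z).trans (add_le_add h3 ?_)
        exact abs_le.2 ⟨h1, by linarith⟩
    obtain ⟨p, ⟨hp, hpR⟩, hmax⟩ := hKc.exists_isMaxOn ⟨z₀, hz₀, hR0⟩ (hvc.mono inter_subset_left)
    have hvp : 0 < v p := lt_of_lt_of_le hpos (hmax ⟨hz₀, hR0⟩)
    have hmax' : ∀ z ∈ closedStrip h, v z ≤ v p := by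
      intro z hz
      by_cases hzR : |z.re| ≤ R
      · exact hmax ⟨hz, hzR⟩
      · exact ((hneg z hz (not_le.1 hzR)).trans hvp).le
    have hBp : ∀ z ∈ closedStrip h, 0 < growthBarrier h z := fun z hz =>
      lt_of_lt_of_le (mul_pos hκ (Real.cosh_pos _)) (growthBarrier_ge hh hz)
    have hps : p ∈ strip h := by
      obtain ⟨h1, h2⟩ := hp
      have e : p = ⟨p.re, p.im⟩ := rfl
      refine ⟨lt_of_le_of_ne h1 fun h3 => ?_, lt_of_le_of_ne h2 fun h3 => ?_⟩
      · have := hbot p.re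
        rw [h3, ← e] at this
        have := mul_pos hε (hBp p ⟨h1, h2⟩)
        simp only [hv] at hvp; linarith
      · have := htop p.re
        rw [← h3, ← e] at this
        have := mul_pos hε (hBp p ⟨h1, h2⟩)
        simp only [hv] at hvp; linarith
    have hloc : IsLocalMax v p := by
      filter_upwards [(isOpen_strip h).mem_nhds hps] with z hz
      exact hmax' z (strip_subset_closedStrip h hz)
    have hB2 : ContDiffAt ℝ 2 (ε • growthBarrier h) p :=
      (contDiff_growthBarrier h).contDiffAt.const_smul ε
    have hv2 : v = u - ε • growthBarrier h := by ext z; simp [hv]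
    -- At an interior maximum the Laplacian of `v` is at most zero, whereas subharmonicity of `u`
    -- and strict superharmonicity of the barrier make it positive.
    have hle := laplacian_nonpos_of_isLocalMax (by rw [hv2]; exact (hu p hps).sub hB2) hloc
    rw [hv2, (hu p hps).laplacian_sub hB2, InnerProductSpace.laplacian_smul _
      (contDiff_growthBarrier h).contDiffAt, laplacian_growthBarrier] at hle
    have h5 := hΔ p hps
    have h6 : 1 / h ^ 2 - (3 / (2 * h)) ^ 2 < 0 := by
      have : 1 / h ^ 2 - (3 / (2 * h)) ^ 2 = -(5 / (4 * h ^ 2)) := by field_simp; norm_num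
      rw [this]; simp; positivity
    have h7 := mul_neg_of_neg_of_pos h6 (hBp p hp)
    have h8 := mul_neg_of_pos_of_neg hε h7
    simp only [smul_eq_mul] at hle
    linarith
  intro z hz
  by_contra! hpos
  have hB : 0 < growthBarrier h z :=
    lt_of_lt_of_le (mul_pos hκ (Real.cosh_pos _)) (growthBarrier_ge hh hz)
  -- This `ε` makes the barrier term equal to half of `u z`, which replaces the passage to the limit
  -- `ε → 0`.
  have := key (u z / (2 * growthBarrier h z)) (by positivity) z hz
  have e : u z / (2 * growthBarrier h z) * growthBarrier h z = u z / 2 := by field_simp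
  rw [e] at this
  linarith

/-- Allows any harmonic extension supplied by `HasDN` to be replaced by the explicit Fourier one. -/
theorem IsStripExtension.unique {h : ℝ} (hh : 0 < h) {w : ℝ → ℝ} {W₁ W₂ : ℂ → ℝ}
    (h₁ : IsStripExtension h w W₁) (h₂ : IsStripExtension h w W₂) :
    ∀ z ∈ closedStrip h, W₁ z = W₂ z := by
  have key : ∀ {W₁ W₂ : ℂ → ℝ}, IsStripExtension h w W₁ → IsStripExtension h w W₂ →
      ∀ z ∈ closedStrip h, (W₁ - W₂) z ≤ 0 := by
    intro W₁ W₂ h₁ h₂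
    have hH := h₁.harmonic.sub h₂.harmonic
    obtain ⟨C₁, hC₁⟩ := h₁.bounded
    obtain ⟨C₂, hC₂⟩ := h₂.bounded
    refine strip_maximum_principle hh (M := C₁ + C₂) (fun z hz => (hH z hz).1)
      (fun z hz => ((hH z hz).2.self_of_nhds).ge) (h₁.continuousOn.sub h₂.continuousOn) ?_ ?_ ?_
    · intro z hz
      have := abs_le.1 (hC₁ z hz)
      have := abs_le.1 (hC₂ z hz)
      simp only [Pi.sub_apply]; linarith
    · intro x; simp [h₁.bottom, h₂.bottom]
    · intro x; simp [h₁.top, h₂.top]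
  intro z hz
  have a := key h₁ h₂ z hz
  have b := key h₂ h₁ z hz
  simp only [Pi.sub_apply] at a b
  linarith

/-! ### Linear decay at the boundary for `C^{1,a}` data -/

/-- Bounds of `C^{1,a}` type with constant `K`. -/
structure HolderFlat (a K : ℝ) (f : ℝ → ℝ) : Prop where
  diff : Differentiable ℝ f
  bound : ∀ x, |f x| ≤ K
  deriv_bound : ∀ x, |deriv f x| ≤ K
  taylor : ∀ x t, |f (x + t) - f x - deriv f x * t| ≤ K * |t| ^ (1 + a)

theorem HolderFlat.nonneg {a K : ℝ} {f : ℝ → ℝ} (hf : HolderFlat a K f) : 0 ≤ K :=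
  (abs_nonneg _).trans (hf.bound 0)

/-- A superharmonic function in the lower half plane which is comparable to `|x - x₀| ^ p` on the
real line and to `|y|` on the line `x = x₀`. -/
def cornerBarrier (p c m x₀ : ℝ) (z : ℂ) : ℝ :=
  ((z.re - x₀) ^ 2 + z.im ^ 2) ^ (p / 2) - c * (-z.im) ^ p - m * z.im

theorem contDiffAt_cornerBarrier (p c m x₀ : ℝ) {z : ℂ} (hz : z.im < 0) :
    ContDiffAt ℝ 2 (cornerBarrier p c m x₀) z := by
  unfold cornerBarrier
  have h1 : ContDiffAt ℝ 2 (fun z : ℂ => (z.re - x₀) ^ 2 + z.im ^ 2) z :=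
    (((contDiff_re.sub contDiff_const).pow 2).add (contDiff_im.pow 2)).contDiffAt
  have h2 : (z.re - x₀) ^ 2 + z.im ^ 2 ≠ 0 := by
    have := sq_pos_of_neg hz
    positivity
  exact ((h1.rpow_const_of_ne h2).sub (contDiffAt_const.mul
    (contDiff_im.contDiffAt.neg.rpow_const_of_ne (by linarith)))).sub
    (contDiffAt_const.mul contDiff_im.contDiffAt)

theorem hasDerivAt_rpow_quadratic {p q s t : ℝ} (h : (s + t) ^ 2 + q ≠ 0) :
    HasDerivAt (fun t : ℝ => ((s + t) ^ 2 + q) ^ p)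
      (2 * p * (s + t) * ((s + t) ^ 2 + q) ^ (p - 1)) t := by
  have h1 : HasDerivAt (fun t : ℝ => (s + t) ^ 2 + q) (2 * (s + t)) t := by
    have := ((((hasDerivAt_id t).const_add s).pow 2).add_const q)
    simpa using this
  have := h1.rpow_const (p := p) (Or.inl h)
  exact this.congr_deriv (by ring)

theorem deriv_deriv_rpow_quadratic {p q s : ℝ} (h : s ^ 2 + q ≠ 0) :
    deriv (deriv fun t : ℝ => ((s + t) ^ 2 + q) ^ p) 0 =
      2 * p * (s ^ 2 + q) ^ (p - 1) + 4 * p * (p - 1) * s ^ 2 * (s ^ 2 + q) ^ (p - 2) := by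
  have hc : Continuous (fun t : ℝ => (s + t) ^ 2 + q) := by fun_prop
  have hev : ∀ᶠ t in 𝓝 (0 : ℝ), (s + t) ^ 2 + q ≠ 0 :=
    hc.continuousAt.eventually_ne (by simpa using h)
  have h1 : deriv (fun t : ℝ => ((s + t) ^ 2 + q) ^ p) =ᶠ[𝓝 0]
      fun t => 2 * p * (s + t) * ((s + t) ^ 2 + q) ^ (p - 1) := by
    filter_upwards [hev] with t ht using (hasDerivAt_rpow_quadratic ht).deriv
  have h2 : HasDerivAt (fun t : ℝ => 2 * p * (s + t)) (2 * p) 0 := by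
    simpa using ((hasDerivAt_id (0 : ℝ)).const_add s).const_mul (2 * p)
  have h3 := h2.mul (hasDerivAt_rpow_quadratic (p := p - 1) (q := q) (s := s) (t := 0)
    (by simpa using h))
  have h4 : HasDerivAt (fun t : ℝ => 2 * p * (s + t) * ((s + t) ^ 2 + q) ^ (p - 1)) _ 0 := h3
  rw [h1.deriv_eq, h4.deriv]
  simp only [add_zero]
  have : p - 1 - 1 = p - 2 := by ring
  rw [this]; ring

/-- The Laplacian of `|z - x₀|^p` is `p²|z - x₀|^(p-2)`. With `c = p/(p-1)`, that of `c|y|^p` is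
`p²|y|^(p-2)`, which is at least as large since `p < 2` and `|y| ≤ |z - x₀|`. -/
theorem laplacian_cornerBarrier_nonpos {p m x₀ : ℝ} (hp1 : 1 < p) (hp2 : p < 2) {z : ℂ}
    (hz : z.im < 0) : Laplacian.laplacian (cornerBarrier p (p / (p - 1)) m x₀) z ≤ 0 := by
  rw [laplacian_eq_lines (contDiffAt_cornerBarrier _ _ _ _ hz)]
  set x := z.re - x₀ with hx
  set y := z.im with hy
  set c := p / (p - 1)
  have hy2 : 0 < y ^ 2 := sq_pos_of_neg hz
  have hR : 0 < x ^ 2 + y ^ 2 := by positivity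
  have h1 : deriv (deriv fun t : ℝ => cornerBarrier p c m x₀ (z + t • (1 : ℂ))) 0 =
      2 * (p / 2) * (x ^ 2 + y ^ 2) ^ (p / 2 - 1) +
        4 * (p / 2) * (p / 2 - 1) * x ^ 2 * (x ^ 2 + y ^ 2) ^ (p / 2 - 2) := by
    have e : (fun t : ℝ => cornerBarrier p c m x₀ (z + t • (1 : ℂ))) =
        fun t => ((x + t) ^ 2 + y ^ 2) ^ (p / 2) - (c * (-y) ^ p + m * y) := by
      ext t
      simp [cornerBarrier, hx, hy]
      ring_nf
    rw [e]
    have e2 : deriv (fun t : ℝ => ((x + t) ^ 2 + y ^ 2) ^ (p / 2) - (c * (-y) ^ p + m * y)) =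
        deriv (fun t : ℝ => ((x + t) ^ 2 + y ^ 2) ^ (p / 2)) := by
      ext t; rw [deriv_sub_const]
    rw [e2, deriv_deriv_rpow_quadratic hR.ne']
  have h2 : deriv (deriv fun t : ℝ => cornerBarrier p c m x₀ (z + t • Complex.I)) 0 =
      2 * (p / 2) * (y ^ 2 + x ^ 2) ^ (p / 2 - 1) +
        4 * (p / 2) * (p / 2 - 1) * y ^ 2 * (y ^ 2 + x ^ 2) ^ (p / 2 - 2)
        - c * (p * (p - 1) * (-y) ^ (p - 2)) := by
    have e : (fun t : ℝ => cornerBarrier p c m x₀ (z + t • Complex.I)) =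
        fun t => ((y + t) ^ 2 + x ^ 2) ^ (p / 2) - (c * (-(y + t)) ^ p + m * (y + t)) := by
      ext t
      simp [cornerBarrier, hx, hy]
      ring_nf
    have hg : ∀ t : ℝ, HasDerivAt (fun t : ℝ => c * (-(y + t)) ^ p + m * (y + t))
        (c * (-p * (-(y + t)) ^ (p - 1)) + m) t := by
      intro t
      have a1 : HasDerivAt (fun t : ℝ => y + t) 1 t := (hasDerivAt_id t).const_add y
      have a2 := (a1.fun_neg.rpow_const (p := p) (Or.inr hp1.le)).const_mul c
      have := a2.fun_add (a1.const_mul m)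
      exact this.congr_deriv (by ring)
    have hg2 : deriv (deriv fun t : ℝ => c * (-(y + t)) ^ p + m * (y + t)) 0 =
        c * (p * (p - 1) * (-y) ^ (p - 2)) := by
      have : deriv (fun t : ℝ => c * (-(y + t)) ^ p + m * (y + t)) =
        fun t => c * (-p * (-(y + t)) ^ (p - 1)) + m := by ext t; exact (hg t).deriv
      rw [this]
      have a1 : HasDerivAt (fun t : ℝ => y + t) 1 0 := (hasDerivAt_id _).const_add y
      have a2 := (a1.fun_neg.rpow_const (p := p - 1) (Or.inl (by simp; linarith)))
      have a3 : HasDerivAt (fun t : ℝ => c * (-p * (-(y + t)) ^ (p - 1)) + m) _ 0 :=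
        ((a2.const_mul (-p)).const_mul c).add_const m
      rw [a3.deriv]
      have : p - 1 - 1 = p - 2 := by ring
      simp only [add_zero, this]; ring
    rw [e]
    have hc : Continuous (fun t : ℝ => (y + t) ^ 2 + x ^ 2) := by fun_prop
    have hR' : y ^ 2 + x ^ 2 ≠ 0 := by positivity
    have hev : ∀ᶠ t in 𝓝 (0 : ℝ), (y + t) ^ 2 + x ^ 2 ≠ 0 :=
      hc.continuousAt.eventually_ne (by simpa using hR')
    have e2 : deriv (fun t : ℝ => ((y + t) ^ 2 + x ^ 2) ^ (p / 2) -
          (c * (-(y + t)) ^ p + m * (y + t))) =ᶠ[𝓝 0]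
        deriv (fun t : ℝ => ((y + t) ^ 2 + x ^ 2) ^ (p / 2)) -
          deriv (fun t : ℝ => c * (-(y + t)) ^ p + m * (y + t)) := by
      filter_upwards [hev] with t ht
      exact deriv_fun_sub (hasDerivAt_rpow_quadratic ht).differentiableAt (hg t).differentiableAt
    have hd1 : DifferentiableAt ℝ (deriv fun t : ℝ => ((y + t) ^ 2 + x ^ 2) ^ (p / 2)) 0 := by
      have h3 : (deriv fun t : ℝ => ((y + t) ^ 2 + x ^ 2) ^ (p / 2)) =ᶠ[𝓝 0]
        fun t => 2 * (p / 2) * (y + t) * ((y + t) ^ 2 + x ^ 2) ^ (p / 2 - 1) := by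
        filter_upwards [hev] with t ht using (hasDerivAt_rpow_quadratic ht).deriv
      rw [h3.differentiableAt_iff]
      exact DifferentiableAt.mul (by fun_prop)
        (hasDerivAt_rpow_quadratic (by simpa using hR')).differentiableAt
    have hd2 : DifferentiableAt ℝ (deriv fun t : ℝ => c * (-(y + t)) ^ p + m * (y + t)) 0 := by
      have : deriv (fun t : ℝ => c * (-(y + t)) ^ p + m * (y + t)) =
        fun t => c * (-p * (-(y + t)) ^ (p - 1)) + m := by ext t; exact (hg t).deriv
      rw [this]
      have a1 : HasDerivAt (fun t : ℝ => y + t) 1 0 := (hasDerivAt_id _).const_add y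
      have a2 := (a1.fun_neg.rpow_const (p := p - 1) (Or.inl (by simp; linarith)))
      exact (((a2.const_mul (-p)).const_mul c).add_const m).differentiableAt
    rw [e2.deriv_eq, deriv_sub hd1 hd2, hg2, deriv_deriv_rpow_quadratic hR']
  rw [h1, h2]
  have hcomm : y ^ 2 + x ^ 2 = x ^ 2 + y ^ 2 := add_comm _ _
  rw [hcomm]
  set R := x ^ 2 + y ^ 2 with hRdef
  have hpow : R * R ^ (p / 2 - 2) = R ^ (p / 2 - 1) := by
    rw [← Real.rpow_one_add' hR.le (by linarith)]; ring_nf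
  have hle : R ^ (p / 2 - 1) ≤ (-y) ^ (p - 2) := by
    have : (-y) ^ (p - 2) = (y ^ 2) ^ (p / 2 - 1) := by
      rw [← neg_sq y, ← Real.rpow_natCast_mul (by linarith)]
      congr 1; push_cast; ring
    rw [this]
    exact Real.rpow_le_rpow_of_nonpos hy2 (by nlinarith [sq_nonneg x]) (by linarith)
  have hcp : c * (p * (p - 1) * (-y) ^ (p - 2)) = p ^ 2 * (-y) ^ (p - 2) := by
    have : p - 1 ≠ 0 := by linarith
    simp only [c]; field_simp
  rw [hcp]
  have : 2 * (p / 2) * R ^ (p / 2 - 1) + 4 * (p / 2) * (p / 2 - 1) * x ^ 2 * R ^ (p / 2 - 2) +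
      (2 * (p / 2) * R ^ (p / 2 - 1) + 4 * (p / 2) * (p / 2 - 1) * y ^ 2 * R ^ (p / 2 - 2)
        - p ^ 2 * (-y) ^ (p - 2)) =
      2 * p * R ^ (p / 2 - 1) + p * (p - 2) * (R * R ^ (p / 2 - 2)) - p ^ 2 * (-y) ^ (p - 2) := by
    rw [hRdef]; ring
  rw [this, hpow]
  nlinarith [sq_nonneg p]

theorem le_one_add_rpow {x p : ℝ} (hx : 0 ≤ x) (hp : 1 ≤ p) : x ≤ 1 + x ^ p := by
  rcases le_total x 1 with h | h
  · linarith [Real.rpow_nonneg hx p]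
  · have := Real.rpow_le_rpow_of_exponent_le h hp
    rw [Real.rpow_one] at this; linarith

theorem sq_rpow_half (t p : ℝ) : (t ^ 2) ^ (p / 2) = |t| ^ p := by
  rw [← sq_abs, ← Real.rpow_natCast_mul (abs_nonneg t)]
  congr 1; push_cast; ring

/-- The bounded harmonic extension of `C^{1,a}` data approaches its boundary values linearly. -/
theorem exists_linear_decay {h a : ℝ} (hh : 0 < h) (ha0 : 0 < a) (ha1 : a < 1) :
    ∃ C > 0, ∀ (f : ℝ → ℝ) (K : ℝ) (W : ℂ → ℝ), HolderFlat a K f → IsStripExtension h f W →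
      ∀ x, ∀ t ∈ Icc 0 h, |f x - W ⟨x, -t⟩| ≤ C * K * t := by
  set p := 1 + a with hp
  set c := p / (p - 1) with hc
  have hc1 : 1 ≤ c := by rw [hc, le_div_iff₀ (by linarith)]; linarith
  -- Chosen so that on the bottom the barrier is at least `|x - x₀|^p + 2`, enough to dominate the
  -- tangent line `Λ` there.
  set m := (2 + c * h ^ p) / h with hm
  have hhp : 0 < h ^ p := Real.rpow_pos_of_pos hh p
  have hm0 : 0 < m := by positivity
  have hmh : m * h = 2 + c * h ^ p := by rw [hm]; field_simp
  refine ⟨m, hm0, fun f K W hf hW x₀ t₀ ht₀ => ?_⟩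
  have hK := hf.nonneg
  set d := deriv f x₀ with hd
  set B := cornerBarrier p c m x₀ with hB
  set Λ : ℂ → ℝ := fun z => f x₀ + d * (z.re - x₀) with hΛ
  have hΛ2 : ContDiff ℝ 2 Λ := contDiff_const.add (contDiff_const.mul
    (contDiff_re.sub contDiff_const))
  have hΛΔ : ∀ z, Laplacian.laplacian Λ z = 0 := by
    intro z
    rw [laplacian_eq_lines hΛ2.contDiffAt]
    have e1 : (fun t : ℝ => Λ (z + t • (1 : ℂ))) = fun t => f x₀ + d * (z.re - x₀) + d * t := by
      ext t; simp [hΛ]; ring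
    have e2 : (fun t : ℝ => Λ (z + t • Complex.I)) = fun t => f x₀ + d * (z.re - x₀) := by
      ext t; simp [hΛ]
    rw [e1, e2]
    have : deriv (fun t : ℝ => f x₀ + d * (z.re - x₀) + d * t) = fun _ => d := by
      ext t; simp
    rw [this]; simp
  have hBc : Continuous B := by
    rw [hB]; unfold cornerBarrier
    have h1 : Continuous fun z : ℂ => ((z.re - x₀) ^ 2 + z.im ^ 2) ^ (p / 2) :=
      (((Complex.continuous_re.sub continuous_const).pow 2).add
        (Complex.continuous_im.pow 2)).rpow_const fun _ => Or.inr (by linarith)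
    have h2 : Continuous fun z : ℂ => (-z.im) ^ p :=
      Complex.continuous_im.neg.rpow_const fun _ => Or.inr (by linarith)
    exact (h1.sub (continuous_const.mul h2)).sub (continuous_const.mul Complex.continuous_im)
  have hdx : ∀ x : ℝ, |d * (x - x₀)| ≤ K * (1 + |x - x₀| ^ p) := by
    intro x
    rw [abs_mul]
    exact mul_le_mul (hf.deriv_bound x₀) (le_one_add_rpow (abs_nonneg _) (by linarith))
      (abs_nonneg _) hK
  have hBge : ∀ z ∈ closedStrip h, |z.re - x₀| ^ p - c * h ^ p ≤ B z := by
    rintro z ⟨h1, h2⟩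
    simp only [hB, cornerBarrier]
    have a1 : |z.re - x₀| ^ p ≤ ((z.re - x₀) ^ 2 + z.im ^ 2) ^ (p / 2) := by
      rw [← sq_rpow_half]
      exact Real.rpow_le_rpow (sq_nonneg _) (by nlinarith [sq_nonneg z.im]) (by linarith)
    have a2 : (-z.im) ^ p ≤ h ^ p := Real.rpow_le_rpow (by linarith) (by linarith) (by linarith)
    have a3 := mul_le_mul_of_nonneg_left a2 (by linarith : (0 : ℝ) ≤ c)
    have a4 := mul_nonpos_of_nonneg_of_nonpos hm0.le h2
    linarith
  obtain ⟨CW, hCW⟩ := hW.bounded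
  -- Both signs of `W - Λ` are compared with `K B`. On the top the Taylor remainder is at most `K|x
  -- - x₀|^(1+a)`, which is the barrier there. On the vertical line through `x₀` the barrier is at
  -- most `m t`, which gives the linear rate.
  have key : ∀ σ : ℝ, |σ| = 1 → ∀ z ∈ closedStrip h, σ * (W z - Λ z) - K * B z ≤ 0 := by
    intro σ hσ
    have hσle : ∀ v : ℝ, σ * v ≤ |v| := fun v => by
      calc σ * v ≤ |σ * v| := le_abs_self _
        _ = |v| := by rw [abs_mul, hσ, one_mul]
    have hu : (fun z => σ * (W z - Λ z) - K * B z) = σ • (W - Λ) - K • B := by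
      ext z; simp
    have hW2 : ∀ z ∈ strip h, ContDiffAt ℝ 2 W z := fun z hz => (hW.harmonic z hz).1
    have hB2 : ∀ z ∈ strip h, ContDiffAt ℝ 2 B z := fun z hz =>
      contDiffAt_cornerBarrier _ _ _ _ hz.2
    refine strip_maximum_principle hh (M := CW + K + K + K * (c * h ^ p)) ?_ ?_ ?_ ?_ ?_ ?_
    · intro z hz
      rw [hu]
      exact (((hW2 z hz).sub hΛ2.contDiffAt).const_smul σ).sub ((hB2 z hz).const_smul K)
    · intro z hz
      have h1 : ContDiffAt ℝ 2 (W - Λ) z := (hW2 z hz).sub hΛ2.contDiffAt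
      have h2 : ContDiffAt ℝ 2 (σ • (W - Λ)) z := h1.const_smul σ
      have h3 : ContDiffAt ℝ 2 (K • B) z := (hB2 z hz).const_smul K
      rw [hu, h2.laplacian_sub h3, InnerProductSpace.laplacian_smul _ h1,
        InnerProductSpace.laplacian_smul _ (hB2 z hz), (hW2 z hz).laplacian_sub hΛ2.contDiffAt,
        hΛΔ, (hW.harmonic z hz).2.self_of_nhds]
      have := laplacian_cornerBarrier_nonpos (m := m) (x₀ := x₀) (by linarith : 1 < p)
        (by linarith) hz.2
      have := mul_nonpos_of_nonneg_of_nonpos hK this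
      simp only [smul_eq_mul, Pi.zero_apply, sub_zero, mul_zero, zero_sub]
      linarith
    · exact ((hW.continuousOn.sub hΛ2.continuous.continuousOn).const_smul σ).sub
        (hBc.continuousOn.const_smul K)
    · intro z hz
      have h1 := hσle (W z - Λ z)
      have h2 : |W z - Λ z| ≤ CW + (K + K * (1 + |z.re - x₀| ^ p)) :=
        (abs_sub _ _).trans (add_le_add (hCW z hz)
          ((abs_add_le _ _).trans (add_le_add (hf.bound x₀) (hdx z.re))))
      have h3 := mul_le_mul_of_nonneg_left (hBge z hz) hK
      linarith
    · intro x
      have h1 := hσle (W ⟨x, -h⟩ - Λ ⟨x, -h⟩)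
      rw [hW.bottom, zero_sub, abs_neg] at h1
      have h2 : |Λ ⟨x, -h⟩| ≤ K + K * (1 + |x - x₀| ^ p) :=
        (abs_add_le _ _).trans (add_le_add (hf.bound x₀) (hdx x))
      have h3 : |x - x₀| ^ p + 2 ≤ B ⟨x, -h⟩ := by
        simp only [hB, cornerBarrier, neg_neg, mul_neg]
        have a1 : |x - x₀| ^ p ≤ ((x - x₀) ^ 2 + (-h) ^ 2) ^ (p / 2) := by
          rw [← sq_rpow_half]
          exact Real.rpow_le_rpow (sq_nonneg _) (by nlinarith [sq_nonneg h]) (by linarith)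
        linarith
      have h4 := mul_le_mul_of_nonneg_left h3 hK
      rw [hW.bottom, zero_sub]
      linarith
    · intro x
      have h1 := hσle (W ⟨x, 0⟩ - Λ ⟨x, 0⟩)
      have h2 := hf.taylor x₀ (x - x₀)
      have h3 : B ⟨x, 0⟩ = |x - x₀| ^ p := by
        simp only [hB, cornerBarrier]
        rw [show ((x - x₀) ^ 2 + (0 : ℝ) ^ 2) = (x - x₀) ^ 2 by ring, sq_rpow_half]
        simp [Real.zero_rpow (by linarith : p ≠ 0)]
      have h4 : W ⟨x, 0⟩ - Λ ⟨x, 0⟩ = f (x₀ + (x - x₀)) - f x₀ - d * (x - x₀) := by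
        rw [hW.top]; simp [hΛ]; ring
      rw [h3]
      rw [h4] at h1 ⊢
      linarith
  have hz : (⟨x₀, -t₀⟩ : ℂ) ∈ closedStrip h := ⟨by simpa using ht₀.2, by simpa using ht₀.1⟩
  have h1 := key 1 (by simp) _ hz
  have h2 := key (-1) (by simp) _ hz
  have h3 : Λ ⟨x₀, -t₀⟩ = f x₀ := by simp [hΛ]
  have h4 : B ⟨x₀, -t₀⟩ ≤ m * t₀ := by
    simp only [hB, cornerBarrier, sub_self, neg_neg, mul_neg, neg_sq]
    rw [show ((0 : ℝ) ^ 2 + t₀ ^ 2) = t₀ ^ 2 by ring, sq_rpow_half, abs_of_nonneg ht₀.1]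
    nlinarith [Real.rpow_nonneg ht₀.1 p]
  have h5 := mul_le_mul_of_nonneg_left h4 hK
  rw [h3] at h1 h2
  rw [abs_le]
  constructor <;> nlinarith

/-! ### Cosine series and their harmonic extensions to the strip -/

theorem norm_complex_sin_le (z : ℂ) : ‖Complex.sin z‖ ≤ Real.cosh z.im := by
  rw [Complex.sin, Real.cosh_eq]
  have h1 : ‖Complex.exp (-z * Complex.I)‖ = Real.exp z.im := by
    rw [Complex.norm_exp]; simp
  have h2 : ‖Complex.exp (z * Complex.I)‖ = Real.exp (-z.im) := by
    rw [Complex.norm_exp]; simp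
  rw [norm_div, norm_mul, Complex.norm_I, mul_one, Complex.norm_ofNat]
  gcongr
  calc _ ≤ _ := norm_sub_le _ _
    _ = _ := by rw [h1, h2]

theorem norm_complex_cos_le (z : ℂ) : ‖Complex.cos z‖ ≤ Real.cosh z.im := by
  rw [Complex.cos, Real.cosh_eq]
  have h1 : ‖Complex.exp (-z * Complex.I)‖ = Real.exp z.im := by
    rw [Complex.norm_exp]; simp
  have h2 : ‖Complex.exp (z * Complex.I)‖ = Real.exp (-z.im) := by
    rw [Complex.norm_exp]; simp
  rw [norm_div, Complex.norm_ofNat]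
  gcongr
  calc _ ≤ _ := norm_add_le _ _
    _ = _ := by rw [h1, h2, add_comm]

def cosSeries (c : ℕ → ℝ) (x : ℝ) : ℝ := ∑' k, c k * Real.cos (k * x)

/-- `sin (k (z + i h)) / sinh (k h)`, which is `0` for `k = 0`. -/
def stripMode (h : ℝ) (k : ℕ) (z : ℂ) : ℂ :=
  Complex.sin (k * (z + h * Complex.I)) / Real.sinh (k * h)

/-- A holomorphic function whose imaginary part is the strip extension of `cosSeries c`. -/
def stripHol (h : ℝ) (c : ℕ → ℝ) (z : ℂ) : ℂ :=
  c 0 * ((z + h * Complex.I) / h) + ∑' k, c k * stripMode h k z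

/-- The symbol of the Dirichlet–Neumann operator of the strip. -/
def dnSymbol (h : ℝ) (k : ℕ) : ℝ :=
  if k = 0 then 1 / h else k * Real.cosh (k * h) / Real.sinh (k * h)

/-- The strip of half-width `h + ρ` around the line `y = -h`. -/
def bigStrip (h ρ : ℝ) : Set ℂ := {z | |z.im + h| < h + ρ}

/-- The ratio `exp (kh) / sinh (kh)` decreases in `k ≥ 1`; this is its value at `k = 1`. -/
def modeConst (h : ℝ) : ℝ := 2 / (1 - Real.exp (-(2 * h)))

theorem modeConst_pos {h : ℝ} (hh : 0 < h) : 0 < modeConst h := by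
  have : Real.exp (-(2 * h)) < 1 := by rw [Real.exp_lt_one_iff]; linarith
  unfold modeConst
  exact div_pos two_pos (by linarith)

theorem exp_le_modeConst_mul_sinh {h : ℝ} (hh : 0 < h) {k : ℕ} (hk : k ≠ 0) :
    Real.exp (k * h) ≤ modeConst h * Real.sinh (k * h) := by
  have h1 : Real.exp (-(2 * h)) < 1 := by rw [Real.exp_lt_one_iff]; linarith
  have hk1 : (1 : ℝ) ≤ k := by exact_mod_cast Nat.one_le_iff_ne_zero.2 hk
  have h2 : Real.exp (-(k * h)) ≤ Real.exp (k * h) * Real.exp (-(2 * h)) := by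
    rw [← Real.exp_add]; apply Real.exp_le_exp.2; nlinarith
  rw [modeConst, Real.sinh_eq, div_mul_div_comm, le_div_iff₀ (by linarith)]
  nlinarith

theorem sinh_nat_mul_pos {h : ℝ} (hh : 0 < h) {k : ℕ} (hk : k ≠ 0) : 0 < Real.sinh (k * h) := by
  have : (0 : ℝ) < k := by exact_mod_cast Nat.pos_of_ne_zero hk
  exact Real.sinh_pos_iff.2 (by positivity)

theorem cosh_div_sinh_le {h ρ t : ℝ} (hh : 0 < h) (k : ℕ)
    (ht : |t| ≤ h + ρ) : Real.cosh (k * t) / Real.sinh (k * h) ≤ modeConst h * Real.exp (k * ρ) := by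
  rcases eq_or_ne k 0 with rfl | hk
  -- At `k = 0` the quotient is a division by `sinh 0 = 0`, hence `0`.
  · simp [(modeConst_pos hh).le]
  rw [div_le_iff₀ (sinh_nat_mul_pos hh hk)]
  have h1 : Real.cosh (k * t) ≤ Real.exp (k * (h + ρ)) := by
    rw [← Real.cosh_abs]
    have h3 : |(k : ℝ) * t| ≤ k * (h + ρ) := by
      rw [abs_mul, Nat.abs_cast]; gcongr
    refine le_trans ?_ (Real.exp_le_exp.2 h3)
    rw [Real.cosh_eq]
    have := Real.exp_le_exp.2 (neg_le_self (abs_nonneg ((k : ℝ) * t)))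
    linarith
  calc _ ≤ _ := h1
    _ = Real.exp (k * h) * Real.exp (k * ρ) := by rw [← Real.exp_add]; ring_nf
    _ ≤ (modeConst h * Real.sinh (k * h)) * Real.exp (k * ρ) := by
        gcongr; exact exp_le_modeConst_mul_sinh hh hk
    _ = _ := by ring

theorem im_nat_mul_add (h : ℝ) (k : ℕ) (z : ℂ) :
    ((k : ℂ) * (z + h * Complex.I)).im = k * (z.im + h) := by simp

theorem norm_stripMode_le {h ρ : ℝ} (hh : 0 < h) (k : ℕ) {z : ℂ} (hz : |z.im + h| ≤ h + ρ) :
    ‖stripMode h k z‖ ≤ modeConst h * Real.exp (k * ρ) := by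
  refine le_trans ?_ (cosh_div_sinh_le hh k hz)
  rw [stripMode, norm_div, Complex.norm_real, Real.norm_of_nonneg
    (Real.sinh_nonneg_iff.2 (by positivity)), ← im_nat_mul_add]
  gcongr
  exact norm_complex_sin_le _

theorem hasDerivAt_stripMode (h : ℝ) (k : ℕ) (z : ℂ) :
    HasDerivAt (stripMode h k)
      (k * Complex.cos (k * (z + h * Complex.I)) / Real.sinh (k * h)) z := by
  have h1 : HasDerivAt (fun z : ℂ => (k : ℂ) * (z + h * Complex.I)) (k * 1) z :=
    ((hasDerivAt_id z).add_const _).const_mul _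
  exact (h1.csin.div_const _).congr_deriv (by ring)

theorem norm_deriv_stripMode_le {h ρ : ℝ} (hh : 0 < h) (k : ℕ) {z : ℂ}
    (hz : |z.im + h| ≤ h + ρ) :
    ‖deriv (stripMode h k) z‖ ≤ k * (modeConst h * Real.exp (k * ρ)) := by
  rw [(hasDerivAt_stripMode h k z).deriv, mul_div_assoc, norm_mul, Complex.norm_natCast]
  gcongr
  refine le_trans ?_ (cosh_div_sinh_le hh k hz)
  rw [norm_div, Complex.norm_real, Real.norm_of_nonneg
    (Real.sinh_nonneg_iff.2 (by positivity)), ← im_nat_mul_add]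
  gcongr
  exact norm_complex_cos_le _

theorem isOpen_bigStrip (h ρ : ℝ) : IsOpen (bigStrip h ρ) :=
  isOpen_lt ((Complex.continuous_im.add continuous_const).abs) continuous_const

theorem strip_subset_bigStrip {h ρ : ℝ} (hρ : 0 ≤ ρ) : strip h ⊆ bigStrip h ρ := by
  rintro z ⟨h1, h2⟩
  change |z.im + h| < h + ρ
  exact abs_lt.2 ⟨by linarith, by linarith⟩

theorem closedStrip_subset_bigStrip {h ρ : ℝ} (hh : 0 < h) (hρ : 0 < ρ) :
    closedStrip h ⊆ bigStrip h ρ := by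
  rintro z ⟨h1, h2⟩
  change |z.im + h| < h + ρ
  exact abs_lt.2 ⟨by linarith, by linarith⟩

section Series

variable {h ρ : ℝ} {c : ℕ → ℝ}

theorem norm_coeff_stripMode_le (hh : 0 < h) (k : ℕ) {z : ℂ} (hz : |z.im + h| ≤ h + ρ) :
    ‖(c k : ℂ) * stripMode h k z‖ ≤ |c k| * Real.exp (k * ρ) * modeConst h := by
  rw [norm_mul, Complex.norm_real, Real.norm_eq_abs, mul_assoc, mul_comm (Real.exp _)]
  gcongr
  exact norm_stripMode_le hh k hz

/-- The extra decay `exp (-kρ)` of the coefficients pushes convergence a distance `ρ` beyond the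
top, and by symmetry about `y = -h` equally far below the reflected strip. Boundary derivatives thus
become interior complex derivatives. -/
theorem differentiableOn_stripHol (hh : 0 < h)
    (hc : Summable fun k => |c k| * Real.exp (k * ρ)) :
    DifferentiableOn ℂ (stripHol h c) (bigStrip h ρ) := by
  unfold stripHol
  refine DifferentiableOn.add (by fun_prop) ?_
  refine Complex.differentiableOn_tsum_of_summable_norm (hc.mul_right (modeConst h))
    (fun k => ?_) (isOpen_bigStrip h ρ) (fun k z hz => norm_coeff_stripMode_le hh k (le_of_lt hz))
  intro z _
  exact ((hasDerivAt_stripMode h k z).const_mul _).differentiableAt.differentiableWithinAt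

theorem continuousOn_stripHol (hh : 0 < h) (hc : Summable fun k => |c k|) :
    ContinuousOn (stripHol h c) (closedStrip h) := by
  unfold stripHol
  refine ContinuousOn.add (by fun_prop) ?_
  refine continuousOn_tsum (u := fun k => |c k| * Real.exp (k * 0) * modeConst h) (fun k => ?_)
    (by simpa using hc.mul_right (modeConst h)) ?_
  · intro z _
    exact ((hasDerivAt_stripMode h k z).const_mul _).continuousAt.continuousWithinAt
  · rintro k z ⟨h1, h2⟩
    exact norm_coeff_stripMode_le hh k (abs_le.2 ⟨by linarith, by linarith⟩)

theorem hasSum_deriv_stripHol (hh : 0 < h) (hc : Summable fun k => |c k| * Real.exp (k * ρ))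
    {z : ℂ} (hz : z ∈ bigStrip h ρ) :
    HasSum (fun k => (c k : ℂ) * deriv (stripMode h k) z)
      (deriv (stripHol h c) z - c 0 / h) := by
  have hd : ∀ k, DifferentiableAt ℂ (fun z => (c k : ℂ) * stripMode h k z) z := fun k =>
    ((hasDerivAt_stripMode h k z).const_mul _).differentiableAt
  have h1 := Complex.hasSum_deriv_of_summable_norm (F := fun k z => (c k : ℂ) * stripMode h k z)
    (hc.mul_right (modeConst h)) (fun k z _ =>
      ((hasDerivAt_stripMode h k z).const_mul _).differentiableAt.differentiableWithinAt)
    (isOpen_bigStrip h ρ) (fun k z hz => norm_coeff_stripMode_le hh k (le_of_lt hz)) hz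
  have h2 : DifferentiableAt ℂ (fun z => ∑' k, (c k : ℂ) * stripMode h k z) z := by
    refine (Complex.differentiableOn_tsum_of_summable_norm (hc.mul_right (modeConst h))
      (fun k z _ => ?_) (isOpen_bigStrip h ρ)
      (fun k z hz => norm_coeff_stripMode_le hh k (le_of_lt hz))).differentiableAt
      ((isOpen_bigStrip h ρ).mem_nhds hz)
    exact ((hasDerivAt_stripMode h k z).const_mul _).differentiableAt.differentiableWithinAt
  have h3 : HasDerivAt (fun z : ℂ => (c 0 : ℂ) * ((z + h * Complex.I) / h)) (c 0 / h) z :=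
    ((((hasDerivAt_id z).add_const _).div_const (h : ℂ)).const_mul (c 0 : ℂ)).congr_deriv
      (by ring)
  have h4 : deriv (stripHol h c) z - c 0 / h =
      deriv (fun z => ∑' k, (c k : ℂ) * stripMode h k z) z := by
    have : HasDerivAt (stripHol h c) _ z := h3.add h2.hasDerivAt
    rw [this.deriv]; ring
  rw [h4]
  have e : (fun k => (c k : ℂ) * deriv (stripMode h k) z) =
      fun k => deriv (fun z => (c k : ℂ) * stripMode h k z) z := by
    ext k
    rw [deriv_const_mul _ (hasDerivAt_stripMode h k z).differentiableAt]
  rw [e]; exact h1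

theorem norm_deriv_stripHol_le (hh : 0 < h)
    (hc : Summable fun k => |c k| * (k * Real.exp (k * ρ))) {z : ℂ} (hz : z ∈ bigStrip h ρ) :
    ‖deriv (stripHol h c) z‖ ≤
      |c 0| / h + modeConst h * ∑' k, |c k| * (k * Real.exp (k * ρ)) := by
  have hc' : Summable fun k => |c k| * Real.exp (k * ρ) := by
    rw [← summable_nat_add_iff 1] at hc ⊢
    refine hc.of_nonneg_of_le (fun k => by positivity) fun k => ?_
    gcongr
    exact le_mul_of_one_le_left (Real.exp_pos _).le (by push_cast; linarith [k.cast_nonneg (α := ℝ)])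
  have h1 := hasSum_deriv_stripHol hh hc' hz
  have h2 : ∀ k, ‖(c k : ℂ) * deriv (stripMode h k) z‖ ≤
      |c k| * (k * Real.exp (k * ρ)) * modeConst h := by
    intro k
    rw [norm_mul, Complex.norm_real, Real.norm_eq_abs, mul_assoc]
    gcongr
    exact (norm_deriv_stripMode_le hh k (le_of_lt hz)).trans (le_of_eq (by ring))
  have h3 := tsum_of_norm_bounded (hc.mul_right (modeConst h)).hasSum h2
  rw [h1.tsum_eq, tsum_mul_right] at h3
  have h4 : deriv (stripHol h c) z = c 0 / h + (deriv (stripHol h c) z - c 0 / h) := by ring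
  rw [h4]
  refine (norm_add_le _ _).trans (add_le_add ?_ ?_)
  · rw [norm_div, Complex.norm_real, Complex.norm_real, Real.norm_eq_abs, Real.norm_of_nonneg hh.le]
  · rw [mul_comm]; exact h3

/-- The profile of the `k`-th harmonic of the strip extension. -/
def stripProfile (h : ℝ) (k : ℕ) (y : ℝ) : ℝ :=
  if k = 0 then (y + h) / h else Real.sinh (k * (y + h)) / Real.sinh (k * h)

theorem im_stripMode (h : ℝ) (k : ℕ) (z : ℂ) : (stripMode h k z).im =
    Real.cos (k * z.re) * (Real.sinh (k * (z.im + h)) / Real.sinh (k * h)) := by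
  have e : (k : ℂ) * (z + h * Complex.I) =
      ((k * z.re : ℝ) : ℂ) + ((k * (z.im + h) : ℝ) : ℂ) * Complex.I := by
    conv_lhs => rw [← Complex.re_add_im z]
    push_cast; ring
  rw [stripMode, Complex.div_ofReal_im, e, Complex.sin_add_mul_I, ← Complex.ofReal_sin,
    ← Complex.ofReal_cos, ← Complex.ofReal_sinh, ← Complex.ofReal_cosh, ← Complex.ofReal_mul,
    ← Complex.ofReal_mul, ← Complex.mk_eq_add_mul_I]
  ring

theorem summable_coeff_stripMode (hh : 0 < h) (hc : Summable fun k => |c k| * Real.exp (k * ρ))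
    {z : ℂ} (hz : |z.im + h| ≤ h + ρ) : Summable fun k => (c k : ℂ) * stripMode h k z :=
  Summable.of_norm_bounded (hc.mul_right (modeConst h)) fun k => norm_coeff_stripMode_le hh k hz

theorem hasSum_im_stripHol (hh : 0 < h) (hc : Summable fun k => |c k|)
    {z : ℂ} (hz : z ∈ closedStrip h) :
    HasSum (fun k => c k * (stripProfile h k z.im * Real.cos (k * z.re))) (stripHol h c z).im := by
  have hc0 : Summable fun k => |c k| * Real.exp (k * (0 : ℝ)) := by simpa using hc
  have h1 := (summable_coeff_stripMode hh hc0 (z := z)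
    (abs_le.2 ⟨by linarith [hz.1], by linarith [hz.2]⟩)).hasSum.mapL Complex.imCLM
  have h2 : HasSum (fun k : ℕ => if k = 0 then c 0 * ((z.im + h) / h) else 0)
    (c 0 * ((z.im + h) / h)) := hasSum_ite_eq 0 _
  have h3 := h2.add h1
  have e : (stripHol h c z).im = c 0 * ((z.im + h) / h) +
      Complex.imCLM (∑' k, (c k : ℂ) * stripMode h k z) := by
    simp [stripHol, Complex.div_ofReal_im]
  rw [e]
  have e2 : (fun k => c k * (stripProfile h k z.im * Real.cos (k * z.re))) = fun k =>
      (if k = 0 then c 0 * ((z.im + h) / h) else 0) +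
        Complex.imCLM ((c k : ℂ) * stripMode h k z) := by
    ext k
    rw [Complex.imCLM_apply, Complex.im_ofReal_mul, im_stripMode]
    rcases eq_or_ne k 0 with rfl | hk
    · simp [stripProfile]
    · simp only [stripProfile, if_neg hk, zero_add]; ring
  rw [e2]; exact h3

theorem stripProfile_bottom (h : ℝ) (k : ℕ) : stripProfile h k (-h) = 0 := by
  simp [stripProfile]

theorem stripProfile_top (hh : 0 < h) (k : ℕ) : stripProfile h k 0 = 1 := by
  rcases eq_or_ne k 0 with rfl | hk
  · simp [stripProfile, hh.ne']
  · simp [stripProfile, hk, (sinh_nat_mul_pos hh hk).ne']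

theorem hasDerivAt_stripProfile (h : ℝ) (k : ℕ) (y : ℝ) :
    HasDerivAt (stripProfile h k)
      (if k = 0 then 1 / h else k * Real.cosh (k * (y + h)) / Real.sinh (k * h)) y := by
  have e0 : HasDerivAt (fun y : ℝ => y + h) 1 y := (hasDerivAt_id y).add_const h
  rcases eq_or_ne k 0 with rfl | hk
  · have : stripProfile h 0 = fun y => (y + h) / h := by ext y; simp [stripProfile]
    rw [this]; simpa using e0.div_const h
  · have : stripProfile h k = fun y => Real.sinh (k * (y + h)) / Real.sinh (k * h) := by
      ext y; simp [stripProfile, hk]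
    rw [this, if_neg hk]
    exact ((e0.const_mul (k : ℝ)).sinh.div_const _).congr_deriv (by ring)

theorem stripProfile_mem_Icc (hh : 0 < h) (k : ℕ) {y : ℝ} (hy : y ∈ Icc (-h) 0) :
    stripProfile h k y ∈ Icc (0 : ℝ) 1 := by
  have hy0 : 0 ≤ y + h := by linarith [hy.1]
  rcases eq_or_ne k 0 with rfl | hk
  · simp only [stripProfile, if_true]
    exact ⟨by positivity, (div_le_one hh).2 (by linarith [hy.2])⟩
  · simp only [stripProfile, if_neg hk]
    have := sinh_nat_mul_pos hh hk
    refine ⟨div_nonneg (Real.sinh_nonneg_iff.2 (by positivity)) this.le, (div_le_one this).2 ?_⟩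
    apply Real.sinh_le_sinh.2
    gcongr
    linarith [hy.2]

theorem isStripExtension_stripHol (hh : 0 < h) (hc : Summable fun k => |c k|) :
    IsStripExtension h (cosSeries c) fun z => (stripHol h c z).im := by
  have hc0 : Summable fun k => |c k| * Real.exp (k * (0 : ℝ)) := by simpa using hc
  have hb : ∀ x : ℝ, (⟨x, -h⟩ : ℂ) ∈ closedStrip h := fun x => ⟨le_rfl, by simpa using hh.le⟩
  have ht : ∀ x : ℝ, (⟨x, 0⟩ : ℂ) ∈ closedStrip h := fun x => ⟨by simpa using hh.le, le_rfl⟩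
  refine ⟨fun z hz => ?_, ?_, ⟨∑' k, |c k|, fun z hz => ?_⟩, fun x => ?_, fun x => ?_⟩
  · have hz' := strip_subset_bigStrip le_rfl hz
    exact ((differentiableOn_stripHol hh hc0).analyticOnNhd (isOpen_bigStrip h 0) z
      hz').harmonicAt_im
  · exact Complex.continuous_im.comp_continuousOn (continuousOn_stripHol hh hc)
  · rw [← (hasSum_im_stripHol hh hc hz).tsum_eq, ← Real.norm_eq_abs]
    refine tsum_of_norm_bounded hc.hasSum fun k => ?_
    have hm := stripProfile_mem_Icc hh k (mem_Icc.2 hz)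
    rw [Real.norm_eq_abs, abs_mul, abs_mul, abs_of_nonneg hm.1]
    exact mul_le_of_le_one_right (abs_nonneg _)
      (mul_le_one₀ hm.2 (abs_nonneg _) (Real.abs_cos_le_one _))
  · simp [← (hasSum_im_stripHol hh hc (hb x)).tsum_eq, stripProfile_bottom]
  · simp [← (hasSum_im_stripHol hh hc (ht x)).tsum_eq, stripProfile_top hh, cosSeries]

theorem hasDerivAt_stripHol_real (hh : 0 < h) (hρ : 0 < ρ)
    (hc : Summable fun k => |c k| * Real.exp (k * ρ)) (x : ℝ) :
    HasDerivAt (stripHol h c) (deriv (stripHol h c) x) x := by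
  have hx : (x : ℂ) ∈ bigStrip h ρ := closedStrip_subset_bigStrip hh hρ
    ⟨by simpa using hh.le, by simp⟩
  exact ((differentiableOn_stripHol hh hc).differentiableAt
    ((isOpen_bigStrip h ρ).mem_nhds hx)).hasDerivAt

theorem summable_of_summable_exp (hρ : 0 ≤ ρ) (hc : Summable fun k => |c k| * Real.exp (k * ρ)) :
    Summable fun k => |c k| :=
  hc.of_nonneg_of_le (fun k => abs_nonneg _) fun k =>
    le_mul_of_one_le_right (abs_nonneg _) (Real.one_le_exp (by positivity))

/-- For `W = Im f` the Cauchy–Riemann equations give `W_y = Re f'` and `W_x = Im f'`. One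
holomorphic function thus carries both the normal derivative and, in `hasDerivAt_cosSeries`, the
tangential one. -/
theorem hasDN_stripHol (hh : 0 < h) (hρ : 0 < ρ)
    (hc : Summable fun k => |c k| * Real.exp (k * ρ)) :
    HasDN h (cosSeries c) fun x => (deriv (stripHol h c) x).re := by
  refine ⟨_, isStripExtension_stripHol hh (summable_of_summable_exp hρ.le hc), fun x => ?_⟩
  have h1 := hasDerivAt_stripHol_real hh hρ hc x
  have h2 : HasDerivAt (fun y : ℝ => (⟨x, y⟩ : ℂ)) Complex.I 0 := by
    have : (fun y : ℝ => (⟨x, y⟩ : ℂ)) = fun y : ℝ => (x : ℂ) + (y : ℂ) * Complex.I := by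
      ext y; rw [Complex.mk_eq_add_mul_I]
    rw [this]
    simpa using ((Complex.ofRealCLM.hasDerivAt (x := (0 : ℝ))).mul_const Complex.I).const_add
      (x : ℂ)
  have h0 : (⟨x, 0⟩ : ℂ) = (x : ℂ) := rfl
  rw [← h0] at h1
  have h3 := h1.scomp (0 : ℝ) h2
  have h4 := Complex.imCLM.hasFDerivAt.comp_hasDerivAt (0 : ℝ) h3
  refine (h4.congr_deriv ?_).hasDerivWithinAt
  simp [h0]

theorem hasDerivAt_cosSeries (hh : 0 < h) (hρ : 0 < ρ)
    (hc : Summable fun k => |c k| * Real.exp (k * ρ)) (x : ℝ) :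
    HasDerivAt (cosSeries c) (deriv (stripHol h c) x).im x := by
  have h1 := (hasDerivAt_stripHol_real hh hρ hc x).comp_ofReal
  have h2 := Complex.imCLM.hasFDerivAt.comp_hasDerivAt x h1
  have h3 : cosSeries c = Complex.imCLM ∘ fun x : ℝ => stripHol h c x := by
    ext x
    exact ((isStripExtension_stripHol hh (summable_of_summable_exp hρ.le hc)).top x).symm
  rw [h3]
  exact h2

theorem hasSum_dn (hh : 0 < h) (hρ : 0 < ρ)
    (hc : Summable fun k => |c k| * Real.exp (k * ρ)) (x : ℝ) :
    HasSum (fun k => c k * (dnSymbol h k * Real.cos (k * x))) (deriv (stripHol h c) x).re := by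
  have hx : (x : ℂ) ∈ bigStrip h ρ := closedStrip_subset_bigStrip hh hρ
    ⟨by simpa using hh.le, by simp⟩
  have h1 := (hasSum_deriv_stripHol hh hc hx).mapL Complex.reCLM
  have h2 : HasSum (fun k : ℕ => if k = 0 then c 0 / h else 0) (c 0 / h) := hasSum_ite_eq 0 _
  have h3 := h2.add h1
  have e : c 0 / h + Complex.reCLM (deriv (stripHol h c) x - c 0 / h) =
      (deriv (stripHol h c) x).re := by
    rw [Complex.reCLM_apply, Complex.sub_re, ← Complex.ofReal_div, Complex.ofReal_re]; ring
  rw [e] at h3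
  have e2 : (fun k => c k * (dnSymbol h k * Real.cos (k * x))) = fun k =>
      (if k = 0 then c 0 / h else 0) + Complex.reCLM ((c k : ℂ) * deriv (stripMode h k) x) := by
    ext k
    rw [Complex.reCLM_apply, Complex.re_ofReal_mul, (hasDerivAt_stripMode h k x).deriv]
    rcases eq_or_ne k 0 with rfl | hk
    · simp [dnSymbol]; ring
    · have e3 : (k : ℂ) * ((x : ℂ) + h * Complex.I) =
          ((k * x : ℝ) : ℂ) + ((k * h : ℝ) : ℂ) * Complex.I := by push_cast; ring
      rw [Complex.div_ofReal_re, e3, Complex.cos_add_mul_I, ← Complex.ofReal_sin,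
        ← Complex.ofReal_cos, ← Complex.ofReal_sinh, ← Complex.ofReal_cosh,
        ← Complex.ofReal_mul, ← Complex.ofReal_mul, ← Complex.ofReal_natCast,
        Complex.re_ofReal_mul, Complex.sub_re, Complex.ofReal_re, Complex.re_ofReal_mul,
        Complex.I_re, mul_zero, sub_zero]
      simp only [dnSymbol, if_neg hk, zero_add]; ring
  rw [e2]; exact h3

end Series

/-! ### Operators on `ℓ¹` -/

abbrev L1 : Type := lp (fun _ : ℕ => ℝ) 1

/-- The `k`-th coefficient of an element of `ℓ¹`. -/
def cf (a : L1) (k : ℕ) : ℝ := (a : ∀ _ : ℕ, ℝ) k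

@[simp] theorem cf_add (a b : L1) (k : ℕ) : cf (a + b) k = cf a k + cf b k := rfl
@[simp] theorem cf_sub (a b : L1) (k : ℕ) : cf (a - b) k = cf a k - cf b k := rfl
@[simp] theorem cf_smul (t : ℝ) (a : L1) (k : ℕ) : cf (t • a) k = t * cf a k := rfl
@[simp] theorem cf_zero (k : ℕ) : cf 0 k = 0 := rfl

theorem L1.ext_cf {a b : L1} (h : ∀ k, cf a k = cf b k) : a = b := Subtype.ext (funext h)

theorem summable_abs_cf (a : L1) : Summable fun k => |cf a k| := by
  have := (memℓp_gen_iff (by simp)).1 (lp.memℓp a)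
  simpa [cf] using this

theorem L1.norm_eq (a : L1) : ‖a‖ = ∑' k, |cf a k| := by
  rw [lp.norm_eq_tsum_rpow (by simp)]
  simp [cf]

theorem hasSum_abs_cf (a : L1) : HasSum (fun k => |cf a k|) ‖a‖ := by
  rw [L1.norm_eq]; exact (summable_abs_cf a).hasSum

/-- An absolutely summable sequence as an element of `ℓ¹`. -/
def L1.mk (a : ℕ → ℝ) (ha : Summable fun k => |a k|) : L1 :=
  ⟨a, memℓp_gen (by simpa using ha)⟩

@[simp] theorem cf_mk (a : ℕ → ℝ) (ha : Summable fun k => |a k|) (k : ℕ) :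
    cf (L1.mk a ha) k = a k := rfl

def L1.delta (k : ℕ) : L1 := lp.single 1 k (1 : ℝ)

theorem L1.norm_delta (k : ℕ) : ‖L1.delta k‖ = 1 := by
  simp [L1.delta, lp.norm_single]

theorem cf_delta (j k : ℕ) : cf (L1.delta j) k = if k = j then 1 else 0 := by
  rw [cf, L1.delta, lp.single_apply]
  split_ifs with h
  · subst h; simp
  · simp [h]

variable {V : Type*} [NormedAddCommGroup V] [NormedSpace ℝ V]

theorem norm_cf_smul_le {e : ℕ → V} {C : ℝ} (hC : ∀ k, ‖e k‖ ≤ C) (a : L1) (k : ℕ) :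
    ‖cf a k • e k‖ ≤ C * |cf a k| := by
  rw [norm_smul, Real.norm_eq_abs, mul_comm]
  gcongr
  exact hC k

theorem norm_tsum_cf_smul_le {e : ℕ → V} {C : ℝ} (hC : ∀ k, ‖e k‖ ≤ C) (a : L1) :
    ‖∑' k, cf a k • e k‖ ≤ C * ‖a‖ :=
  tsum_of_norm_bounded ((hasSum_abs_cf a).mul_left C) (norm_cf_smul_le hC a)

variable [CompleteSpace V]

theorem summable_smul_of_bounded {e : ℕ → V} (he : ∃ C, ∀ k, ‖e k‖ ≤ C) (a : L1) :
    Summable fun k => cf a k • e k := by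
  obtain ⟨C, hC⟩ := he
  exact Summable.of_norm_bounded ((summable_abs_cf a).mul_left C) (norm_cf_smul_le hC a)

/-- The continuous linear map on `ℓ¹` with prescribed (bounded) values on the basis. -/
def l1Lift (e : ℕ → V) (he : ∃ C, ∀ k, ‖e k‖ ≤ C) : L1 →L[ℝ] V :=
  LinearMap.mkContinuousOfExistsBound
    { toFun := fun a => ∑' k, cf a k • e k
      map_add' := fun a b => by
        rw [← (summable_smul_of_bounded he a).tsum_add (summable_smul_of_bounded he b)]
        simp [add_smul]
      map_smul' := fun t a => by
        rw [RingHom.id_apply, ← (summable_smul_of_bounded he a).tsum_const_smul]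
        simp [smul_smul] }
    (he.imp fun _ hC => norm_tsum_cf_smul_le hC)

theorem l1Lift_apply (e : ℕ → V) (he : ∃ C, ∀ k, ‖e k‖ ≤ C) (a : L1) :
    l1Lift e he a = ∑' k, cf a k • e k := rfl

theorem hasSum_l1Lift (e : ℕ → V) (he : ∃ C, ∀ k, ‖e k‖ ≤ C) (a : L1) :
    HasSum (fun k => cf a k • e k) (l1Lift e he a) := (summable_smul_of_bounded he a).hasSum

theorem norm_l1Lift_le {e : ℕ → V} {C : ℝ} (hC : ∀ k, ‖e k‖ ≤ C) : ‖l1Lift e ⟨C, hC⟩‖ ≤ C :=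
  ContinuousLinearMap.opNorm_le_bound _ ((norm_nonneg _).trans (hC 0)) (norm_tsum_cf_smul_le hC)

/-- The diagonal operator with (bounded) symbol `d`. -/
def diagOp (d : ℕ → ℝ) (hd : ∃ C, ∀ k, |d k| ≤ C) : L1 →L[ℝ] L1 :=
  l1Lift (fun k => d k • L1.delta k) (by
    obtain ⟨C, hC⟩ := hd
    exact ⟨C, fun k => by rw [norm_smul, L1.norm_delta, mul_one]; exact hC k⟩)

def coord (k : ℕ) : L1 →L[ℝ] ℝ :=
  l1Lift (fun j => if j = k then 1 else 0) ⟨1, fun j => by split_ifs <;> simp⟩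

theorem coord_apply (k : ℕ) (a : L1) : coord k a = cf a k := by
  rw [coord, l1Lift_apply, tsum_eq_single k (fun j hj => by simp [hj])]
  simp

@[simp] theorem cf_diagOp (d : ℕ → ℝ) (hd : ∃ C, ∀ k, |d k| ≤ C) (a : L1) (k : ℕ) :
    cf (diagOp d hd a) k = d k * cf a k := by
  have h := (hasSum_l1Lift _ _ a : HasSum _ (diagOp d hd a)).mapL (coord k)
  have h2 := h.tsum_eq
  rw [← coord_apply, diagOp, ← h2, tsum_eq_single k]
  · simp [coord_apply, cf_delta]; ring
  · intro j hj
    simp [coord_apply, cf_delta, hj.symm]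

/-- The bilinear operator on `ℓ¹` with prescribed (bounded) values on pairs of basis vectors. -/
def bilinOp (E : ℕ → ℕ → V) (hE : ∃ C, ∀ j k, ‖E j k‖ ≤ C) : L1 →L[ℝ] L1 →L[ℝ] V :=
  l1Lift (fun j => l1Lift (E j) (hE.imp fun _ h => h j))
    (hE.imp fun _ h j => norm_l1Lift_le (h j))

/-- Reduces an identity between evaluations of bilinear operators to one on pairs of basis vectors.
-/
theorem clm_bilinOp (φ : V →L[ℝ] ℝ) (E : ℕ → ℕ → V) (hE : ∃ C, ∀ j k, ‖E j k‖ ≤ C)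
    (a b : L1) : φ (bilinOp E hE a b) = ∑' j, ∑' k, cf a j * (cf b k * φ (E j k)) := by
  have h := ((hasSum_l1Lift _ _ a : HasSum _ (bilinOp E hE a)).mapL
    (ContinuousLinearMap.apply ℝ V b)).mapL φ
  refine h.tsum_eq.symm.trans (tsum_congr fun j => ?_)
  rw [tsum_mul_left, map_smul, map_smul, smul_eq_mul]
  congr 1
  have h2 := (hasSum_l1Lift (E j) (hE.imp fun _ h => h j) b).mapL φ
  rw [ContinuousLinearMap.apply_apply, ← h2.tsum_eq]
  simp

/-! ### Products of trigonometric series -/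

/-- The family `p j k e_{j+k} + q j k r ^ (2 min j k) e_{|j-k|}`. -/
def pairFamily (r : ℝ) (p q : ℕ → ℕ → ℝ) (j k : ℕ) : L1 :=
  p j k • L1.delta (j + k) + (q j k * r ^ (2 * min j k)) • L1.delta (Nat.dist j k)

theorem pairFamily_bounded {r : ℝ} (hr0 : 0 ≤ r) (hr1 : r ≤ 1) {p q : ℕ → ℕ → ℝ} {C : ℝ}
    (hp : ∀ j k, |p j k| ≤ C) (hq : ∀ j k, |q j k| ≤ C) (j k : ℕ) :
    ‖pairFamily r p q j k‖ ≤ C + C := by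
  refine (norm_add_le _ _).trans (add_le_add ?_ ?_)
  · rw [norm_smul, L1.norm_delta, mul_one]; exact hp j k
  · rw [norm_smul, L1.norm_delta, mul_one, Real.norm_eq_abs, abs_mul, abs_pow, abs_of_nonneg hr0]
    exact (mul_le_of_le_one_right (abs_nonneg _) (pow_le_one₀ hr0 hr1)).trans (hq j k)

theorem cos_dist (j k : ℕ) (x : ℝ) : Real.cos (Nat.dist j k * x) = Real.cos (j * x - k * x) := by
  rcases le_total j k with h | h
  · rw [Nat.dist_eq_sub_of_le h, Nat.cast_sub h, ← Real.cos_neg]; ring_nf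
  · rw [Nat.dist_eq_sub_of_le_right h, Nat.cast_sub h]; ring_nf

theorem two_mul_min_add_dist (j k : ℕ) : 2 * min j k + Nat.dist j k = j + k := by
  rcases le_total j k with h | h
  · rw [Nat.dist_eq_sub_of_le h, min_eq_left h]; omega
  · rw [Nat.dist_eq_sub_of_le_right h, min_eq_right h]; omega

theorem dist_le_add (j k : ℕ) : Nat.dist j k ≤ j + k := by
  have := two_mul_min_add_dist j k; omega

theorem abs_pow_mul_cos_le {r : ℝ} (hr0 : 0 ≤ r) (hr1 : r ≤ 1) (k : ℕ) (x : ℝ) :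
    |r ^ k * Real.cos x| ≤ 1 := by
  rw [abs_mul, abs_pow, abs_of_nonneg hr0]
  exact mul_le_one₀ (pow_le_one₀ hr0 hr1) (abs_nonneg _) (Real.abs_cos_le_one _)

theorem abs_pow_mul_sin_le {r : ℝ} (hr0 : 0 ≤ r) (hr1 : r ≤ 1) (k : ℕ) (x : ℝ) :
    |r ^ k * Real.sin x| ≤ 1 := by
  rw [abs_mul, abs_pow, abs_of_nonneg hr0]
  exact mul_le_one₀ (pow_le_one₀ hr0 hr1) (abs_nonneg _) (Real.abs_sin_le_one _)

/-- A base `r ∈ [0,1]` for the geometric weights. -/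
structure IsWeight (r : ℝ) : Prop where
  nonneg : 0 ≤ r
  le_one : r ≤ 1

variable {r : ℝ}

/-- Evaluation at `x` of `∑ a_k r ^ k cos (k x)`. -/
def evalCos (hr : IsWeight r) (x : ℝ) : L1 →L[ℝ] ℝ :=
  l1Lift (fun k => r ^ k * Real.cos (k * x)) ⟨1, fun k => abs_pow_mul_cos_le hr.1 hr.2 k _⟩

/-- Evaluation at `x` of `∑ a_k r ^ k sin (k x)`. -/
def evalSin (hr : IsWeight r) (x : ℝ) : L1 →L[ℝ] ℝ :=
  l1Lift (fun k => r ^ k * Real.sin (k * x)) ⟨1, fun k => abs_pow_mul_sin_le hr.1 hr.2 k _⟩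

theorem evalCos_delta (hr : IsWeight r) (x : ℝ) (k : ℕ) :
    evalCos hr x (L1.delta k) = r ^ k * Real.cos (k * x) := by
  rw [evalCos, l1Lift_apply, tsum_eq_single k (fun j hj => by simp [cf_delta, hj])]
  simp [cf_delta]

theorem evalCos_eq_cosSeries (hr : IsWeight r) (x : ℝ) (a : L1) :
    evalCos hr x a = cosSeries (fun k => cf a k * r ^ k) x := by
  rw [evalCos, l1Lift_apply, cosSeries]
  simp [mul_assoc]

def cosMul (hr : IsWeight r) : L1 →L[ℝ] L1 →L[ℝ] L1 :=
  bilinOp (pairFamily r (fun _ _ => 1 / 2) (fun _ _ => 1 / 2))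
    ⟨_, pairFamily_bounded hr.1 hr.2 (C := |1 / 2|) (fun _ _ => le_rfl) (fun _ _ => le_rfl)⟩

def sinMul (hr : IsWeight r) : L1 →L[ℝ] L1 →L[ℝ] L1 :=
  bilinOp (pairFamily r (fun _ _ => -(1 / 2)) (fun _ _ => 1 / 2))
    ⟨_, pairFamily_bounded hr.1 hr.2 (C := |1 / 2|) (fun _ _ => by simp) (fun _ _ => le_rfl)⟩

theorem pow_dist (r : ℝ) (j k : ℕ) : r ^ (2 * min j k) * r ^ Nat.dist j k = r ^ j * r ^ k := by
  rw [← pow_add, ← pow_add, two_mul_min_add_dist]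

/-- The product-to-sum formula. The mode `|j - k|` carries weight `r^|j-k|` rather than `r^(j+k)`;
the surplus factor `r^(2 min j k)` is at most `1`, so weighted cosine series multiply boundedly in
`ℓ¹`. -/
theorem evalCos_cosMul (hr : IsWeight r) (x : ℝ) (a b : L1) :
    evalCos hr x (cosMul hr a b) = evalCos hr x a * evalCos hr x b := by
  rw [cosMul, clm_bilinOp]
  have e : ∀ j k, evalCos hr x (pairFamily r (fun _ _ => 1 / 2) (fun _ _ => 1 / 2) j k) =
      (r ^ j * Real.cos (j * x)) * (r ^ k * Real.cos (k * x)) := by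
    intro j k
    rw [pairFamily, map_add, map_smul, map_smul, evalCos_delta, evalCos_delta, cos_dist,
      smul_eq_mul, smul_eq_mul]
    push_cast
    rw [add_mul, Real.cos_add, Real.cos_sub, pow_add]
    linear_combination (1 / 2 * (Real.cos (j * x) * Real.cos (k * x) +
      Real.sin (j * x) * Real.sin (k * x))) * pow_dist r j k
  simp only [e]
  rw [evalCos, l1Lift_apply, l1Lift_apply, ← tsum_mul_right]
  apply tsum_congr
  intro j
  rw [← tsum_mul_left]
  apply tsum_congr
  intro k
  rw [smul_eq_mul, smul_eq_mul]; ring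

theorem evalCos_sinMul (hr : IsWeight r) (x : ℝ) (a b : L1) :
    evalCos hr x (sinMul hr a b) = evalSin hr x a * evalSin hr x b := by
  rw [sinMul, clm_bilinOp]
  have e : ∀ j k, evalCos hr x (pairFamily r (fun _ _ => -(1 / 2)) (fun _ _ => 1 / 2) j k) =
      (r ^ j * Real.sin (j * x)) * (r ^ k * Real.sin (k * x)) := by
    intro j k
    rw [pairFamily, map_add, map_smul, map_smul, evalCos_delta, evalCos_delta, cos_dist,
      smul_eq_mul, smul_eq_mul]
    push_cast
    rw [add_mul, Real.cos_add, Real.cos_sub, pow_add]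
    linear_combination (1 / 2 * (Real.cos (j * x) * Real.cos (k * x) +
      Real.sin (j * x) * Real.sin (k * x))) * pow_dist r j k
  simp only [e]
  rw [evalSin, l1Lift_apply, l1Lift_apply, ← tsum_mul_right]
  apply tsum_congr
  intro j
  rw [← tsum_mul_left]
  apply tsum_congr
  intro k
  rw [smul_eq_mul, smul_eq_mul]; ring

/-! ### The symbol of the Dirichlet–Neumann operator -/

section Symbol

variable {h : ℝ}

theorem dnSymbol_zero (h : ℝ) : dnSymbol h 0 = 1 / h := by simp [dnSymbol]

theorem dnSymbol_of_ne {k : ℕ} (hk : k ≠ 0) :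
    dnSymbol h k = k * (Real.cosh (k * h) / Real.sinh (k * h)) := by
  rw [dnSymbol, if_neg hk, mul_div_assoc]

theorem dnSymbol_pos (hh : 0 < h) (k : ℕ) : 0 < dnSymbol h k := by
  rcases eq_or_ne k 0 with rfl | hk
  · rw [dnSymbol_zero]; positivity
  · rw [dnSymbol_of_ne hk]
    have := sinh_nat_mul_pos hh hk
    have : (0 : ℝ) < k := by exact_mod_cast Nat.pos_of_ne_zero hk
    positivity

theorem dnSymbol_le (hh : 0 < h) (k : ℕ) : dnSymbol h k ≤ k + 1 / h := by
  rcases eq_or_ne k 0 with rfl | hk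
  · simp [dnSymbol_zero]
  · have hs := sinh_nat_mul_pos hh hk
    have hk0 : (0 : ℝ) < k := by exact_mod_cast Nat.pos_of_ne_zero hk
    rw [dnSymbol_of_ne hk, mul_div_assoc', div_le_iff₀ hs]
    have h1 : Real.cosh (k * h) = Real.sinh (k * h) + Real.exp (-(k * h)) := by
      rw [← Real.cosh_sub_sinh]; ring
    have h2 : Real.exp (-(k * h)) ≤ 1 := Real.exp_le_one_iff.2 (by simp; positivity)
    have h3 : k * h ≤ Real.sinh (k * h) := Real.self_le_sinh_iff.2 (by positivity)
    have h4 : (k : ℝ) ≤ 1 / h * Real.sinh (k * h) := by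
      rw [div_mul_eq_mul_div, le_div_iff₀ hh]; linarith
    rw [h1]
    nlinarith

theorem dnSymbol_ge (hh : 0 < h) (k : ℕ) : (k : ℝ) ≤ dnSymbol h k := by
  rcases eq_or_ne k 0 with rfl | hk
  · simpa using (dnSymbol_pos hh 0).le
  · rw [dnSymbol_of_ne hk]
    refine le_mul_of_one_le_right (by positivity) ((one_le_div (sinh_nat_mul_pos hh hk)).2 ?_)
    exact (Real.sinh_lt_cosh _).le

theorem dnSymbol_one (h : ℝ) : dnSymbol h 1 = (Real.tanh h)⁻¹ := by
  rw [dnSymbol_of_ne one_ne_zero, Real.tanh_eq_sinh_div_cosh]; simp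

theorem tanh_pos' (hh : 0 < h) : 0 < Real.tanh h := by
  rw [Real.tanh_eq_sinh_div_cosh]
  exact div_pos (Real.sinh_pos_iff.2 hh) (Real.cosh_pos h)

/-- Induction on `k` through the addition formula for `coth`. With `b = coth h` and `a = coth
((k+1)h)`, the next cotangent is `(ab+1)/(a+b)`, and the induction hypothesis enters only as `b ≤
(k+1)a`. -/
theorem dnSymbol_gap (hh : 0 < h) (k : ℕ) :
    dnSymbol h 1 + k * Real.tanh h ≤ dnSymbol h (k + 1) := by
  have hS := Real.sinh_pos_iff.2 hh
  have hC := Real.cosh_pos h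
  set b := (Real.tanh h)⁻¹ with hb
  have hb' : b = Real.cosh h / Real.sinh h := by rw [hb, Real.tanh_eq_sinh_div_cosh, inv_div]
  have ht : Real.tanh h = b⁻¹ := by rw [hb, inv_inv]
  have hb1 : 1 < b := by rw [hb', one_lt_div hS]; exact Real.sinh_lt_cosh h
  have hb0 : 0 < b := by linarith
  rw [dnSymbol_one, ← hb, ht]
  induction k with
  | zero => rw [zero_add, dnSymbol_one, ← hb]; simp
  | succ k ih =>
    rw [dnSymbol_of_ne (Nat.succ_ne_zero _)] at ih ⊢
    have hs := sinh_nat_mul_pos hh (Nat.succ_ne_zero k)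
    have hc := Real.cosh_pos ((k + 1 : ℕ) * h)
    set a := Real.cosh ((k + 1 : ℕ) * h) / Real.sinh ((k + 1 : ℕ) * h) with ha
    have ha0 : 0 < a := div_pos hc hs
    have e : Real.cosh ((k + 1 + 1 : ℕ) * h) / Real.sinh ((k + 1 + 1 : ℕ) * h) =
        (a * b + 1) / (a + b) := by
      have e1 : ((k + 1 + 1 : ℕ) : ℝ) * h = (k + 1 : ℕ) * h + h := by push_cast; ring
      rw [e1, Real.cosh_add, Real.sinh_add, ha, hb']
      field_simp
      ring
    rw [e]
    push_cast at ih ⊢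
    have h1 : b ≤ (k + 1) * a := by
      have : 0 ≤ (k : ℝ) * b⁻¹ := by positivity
      linarith
    rw [mul_div_assoc', le_div_iff₀ (by positivity)]
    have h2 : (b + (k + 1) * b⁻¹) * (a + b) * b = (b ^ 2 + (k + 1)) * (a + b) := by
      field_simp
    have h3 : (b ^ 2 + (k + 1)) * (a + b) ≤ (k + 1 + 1) * (a * b + 1) * b := by
      -- The two sides of `h3` differ by exactly this product.
      have : 0 ≤ ((k + 1) * a - b) * (b ^ 2 - 1) := mul_nonneg (by linarith) (by nlinarith)
      nlinarith
    have h4 : (b + (k + 1) * b⁻¹) * (a + b) * b ≤ (k + 1 + 1) * (a * b + 1) * b := by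
      rw [h2]; exact h3
    exact le_of_mul_le_mul_right h4 hb0

end Symbol

/-! ### Waves with analytic profile -/

/-- The base of the geometric weights. -/
def wbase : ℝ := Real.exp (-1)

theorem isWeight_wbase : IsWeight wbase :=
  ⟨(Real.exp_pos _).le, Real.exp_le_one_iff.2 (by norm_num)⟩

theorem isWeight_one : IsWeight 1 := ⟨zero_le_one, le_rfl⟩

theorem wbase_pow (k : ℕ) : wbase ^ k = Real.exp (-k) := by
  rw [wbase, ← Real.exp_nat_mul]; ring_nf

theorem wbase_pow_mul_exp (k : ℕ) : wbase ^ k * Real.exp (k * (1 / 2 : ℝ)) = Real.exp (-(k / 2)) := by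
  rw [wbase_pow, ← Real.exp_add]; ring_nf

theorem wbase_pow_mul_exp_le (k : ℕ) : wbase ^ k * Real.exp (k * (1 / 2 : ℝ)) ≤ 1 := by
  rw [wbase_pow_mul_exp]
  exact Real.exp_le_one_iff.2 (by simp; positivity)

theorem inv_nat_le_one (k : ℕ) : |(k : ℝ)⁻¹| ≤ 1 := by
  rcases eq_or_ne k 0 with rfl | hk
  · simp
  · have : (1 : ℝ) ≤ k := by exact_mod_cast Nat.one_le_iff_ne_zero.2 hk
    rw [abs_of_nonneg (by positivity)]
    exact inv_le_one_of_one_le₀ this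

section Ops

variable {h : ℝ}

/-- The symbol grows linearly, and the primitive `1/k` compensates. At `k = 0` the division returns
`0`. -/
theorem abs_dnSymbol_div_le (hh : 0 < h) (k : ℕ) : |dnSymbol h k / k| ≤ 1 + 1 / h := by
  rcases eq_or_ne k 0 with rfl | hk
  · simp; positivity
  · have hk1 : (1 : ℝ) ≤ k := by exact_mod_cast Nat.one_le_iff_ne_zero.2 hk
    rw [abs_of_nonneg (div_nonneg (dnSymbol_pos hh k).le (by linarith)), div_le_iff₀ (by linarith)]
    have := dnSymbol_le hh k
    have h2 : 1 / h ≤ 1 / h * k := le_mul_of_one_le_right (by positivity) hk1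
    nlinarith

/-- The operator costs at most a factor `j + k + 1/h`, while the two primitives gain `jk`, and both
`j` and `k` are at most `jk` when they are positive. Hence the choice of the derivative of the wave
as the unknown: the quadratic term is then bounded on `ℓ¹`. -/
theorem abs_dnSymbol_pair_le (hh : 0 < h) {m j k : ℕ} (hm : m ≤ j + k) :
    |1 / 2 * (dnSymbol h m * ((j : ℝ)⁻¹ * (k : ℝ)⁻¹))| ≤ 2 + 1 / h := by
  have hi : 0 < 1 / h := by positivity
  rcases eq_or_ne j 0 with rfl | hj
  · simp; positivity
  rcases eq_or_ne k 0 with rfl | hk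
  · simp; positivity
  have hj1 : (1 : ℝ) ≤ j := by exact_mod_cast Nat.one_le_iff_ne_zero.2 hj
  have hk1 : (1 : ℝ) ≤ k := by exact_mod_cast Nat.one_le_iff_ne_zero.2 hk
  have hm' : (m : ℝ) ≤ j + k := by exact_mod_cast hm
  have h1 := dnSymbol_le hh m
  have h2 := dnSymbol_pos hh m
  rw [abs_of_nonneg (by positivity), ← mul_inv, ← div_eq_mul_inv]
  have h3 : dnSymbol h m / (j * k) ≤ 2 + 1 / h := by
    rw [div_le_iff₀ (by positivity)]
    have e1 : (j : ℝ) ≤ j * k := le_mul_of_one_le_right (by linarith) hk1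
    have e2 : (k : ℝ) ≤ j * k := le_mul_of_one_le_left (by linarith) hj1
    have e3 : (1 : ℝ) ≤ j * k := hj1.trans e1
    nlinarith
  have : 0 ≤ dnSymbol h m / (j * k) := by positivity
  linarith

/-- Primitive: `k ↦ 1/k`. -/
def opJ : L1 →L[ℝ] L1 := diagOp (fun k => (k : ℝ)⁻¹) ⟨1, inv_nat_le_one⟩

/-- The Dirichlet–Neumann operator after `opJ`. -/
def opD (hh : 0 < h) : L1 →L[ℝ] L1 :=
  diagOp (fun k => dnSymbol h k / k) ⟨_, abs_dnSymbol_div_le hh⟩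

/-- The Dirichlet–Neumann operator of the product of two `opJ` images. -/
def opQ (hh : 0 < h) : L1 →L[ℝ] L1 →L[ℝ] L1 :=
  bilinOp (pairFamily wbase
      (fun j k => 1 / 2 * (dnSymbol h (j + k) * ((j : ℝ)⁻¹ * (k : ℝ)⁻¹)))
      (fun j k => 1 / 2 * (dnSymbol h (Nat.dist j k) * ((j : ℝ)⁻¹ * (k : ℝ)⁻¹))))
    ⟨_, pairFamily_bounded isWeight_wbase.1 isWeight_wbase.2
      (fun _ _ => abs_dnSymbol_pair_le hh le_rfl)
      (fun j k => abs_dnSymbol_pair_le hh (dist_le_add j k))⟩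

/-- The cosine coefficients of the wave with derivative coefficients `a`. -/
def waveCoeff (a : L1) (k : ℕ) : ℝ := cf (opJ a) k * wbase ^ k

def wave (a : L1) : ℝ → ℝ := cosSeries (waveCoeff a)

/-- The weight `exp (-k)` leaves room for a convergence margin; `ρ = 1/2` is the one used from here
on. -/
theorem summable_weighted (a : L1) :
    Summable fun k => |cf a k * wbase ^ k| * Real.exp (k * (1 / 2 : ℝ)) := by
  refine (summable_abs_cf a).of_nonneg_of_le (fun k => by positivity) fun k => ?_
  rw [abs_mul, abs_pow, abs_of_nonneg isWeight_wbase.1, mul_assoc]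
  exact mul_le_of_le_one_right (abs_nonneg _) (wbase_pow_mul_exp_le k)

theorem summable_waveCoeff (a : L1) :
    Summable fun k => |waveCoeff a k| * Real.exp (k * (1 / 2 : ℝ)) := summable_weighted (opJ a)

theorem wave_eq_evalCos (a : L1) (x : ℝ) : wave a x = evalCos isWeight_wbase x (opJ a) :=
  (evalCos_eq_cosSeries isWeight_wbase x (opJ a)).symm

theorem dnSymbol_mul_wbase_le (hh : 0 < h) (x : ℝ) (k : ℕ) :
    |wbase ^ k * (dnSymbol h k * Real.cos (k * x))| ≤ 1 + 1 / h := by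
  have h1 := dnSymbol_le hh k
  have h2 := dnSymbol_pos hh k
  have h0 : 0 < wbase ^ k := pow_pos (Real.exp_pos _) k
  have h5 : wbase ^ k ≤ 1 := pow_le_one₀ isWeight_wbase.1 isWeight_wbase.2
  rw [abs_mul, abs_mul, abs_of_pos h0, abs_of_pos h2]
  have h3 : wbase ^ k * k ≤ 1 := by
    rw [wbase_pow, Real.exp_neg, inv_mul_le_iff₀ (Real.exp_pos _), mul_one]
    linarith [Real.add_one_le_exp (k : ℝ)]
  have h4 := Real.abs_cos_le_one (k * x)
  calc wbase ^ k * (dnSymbol h k * |Real.cos (k * x)|) ≤ wbase ^ k * ((k + 1 / h) * 1) := by gcongr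
    _ = wbase ^ k * k + wbase ^ k * (1 / h) := by ring
    _ ≤ 1 + 1 * (1 / h) := by gcongr
    _ = _ := by ring

/-- Evaluation of the Dirichlet–Neumann operator at `x`. -/
def evalDN (hh : 0 < h) (x : ℝ) : L1 →L[ℝ] ℝ :=
  l1Lift (fun k => wbase ^ k * (dnSymbol h k * Real.cos (k * x)))
    ⟨_, dnSymbol_mul_wbase_le hh x⟩

theorem evalDN_delta (hh : 0 < h) (x : ℝ) (k : ℕ) :
    evalDN hh x (L1.delta k) = wbase ^ k * (dnSymbol h k * Real.cos (k * x)) := by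
  rw [evalDN, l1Lift_apply, tsum_eq_single k (fun j hj => by simp [cf_delta, hj])]
  simp [cf_delta]

theorem hasDN_evalDN (hh : 0 < h) (a : L1) :
    HasDN h (fun x => evalCos isWeight_wbase x a) (fun x => evalDN hh x a) := by
  have h1 := hasDN_stripHol hh (by norm_num) (summable_weighted a)
  have e1 : (fun x => evalCos isWeight_wbase x a) = cosSeries fun k => cf a k * wbase ^ k :=
    funext fun x => evalCos_eq_cosSeries _ _ _
  have e2 : (fun x => evalDN hh x a) =
      fun x : ℝ => (deriv (stripHol h fun k => cf a k * wbase ^ k) x).re := by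
    ext x
    rw [← (hasSum_dn hh (by norm_num) (summable_weighted a) x).tsum_eq, evalDN, l1Lift_apply]
    simp [mul_assoc]
  rw [e1, e2]; exact h1

theorem evalDN_opJ (hh : 0 < h) (x : ℝ) (a : L1) :
    evalDN hh x (opJ a) = evalCos isWeight_wbase x (opD hh a) := by
  rw [evalDN, evalCos, l1Lift_apply, l1Lift_apply]
  apply tsum_congr
  intro k
  simp only [opJ, opD, cf_diagOp, smul_eq_mul]
  ring

theorem evalDN_cosMul (hh : 0 < h) (x : ℝ) (a b : L1) :
    evalDN hh x (cosMul isWeight_wbase (opJ a) (opJ b)) =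
      evalCos isWeight_wbase x (opQ hh a b) := by
  rw [cosMul, opQ, clm_bilinOp, clm_bilinOp]
  apply tsum_congr; intro j
  apply tsum_congr; intro k
  simp only [pairFamily, map_add, map_smul, evalDN_delta, evalCos_delta, opJ, cf_diagOp,
    smul_eq_mul]
  ring

theorem hasDN_wave (hh : 0 < h) (a : L1) :
    HasDN h (wave a) fun x => evalCos isWeight_wbase x (opD hh a) := by
  have := hasDN_evalDN hh (opJ a)
  simp only [evalDN_opJ, ← wave_eq_evalCos] at this
  exact this

/-- The square is formed first and then differentiated; `opQ` performs both at once, because the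
first alone followed by the unbounded operator would leave `ℓ¹`. -/
theorem hasDN_wave_sq (hh : 0 < h) (a : L1) :
    HasDN h (fun x => wave a x ^ 2 / 2)
      fun x => 1 / 2 * evalCos isWeight_wbase x (opQ hh a a) := by
  have := hasDN_evalDN hh ((1 / 2 : ℝ) • cosMul isWeight_wbase (opJ a) (opJ a))
  simp only [map_smul, evalDN_cosMul, evalCos_cosMul, ← wave_eq_evalCos, smul_eq_mul] at this
  convert this using 2
  ring

theorem hasSum_im_deriv_stripHol (hh : 0 < h) {ρ : ℝ} (hρ : 0 < ρ) {c : ℕ → ℝ}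
    (hc : Summable fun k => |c k| * Real.exp (k * ρ)) (x : ℝ) :
    HasSum (fun k => -(c k * (k * Real.sin (k * x)))) (deriv (stripHol h c) x).im := by
  have hx : (x : ℂ) ∈ bigStrip h ρ := closedStrip_subset_bigStrip hh hρ
    ⟨by simpa using hh.le, by simp⟩
  have h1 := (hasSum_deriv_stripHol hh hc hx).mapL Complex.imCLM
  have e : Complex.imCLM (deriv (stripHol h c) x - c 0 / h) = (deriv (stripHol h c) x).im := by
    rw [Complex.imCLM_apply, Complex.sub_im, ← Complex.ofReal_div, Complex.ofReal_im, sub_zero]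
  rw [e] at h1
  have e2 : (fun k => -(c k * (k * Real.sin (k * x)))) = fun k =>
      Complex.imCLM ((c k : ℂ) * deriv (stripMode h k) x) := by
    ext k
    rw [Complex.imCLM_apply, Complex.im_ofReal_mul, (hasDerivAt_stripMode h k x).deriv]
    rcases eq_or_ne k 0 with rfl | hk
    · simp
    · have e3 : (k : ℂ) * ((x : ℂ) + h * Complex.I) =
          ((k * x : ℝ) : ℂ) + ((k * h : ℝ) : ℂ) * Complex.I := by push_cast; ring
      have hs := (sinh_nat_mul_pos hh hk).ne'
      rw [Complex.div_ofReal_im, e3, Complex.cos_add_mul_I, ← Complex.ofReal_sin,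
        ← Complex.ofReal_cos, ← Complex.ofReal_sinh, ← Complex.ofReal_cosh,
        ← Complex.ofReal_mul, ← Complex.ofReal_mul, ← Complex.ofReal_natCast,
        Complex.im_ofReal_mul, Complex.sub_im, Complex.ofReal_im, Complex.im_ofReal_mul,
        Complex.I_im, mul_one, zero_sub]
      field_simp
  rw [e2]; exact h1

theorem hasDerivAt_wave (a : L1) (x : ℝ) :
    HasDerivAt (wave a) (-evalSin isWeight_wbase x a) x := by
  -- The tangential derivative does not depend on the depth, so an auxiliary strip of depth `1`
  -- serves.
  have h1 := hasDerivAt_cosSeries one_pos (by norm_num) (summable_waveCoeff a) x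
  refine h1.congr_deriv ?_
  rw [← (hasSum_im_deriv_stripHol one_pos (by norm_num) (summable_waveCoeff a) x).tsum_eq,
    tsum_neg, evalSin, l1Lift_apply]
  congr 1
  apply tsum_congr; intro k
  rcases eq_or_ne k 0 with rfl | hk
  · simp
  · have : (k : ℝ) ≠ 0 := by exact_mod_cast hk
    simp only [waveCoeff, opJ, cf_diagOp, smul_eq_mul]
    field_simp

end Ops

/-! ### Existence of the branch by the implicit function theorem -/

section Branch

variable {g γ h lamStar : ℝ}

/-- The spectral conditions at the bifurcation value: kernel, sign and transversality. -/
structure IsCritical (g γ h lamStar : ℝ) : Prop where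
  kernel : 2 * g - 2 * lamStar * γ - 2 * lamStar ^ 2 * dnSymbol h 1 = 0
  ne_zero : lamStar ≠ 0
  transversal : γ + 2 * lamStar * dnSymbol h 1 ≠ 0

/-- With `t = tanh h`, the kernel condition is the quadratic equation `λ² + γtλ - gt = 0`, of which
`lamStar` is the negative root. Transversality says that the root is simple, the quantity being
`-2q/t` with `q` the square root. -/
theorem isCritical_of_eq (hg : 0 < g) (hh : 0 < h) (hlam : lamStar = -(γ * Real.tanh h / 2) -
      Real.sqrt (γ ^ 2 * Real.tanh h ^ 2 / 4 + g * Real.tanh h)) :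
    IsCritical g γ h lamStar := by
  have ht := tanh_pos' hh
  set t := Real.tanh h
  set q := Real.sqrt (γ ^ 2 * t ^ 2 / 4 + g * t) with hq
  have hq2 : q ^ 2 = γ ^ 2 * t ^ 2 / 4 + g * t := Real.sq_sqrt (by positivity)
  have hq0 : 0 < q := Real.sqrt_pos.2 (by positivity)
  have hroot : lamStar ^ 2 + γ * t * lamStar - g * t = 0 := by rw [hlam]; nlinarith
  refine ⟨?_, ?_, ?_⟩
  · rw [dnSymbol_one]
    change _ - 2 * lamStar ^ 2 * t⁻¹ = 0
    field_simp
    linarith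
  · intro h0
    rw [h0] at hroot
    have := mul_pos hg ht
    nlinarith
  · rw [dnSymbol_one]
    change γ + 2 * lamStar * t⁻¹ ≠ 0
    have : γ + 2 * lamStar * t⁻¹ = -(2 * q) * t⁻¹ := by rw [hlam]; field_simp; ring
    rw [this]
    have : 0 < q * t⁻¹ := by positivity
    nlinarith

/-- Projection onto the modes `k ≥ 2`. -/
def opP : L1 →L[ℝ] L1 := diagOp (fun k => if 2 ≤ k then 1 else 0)
  ⟨1, fun k => by split_ifs <;> simp⟩

/-- The derivative coefficients of `cos x + z`, where `z` is given by the modes `k ≥ 2` of `ξ`. -/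
def profile (ξ : L1) : L1 := Real.exp 1 • L1.delta 1 + opP ξ

/-- For the wave `w = s · wave x` and `μ = sν`, multiplying by `s` turns `redN` into the expression
multiplied by `γ` in (*), `redP` into the last factor minus `1`, and `redM` into `μ - 2gw`. -/
def redN (hh : 0 < h) (s : ℝ) (x : L1) : L1 :=
  -(opJ x) + s • ((1 / 2 : ℝ) • opQ hh x x - cosMul isWeight_wbase (opJ x) (opD hh x))

def redP (hh : 0 < h) (s : ℝ) (x : L1) : L1 :=
  (2 : ℝ) • opD hh x + s • (sinMul isWeight_wbase x x +
    cosMul isWeight_wbase (opD hh x) (opD hh x))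

def redM (g ν : ℝ) (x : L1) : L1 := ν • L1.delta 0 - (2 * g) • opJ x

/-- The equation divided by `s`, for `λ = lam`, `μ = s ν` and `w = s · wave x`. -/
def reduced (g γ : ℝ) (hh : 0 < h) (s lam ν : ℝ) (x : L1) : L1 :=
  (2 * lam * γ) • redN hh s x + (s * γ ^ 2) • cosMul isWeight_wbase (redN hh s x) (redN hh s x)
    - lam ^ 2 • redP hh s x - redM g ν x - s • cosMul isWeight_wbase (redM g ν x) (redP hh s x)

theorem evalCos_redM (g ν : ℝ) (a : L1) (x : ℝ) :
    evalCos isWeight_wbase x (redM g ν a) = ν - 2 * g * wave a x := by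
  simp [redM, evalCos_delta, wave_eq_evalCos]

theorem evalCos_redN (hh : 0 < h) (s : ℝ) (a : L1) (x : ℝ) :
    evalCos isWeight_wbase x (redN hh s a) = -wave a x + s * (1 / 2 *
      evalCos isWeight_wbase x (opQ hh a a) - wave a x * evalCos isWeight_wbase x (opD hh a)) := by
  simp only [redN, map_add, map_neg, map_smul, map_sub, evalCos_cosMul, wave_eq_evalCos,
    smul_eq_mul]

theorem evalCos_redP (hh : 0 < h) (s : ℝ) (a : L1) (x : ℝ) :
    evalCos isWeight_wbase x (redP hh s a) = 2 * evalCos isWeight_wbase x (opD hh a) +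
      s * (evalSin isWeight_wbase x a ^ 2 + evalCos isWeight_wbase x (opD hh a) ^ 2) := by
  simp only [redP, map_add, map_smul, evalCos_cosMul, evalCos_sinMul, smul_eq_mul, pow_two]

theorem wave_smul (s : ℝ) (a : L1) : wave (s • a) = s • wave a := by
  ext x; simp [wave_eq_evalCos]

theorem wave_sub (a b : L1) : wave (a - b) = wave a - wave b := by
  ext x; simp [wave_eq_evalCos]

theorem solvesEq_of_reduced (hh : 0 < h) {s lam ν : ℝ} {a : L1}
    (hred : reduced g γ hh s lam ν a = 0) : SolvesEq g γ h lam (s * ν) (wave (s • a)) := by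
  refine ⟨_, _, hasDN_wave hh (s • a), hasDN_wave_sq hh (s • a), fun x => ?_⟩
  have h1 := congrArg (evalCos isWeight_wbase x) hred
  simp only [reduced, map_add, map_sub, map_smul, evalCos_cosMul, evalCos_redN, evalCos_redP,
    evalCos_redM, map_zero, smul_eq_mul] at h1
  rw [(hasDerivAt_wave (s • a) x).deriv]
  simp only [wave_smul, Pi.smul_apply, map_smul, smul_eq_mul, smul_apply]
  -- Expanding, `(λ + γsN)² - (λ² + sM)(1 + sP)` is `s` times the reduced equation.
  linear_combination s * h1

/-- The reduced equation as a function of `s` and of the unknown `ξ ∈ ℓ¹` which collects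
`ν = ξ₀`, `lam - lamStar = ξ₁` and the higher modes. -/
def branchMap (g γ : ℝ) (hh : 0 < h) (lamStar : ℝ) (p : ℝ × L1) : L1 :=
  reduced g γ hh p.1 (lamStar + coord 1 p.2) (coord 0 p.2) (profile p.2)

theorem contDiff_branchMap (hh : 0 < h) : ContDiff ℝ 1 (branchMap g γ hh lamStar) := by
  unfold branchMap reduced redN redP redM profile
  fun_prop

/-- Subtracting the kernel relation leaves `2λ*²` times the gap between the symbols at `k` and at
`1`, which is at least `(k-1) tanh h`; and `2(k-1) ≥ k` for `k ≥ 2`. Linear growth in `k` is what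
makes the inverse linearisation bounded and gives the coercivity in the uniqueness argument. -/
theorem dnSymbol_linear_lower (hh : 0 < h) (hcr : IsCritical g γ h lamStar) {k : ℕ}
    (hk : 2 ≤ k) : lamStar ^ 2 * Real.tanh h * k ≤
      -(2 * g - 2 * lamStar * γ - 2 * lamStar ^ 2 * dnSymbol h k) := by
  have ht := tanh_pos' hh
  obtain ⟨j, rfl⟩ : ∃ j, k = j + 1 := ⟨k - 1, by omega⟩
  have hj : (1 : ℝ) ≤ j := by exact_mod_cast (by omega : 1 ≤ j)
  have h1 := dnSymbol_gap hh j
  have h2 := hcr.kernel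
  have h3 : 0 < lamStar ^ 2 := by have := hcr.ne_zero; positivity
  have h4 : lamStar ^ 2 * (j * Real.tanh h) ≤
      lamStar ^ 2 * (dnSymbol h (j + 1) - dnSymbol h 1) := by gcongr; linarith
  push_cast
  have h5 : 0 ≤ lamStar ^ 2 * Real.tanh h * (j - 1) :=
    mul_nonneg (by positivity) (by linarith)
  nlinarith

/-- The symbol of the linearisation in the unknown `ξ`. -/
def branchSymbol (g γ h lamStar : ℝ) (k : ℕ) : ℝ :=
  if k = 0 then -1 else if k = 1 then -(2 * Real.exp 1 * (γ + 2 * lamStar * dnSymbol h 1))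
  else (2 * g - 2 * lamStar * γ - 2 * lamStar ^ 2 * dnSymbol h k) / k

theorem branchSymbol_bounded (hh : 0 < h) : ∃ C, ∀ k, |branchSymbol g γ h lamStar k| ≤ C := by
  refine ⟨1 + |2 * Real.exp 1 * (γ + 2 * lamStar * dnSymbol h 1)| +
    (|2 * g - 2 * lamStar * γ| + 2 * lamStar ^ 2 * (1 + 1 / h)), fun k => ?_⟩
  have a1 := abs_nonneg (2 * Real.exp 1 * (γ + 2 * lamStar * dnSymbol h 1))
  have a2 : 0 ≤ |2 * g - 2 * lamStar * γ| + 2 * lamStar ^ 2 * (1 + 1 / h) := by positivity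
  unfold branchSymbol
  split_ifs with h0 h1
  · rw [abs_neg, abs_one]; linarith
  · rw [abs_neg]; linarith
  · have e : (2 * g - 2 * lamStar * γ - 2 * lamStar ^ 2 * dnSymbol h k) / k =
      (2 * g - 2 * lamStar * γ) * (k : ℝ)⁻¹ - 2 * lamStar ^ 2 * (dnSymbol h k / k) := by ring
    have b1 : |(2 * g - 2 * lamStar * γ) * (k : ℝ)⁻¹| ≤ |2 * g - 2 * lamStar * γ| := by
      rw [abs_mul]; exact mul_le_of_le_one_right (abs_nonneg _) (inv_nat_le_one k)
    have b2 : |2 * lamStar ^ 2 * (dnSymbol h k / k)| ≤ 2 * lamStar ^ 2 * (1 + 1 / h) := by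
      rw [abs_mul, abs_of_nonneg (by positivity : 0 ≤ 2 * lamStar ^ 2)]
      gcongr
      exact abs_dnSymbol_div_le hh k
    rw [e]
    have := abs_sub ((2 * g - 2 * lamStar * γ) * (k : ℝ)⁻¹) (2 * lamStar ^ 2 * (dnSymbol h k / k))
    linarith

theorem branchSymbol_ne_zero (hh : 0 < h) (hcr : IsCritical g γ h lamStar) (k : ℕ) :
    branchSymbol g γ h lamStar k ≠ 0 := by
  have h3 : 0 < lamStar ^ 2 := by have := hcr.ne_zero; positivity
  have ht := tanh_pos' hh
  unfold branchSymbol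
  split_ifs with h0 h1
  · norm_num
  · have := hcr.transversal
    have := (Real.exp_pos 1).ne'
    simp [*]
  · have h2 := dnSymbol_linear_lower hh hcr (k := k) (by omega)
    have hk : (0 : ℝ) < k := by exact_mod_cast Nat.pos_of_ne_zero h0
    have : 0 < lamStar ^ 2 * Real.tanh h * k := by positivity
    exact div_ne_zero (by linarith) hk.ne'

theorem branchSymbol_inv_bounded (hh : 0 < h) (hcr : IsCritical g γ h lamStar) :
    ∃ C, ∀ k, |(branchSymbol g γ h lamStar k)⁻¹| ≤ C := by
  have h3 : 0 < lamStar ^ 2 := by have := hcr.ne_zero; positivity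
  have ht := tanh_pos' hh
  refine ⟨1 + |(2 * Real.exp 1 * (γ + 2 * lamStar * dnSymbol h 1))⁻¹| +
    (lamStar ^ 2 * Real.tanh h)⁻¹, fun k => ?_⟩
  have a1 := abs_nonneg (2 * Real.exp 1 * (γ + 2 * lamStar * dnSymbol h 1))⁻¹
  have a2 : 0 < (lamStar ^ 2 * Real.tanh h)⁻¹ := by positivity
  unfold branchSymbol
  split_ifs with h0 h1
  · rw [inv_neg, abs_neg, inv_one, abs_one]; linarith
  · rw [inv_neg, abs_neg]; linarith
  · have h2 := dnSymbol_linear_lower hh hcr (k := k) (by omega)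
    have hk : (0 : ℝ) < k := by exact_mod_cast Nat.pos_of_ne_zero h0
    have h4 : lamStar ^ 2 * Real.tanh h ≤
        |(2 * g - 2 * lamStar * γ - 2 * lamStar ^ 2 * dnSymbol h k) / k| := by
      rw [abs_div, abs_of_pos hk, le_div_iff₀ hk]
      exact h2.trans (neg_le_abs _)
    rw [abs_inv]
    have := inv_anti₀ (by positivity) h4
    linarith

theorem diagOp_isInvertible {d : ℕ → ℝ} (hd : ∃ C, ∀ k, |d k| ≤ C) (h0 : ∀ k, d k ≠ 0)
    (hi : ∃ C, ∀ k, |(d k)⁻¹| ≤ C) : (diagOp d hd).IsInvertible := by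
  refine ⟨ContinuousLinearEquiv.equivOfInverse (diagOp d hd) (diagOp (fun k => (d k)⁻¹) hi)
    (fun a => L1.ext_cf fun k => ?_) (fun a => L1.ext_cf fun k => ?_), rfl⟩
  · rw [cf_diagOp, cf_diagOp, ← mul_assoc, inv_mul_cancel₀ (h0 k), one_mul]
  · rw [cf_diagOp, cf_diagOp, ← mul_assoc, mul_inv_cancel₀ (h0 k), one_mul]

@[simp] theorem cf_neg (a : L1) (k : ℕ) : cf (-a) k = -cf a k := rfl

theorem cf_opJ (a : L1) (k : ℕ) : cf (opJ a) k = (k : ℝ)⁻¹ * cf a k := cf_diagOp _ _ _ _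

theorem cf_opD (hh : 0 < h) (a : L1) (k : ℕ) : cf (opD hh a) k = dnSymbol h k / k * cf a k :=
  cf_diagOp _ _ _ _

theorem cf_opP (a : L1) (k : ℕ) : cf (opP a) k = (if 2 ≤ k then 1 else 0) * cf a k :=
  cf_diagOp _ _ _ _

theorem branchMap_zero_left (hh : 0 < h) (ξ : L1) :
    branchMap g γ hh lamStar (0, ξ) = (2 * (lamStar + coord 1 ξ) * γ) • (-(opJ (profile ξ)))
      - (lamStar + coord 1 ξ) ^ 2 • ((2 : ℝ) • opD hh (profile ξ))
      - (coord 0 ξ • L1.delta 0 - (2 * g) • opJ (profile ξ)) := by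
  simp [branchMap, reduced, redN, redP, redM]

/-- At `s = 0` all quadratic operators drop out and only Fourier multipliers remain. -/
theorem hasFDerivAt_branchMap_zero_left (hh : 0 < h) :
    HasFDerivAt (fun ξ => branchMap g γ hh lamStar (0, ξ))
      (diagOp (branchSymbol g γ h lamStar) (branchSymbol_bounded hh)) 0 := by
  have e : (fun ξ => branchMap g γ hh lamStar (0, ξ)) = fun ξ =>
      (2 * (lamStar + coord 1 ξ) * γ) • (-(opJ (profile ξ)))
      - (lamStar + coord 1 ξ) ^ 2 • ((2 : ℝ) • opD hh (profile ξ))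
      - (coord 0 ξ • L1.delta 0 - (2 * g) • opJ (profile ξ)) :=
    funext fun ξ => branchMap_zero_left hh ξ
  rw [e]
  have hp : HasFDerivAt profile opP (0 : L1) := opP.hasFDerivAt.const_add _
  have hJ : HasFDerivAt (fun ξ => opJ (profile ξ)) (opJ ∘L opP) (0 : L1) :=
    opJ.hasFDerivAt.comp _ hp
  have hD : HasFDerivAt (fun ξ => opD hh (profile ξ)) (opD hh ∘L opP) (0 : L1) :=
    (opD hh).hasFDerivAt.comp _ hp
  have hl : HasFDerivAt (fun ξ : L1 => lamStar + coord 1 ξ) (coord 1) (0 : L1) :=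
    (coord 1).hasFDerivAt.const_add _
  have h1 := ((hl.const_mul 2).mul_const γ).smul hJ.neg
  have h2 := (hl.pow 2).smul (hD.const_smul (2 : ℝ))
  have h3 := ((coord 0).hasFDerivAt (x := (0 : L1))).smul_const (L1.delta 0)
  have h4 := (h1.sub h2).sub (h3.sub (hJ.const_smul (2 * g)))
  refine h4.congr_fderiv ?_
  ext1 η
  refine L1.ext_cf fun k => ?_
  simp only [sub_apply, add_apply,
    smul_apply, neg_apply,
    ContinuousLinearMap.smulRight_apply,
    ContinuousLinearMap.comp_apply, cf_sub, cf_add, cf_smul, cf_neg, cf_opJ, cf_opD, cf_opP,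
    cf_diagOp, profile, map_zero, add_zero, cf_delta, coord_apply, smul_eq_mul]
  -- Mode `0` sees only `ν`, mode `1` only the variation of `λ` (the profile is fixed there), and
  -- modes `k ≥ 2` only the profile.
  rcases eq_or_ne k 0 with rfl | hk0
  · simp [branchSymbol, cf_opJ, cf_opD, cf_delta]
  rcases eq_or_ne k 1 with rfl | hk1
  · simp [branchSymbol, cf_opJ, cf_opD, cf_delta]
    ring
  · have : 2 ≤ k := by omega
    have hk : (k : ℝ) ≠ 0 := by exact_mod_cast hk0
    simp [branchSymbol, this, hk0, hk1, cf_opJ, cf_opD, cf_delta]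
    field_simp
    ring

theorem branchMap_zero (hh : 0 < h) (hcr : IsCritical g γ h lamStar) :
    branchMap g γ hh lamStar (0, 0) = 0 := by
  rw [branchMap_zero_left]
  refine L1.ext_cf fun k => ?_
  simp only [cf_sub, cf_smul, cf_neg, cf_opJ, cf_opD, profile, map_zero, add_zero, cf_delta,
    cf_zero]
  rcases eq_or_ne k 1 with rfl | hk1
  · simp
    linear_combination Real.exp 1 * hcr.kernel
  · simp [hk1]

theorem exists_branch (hh : 0 < h) (hcr : IsCritical g γ h lamStar) :
    ∃ (ε : ℝ) (ξ : ℝ → L1), 0 < ε ∧ (∀ s ∈ Ioo (-ε) ε, ContinuousAt ξ s) ∧ ξ 0 = 0 ∧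
      ∀ s ∈ Ioo (-ε) ε, reduced g γ hh s (lamStar + cf (ξ s) 1) (cf (ξ s) 0) (profile (ξ s)) = 0 := by
  have hcd : ContDiffAt ℝ 1 (branchMap g γ hh lamStar) (0, 0) :=
    (contDiff_branchMap hh).contDiffAt
  -- The partial derivative in `ξ` is the diagonal operator just computed, whose entries are bounded
  -- and bounded away from zero; so `ξ` can be solved for as a function of `s`.
  have hinv : (fderiv ℝ (branchMap g γ hh lamStar) (0, 0) ∘L .inr ℝ ℝ L1).IsInvertible := by
    have h1 : HasFDerivAt (fun ξ : L1 => ((0 : ℝ), ξ)) (.inr ℝ ℝ L1) (0 : L1) :=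
      (ContinuousLinearMap.inr ℝ ℝ L1).hasFDerivAt
    have h2 : HasFDerivAt (branchMap g γ hh lamStar)
        (fderiv ℝ (branchMap g γ hh lamStar) (0, 0)) ((0 : ℝ), (0 : L1)) :=
      (hcd.differentiableAt (by norm_num)).hasFDerivAt
    have h3 := h2.comp (0 : L1) h1
    rw [h3.unique (hasFDerivAt_branchMap_zero_left hh)]
    exact diagOp_isInvertible _ (branchSymbol_ne_zero hh hcr) (branchSymbol_inv_bounded hh hcr)
  set φ := hcd.implicitFunction (by norm_num) hinv with hφ
  have h0 : φ 0 = 0 := hcd.implicitFunction_apply_self (by norm_num) hinv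
  have hev := hcd.eventually_apply_implicitFunction (by norm_num) hinv
  have hcont : ∀ᶠ s in 𝓝 (0 : ℝ), ContinuousAt φ s := by
    have := (hcd.contDiffAt_implicitFunction (by norm_num) hinv).eventually (by simp)
    filter_upwards [this] with s hs using hs.continuousAt
  obtain ⟨ε, hε, hball⟩ := Metric.eventually_nhds_iff.1 (hev.and hcont)
  have hmem : ∀ s ∈ Ioo (-ε) ε, dist s 0 < ε := fun s hs => by
    rw [Real.dist_0_eq_abs]; exact abs_lt.2 hs
  refine ⟨ε, φ, hε, fun s hs => (hball (hmem s hs)).2, h0, fun s hs => ?_⟩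
  have := (hball (hmem s hs)).1
  rw [branchMap_zero hh hcr] at this
  simpa [branchMap, coord_apply] using this

end Branch

/-! ### Hölder estimates -/

theorem le_rpow_of_le_one {d a : ℝ} (h0 : 0 ≤ d) (h1 : d ≤ 1) (ha1 : a ≤ 1) :
    d ≤ d ^ a := by
  rcases h0.eq_or_lt with rfl | hd
  · exact Real.rpow_nonneg le_rfl _
  · simpa using Real.rpow_le_rpow_of_exponent_ge hd h1 ha1

/-- A bounded Lipschitz map is Hölder. -/
theorem min_le_rpow {d e L M a : ℝ} (hd : 0 ≤ d) (ha0 : 0 ≤ a) (ha1 : a ≤ 1) (hL : 0 ≤ L)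
    (hM : 0 ≤ M) (h1 : e ≤ L * d) (h2 : e ≤ M) : e ≤ (L + M) * d ^ a := by
  rcases le_total d 1 with h | h
  · have h3 := le_rpow_of_le_one hd h ha1
    nlinarith [Real.rpow_nonneg hd a]
  · have h3 := Real.one_le_rpow h ha0
    nlinarith

theorem holderOnWith_of_bound {X Y : Type*} [PseudoMetricSpace X] [PseudoMetricSpace Y]
    {f : X → Y} {s : Set X} {α : ℝ≥0} {C : ℝ≥0}
    (h : ∀ x ∈ s, ∀ y ∈ s, dist (f x) (f y) ≤ C * dist x y ^ (α : ℝ)) : HolderOnWith C α f s := by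
  intro x hx y hy
  rw [edist_dist, edist_dist, ENNReal.ofReal_rpow_of_nonneg dist_nonneg α.coe_nonneg,
    ← ENNReal.ofReal_coe_nnreal, ← ENNReal.ofReal_mul C.coe_nonneg]
  exact ENNReal.ofReal_le_ofReal (h x hx y hy)

theorem HolderWith.real_bound {f : ℝ → ℝ} {α C : ℝ≥0} (h : HolderWith C α f) (x y : ℝ) :
    |f x - f y| ≤ C * |x - y| ^ (α : ℝ) := by
  have := h.dist_le x y
  rwa [Real.dist_eq, Real.dist_eq] at this

theorem holderNorm_le {n : ℕ} {α : ℝ≥0} {f : ℝ → ℝ} {M : ℕ → ℝ} {K : ℝ≥0} (hM : ∀ j, 0 ≤ M j)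
    (hb : ∀ j ≤ n, ∀ x, |iteratedDeriv j f x| ≤ M j)
    (hK : ∀ x y, |iteratedDeriv n f x - iteratedDeriv n f y| ≤ K * |x - y| ^ (α : ℝ)) :
    holderNorm n α f ≤ ENNReal.ofReal (∑ j ∈ Finset.range (n + 1), M j + K) := by
  rw [ENNReal.ofReal_add (Finset.sum_nonneg fun j _ => hM j) K.coe_nonneg,
    ENNReal.ofReal_sum_of_nonneg fun j _ => hM j, holderNorm]
  refine add_le_add (Finset.sum_le_sum fun j hj => iSup_le fun x => ?_) ?_
  · rw [Real.enorm_eq_ofReal_abs]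
    exact ENNReal.ofReal_le_ofReal (hb j (by simpa [Nat.lt_succ_iff] using hj) x)
  · rw [ENNReal.ofReal_coe_nnreal]
    refine HolderWith.eHolderNorm_le ?_
    rw [← holderOnWith_univ]
    refine holderOnWith_of_bound fun x _ y _ => ?_
    rw [Real.dist_eq, Real.dist_eq]; exact hK x y

theorem abs_iteratedDeriv_cos_mul_le (c : ℝ) (k j : ℕ) (x : ℝ) :
    ‖iteratedFDeriv ℝ j (fun x => c * Real.cos (k * x)) x‖ ≤ |c| * (k : ℝ) ^ j := by
  rw [norm_iteratedFDeriv_eq_norm_iteratedDeriv, Real.norm_eq_abs]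
  have hc : ContDiff ℝ j (fun x : ℝ => Real.cos (k * x)) := by fun_prop
  rw [iteratedDeriv_const_mul_field, iteratedDeriv_comp_const_mul Real.contDiff_cos]
  simp only [abs_mul, abs_pow, Nat.abs_cast]
  gcongr
  exact mul_le_of_le_one_right (by positivity) (Real.abs_iteratedDeriv_cos_le_one _ _)

theorem pow_mul_wbase_pow_le (k j : ℕ) : (k : ℝ) ^ j * wbase ^ k ≤ j.factorial := by
  have h := Real.pow_div_factorial_le_exp (k : ℝ) (by positivity) j
  rw [wbase_pow, Real.exp_neg, ← div_eq_mul_inv, div_le_iff₀ (Real.exp_pos _)]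
  rwa [div_le_iff₀ (by positivity), mul_comm] at h

/-- Since `k^j exp (-k) ≤ j!`, every derivative of the wave is controlled by the `ℓ¹` norm alone.
Convergence in `ℓ¹` therefore implies convergence in every Hölder norm. -/
theorem abs_waveCoeff_mul_pow_le (a : L1) (k j : ℕ) :
    |waveCoeff a k| * (k : ℝ) ^ j ≤ |cf a k| * j.factorial := by
  have h0 : 0 ≤ wbase ^ k := pow_nonneg isWeight_wbase.1 k
  have h1 : |waveCoeff a k| ≤ |cf a k| * wbase ^ k := by
    rw [waveCoeff, cf_opJ, abs_mul, abs_mul, abs_of_nonneg h0]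
    gcongr
    exact mul_le_of_le_one_left (abs_nonneg _) (inv_nat_le_one k)
  calc |waveCoeff a k| * (k : ℝ) ^ j ≤ |cf a k| * wbase ^ k * (k : ℝ) ^ j := by gcongr
    _ = |cf a k| * ((k : ℝ) ^ j * wbase ^ k) := by ring
    _ ≤ _ := by gcongr; exact pow_mul_wbase_pow_le k j

theorem norm_iteratedFDeriv_waveTerm_le (a : L1) (k j : ℕ) (x : ℝ) :
    ‖iteratedFDeriv ℝ j (fun x => waveCoeff a k * Real.cos (k * x)) x‖ ≤
      |cf a k| * j.factorial :=
  (abs_iteratedDeriv_cos_mul_le _ _ _ _).trans (abs_waveCoeff_mul_pow_le a k j)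

theorem contDiff_waveTerm (a : L1) (k : ℕ) :
    ContDiff ℝ (⊤ : ℕ∞) (fun x : ℝ => waveCoeff a k * Real.cos (k * x)) := by fun_prop

theorem contDiff_wave (a : L1) (n : ℕ) : ContDiff ℝ n (wave a) := by
  have h : ContDiff ℝ (⊤ : ℕ∞) (fun x : ℝ => ∑' k : ℕ, waveCoeff a k * Real.cos (k * x)) :=
    contDiff_tsum (contDiff_waveTerm a)
      (fun j _ => (summable_abs_cf a).mul_right (j.factorial : ℝ))
      (fun j k x _ => norm_iteratedFDeriv_waveTerm_le a k j x)
  exact h.of_le (by exact_mod_cast le_top)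

theorem abs_iteratedDeriv_wave_le (a : L1) (j : ℕ) (x : ℝ) :
    |iteratedDeriv j (wave a) x| ≤ j.factorial * ‖a‖ := by
  rw [← Real.norm_eq_abs, ← norm_iteratedFDeriv_eq_norm_iteratedDeriv]
  have e : iteratedFDeriv ℝ j (wave a) x =
      ∑' k : ℕ, iteratedFDeriv ℝ j (fun x => waveCoeff a k * Real.cos (k * x)) x :=
    iteratedFDeriv_tsum_apply (contDiff_waveTerm a)
      (fun j _ => (summable_abs_cf a).mul_right (j.factorial : ℝ))
      (fun j k x _ => norm_iteratedFDeriv_waveTerm_le a k j x) le_top x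
  rw [e, mul_comm]
  exact tsum_of_norm_bounded ((hasSum_abs_cf a).mul_right _)
    fun k => norm_iteratedFDeriv_waveTerm_le a k j x

theorem abs_sub_le_of_abs_deriv_le {f : ℝ → ℝ} (hf : Differentiable ℝ f) {L : ℝ}
    (hL : ∀ x, |deriv f x| ≤ L) (x y : ℝ) : |f x - f y| ≤ L * |x - y| := by
  have := convex_univ.norm_image_sub_le_of_norm_deriv_le (f := f) (fun z _ => hf z)
    (fun z _ => hL z) (mem_univ y) (mem_univ x)
  simpa using this

/-- The constant in the Hölder estimate for waves. -/
def waveConst (n : ℕ) : ℝ :=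
  ∑ j ∈ Finset.range (n + 1), (j.factorial : ℝ) + ((n + 1).factorial + 2 * n.factorial)

theorem waveConst_pos (n : ℕ) : 0 < waveConst n := by unfold waveConst; positivity

theorem holderNorm_wave_le (n : ℕ) {α : ℝ≥0} (hα : α ≤ 1) (a : L1) :
    holderNorm n α (wave a) ≤ ENNReal.ofReal (waveConst n * ‖a‖) := by
  set L : ℝ := (n + 1).factorial * ‖a‖
  set M : ℝ := n.factorial * ‖a‖
  have hL : 0 ≤ L := by positivity
  have hM : 0 ≤ M := by positivity
  have hd : Differentiable ℝ (iteratedDeriv n (wave a)) :=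
    (contDiff_wave a (n + 1)).differentiable_iteratedDeriv n (by exact_mod_cast n.lt_succ_self)
  have h := holderNorm_le (n := n) (α := α) (f := wave a) (M := fun j => j.factorial * ‖a‖)
    (K := (L + (M + M)).toNNReal) (fun j => by positivity)
    (fun j _ x => abs_iteratedDeriv_wave_le a j x) (fun x y => by
      rw [Real.coe_toNNReal _ (by positivity)]
      refine min_le_rpow (abs_nonneg _) α.coe_nonneg (by exact_mod_cast hα) hL (by positivity) ?_ ?_
      · refine abs_sub_le_of_abs_deriv_le hd (fun z => ?_) x y
        rw [← iteratedDeriv_succ]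
        exact abs_iteratedDeriv_wave_le a (n + 1) z
      · exact (abs_sub _ _).trans (add_le_add (abs_iteratedDeriv_wave_le a n x)
          (abs_iteratedDeriv_wave_le a n y)))
  refine h.trans (ENNReal.ofReal_le_ofReal (le_of_eq ?_))
  rw [Real.coe_toNNReal _ (by positivity), ← Finset.sum_mul, waveConst]
  simp only [L, M]; ring

theorem isHolder_wave (n : ℕ) {α : ℝ≥0} (hα : α ≤ 1) (a : L1) : IsHolder n α (wave a) :=
  ⟨contDiff_wave a n, (holderNorm_wave_le n hα a).trans_lt ENNReal.ofReal_lt_top⟩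

theorem abs_iteratedDeriv_le_of_holderNorm {n : ℕ} {α : ℝ≥0} {f : ℝ → ℝ} {K : ℝ} (hK : 0 ≤ K)
    (h : holderNorm n α f ≤ ENNReal.ofReal K) {j : ℕ} (hj : j ≤ n) (x : ℝ) :
    |iteratedDeriv j f x| ≤ K := by
  have h1 : ‖iteratedDeriv j f x‖ₑ ≤ ENNReal.ofReal K := by
    refine le_trans ?_ h
    refine le_trans ?_ le_self_add
    refine le_trans (le_iSup (fun x => ‖iteratedDeriv j f x‖ₑ) x) ?_
    exact Finset.single_le_sum (f := fun j => ⨆ x : ℝ, ‖iteratedDeriv j f x‖ₑ)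
      (fun _ _ => zero_le) (Finset.mem_range.2 (Nat.lt_succ_of_le hj))
  rw [Real.enorm_eq_ofReal_abs] at h1
  exact (ENNReal.ofReal_le_ofReal_iff hK).1 h1

theorem holderWith_of_holderNorm {n : ℕ} {α : ℝ≥0} {f : ℝ → ℝ} {K : ℝ}
    (h : holderNorm n α f ≤ ENNReal.ofReal K) (x y : ℝ) (hK : 0 ≤ K) :
    |iteratedDeriv n f x - iteratedDeriv n f y| ≤ K * |x - y| ^ (α : ℝ) := by
  have h1 : eHolderNorm α (iteratedDeriv n f) ≤ ENNReal.ofReal K := le_trans le_add_self h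
  have h2 : MemHolder α (iteratedDeriv n f) := by
    rw [← eHolderNorm_lt_top]; exact h1.trans_lt ENNReal.ofReal_lt_top
  have h3 := HolderWith.real_bound h2.holderWith x y
  refine h3.trans ?_
  gcongr
  rw [← ENNReal.ofReal_le_ofReal_iff hK, ENNReal.ofReal_coe_nnreal, h2.coe_nnHolderNorm_eq_eHolderNorm]
  exact h1

/-- For `n = 1` the derivative is Hölder by definition. For `n ≥ 2` it is Lipschitz with constant
`K` and oscillates by at most `2K`, and interpolation costs the factor `3`. -/
theorem holderFlat_of_holderNorm {n : ℕ} (hn : 1 ≤ n) {α : ℝ≥0} (hα1 : α ≤ 1) {f : ℝ → ℝ}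
    {K : ℝ} (hK : 0 ≤ K) (hf : ContDiff ℝ n f) (h : holderNorm n α f ≤ ENNReal.ofReal K) :
    HolderFlat α (3 * K) f := by
  have hdiff : Differentiable ℝ f := hf.differentiable (by exact_mod_cast (by omega : n ≠ 0))
  have h0 : ∀ x, |f x| ≤ K := fun x => by
    simpa using abs_iteratedDeriv_le_of_holderNorm hK h (Nat.zero_le n) x
  have h1 : ∀ x, |deriv f x| ≤ K := fun x => by
    simpa using abs_iteratedDeriv_le_of_holderNorm hK h hn x
  have h2 : ∀ x y, |deriv f x - deriv f y| ≤ 3 * K * |x - y| ^ (α : ℝ) := by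
    intro x y
    rcases hn.eq_or_lt with rfl | hn2
    · have := holderWith_of_holderNorm h x y hK
      rw [iteratedDeriv_one] at this
      have h3 : 0 ≤ |x - y| ^ (α : ℝ) := by positivity
      nlinarith
    · have hd : Differentiable ℝ (deriv f) := by
        have := hf.differentiable_iteratedDeriv 1 (by exact_mod_cast hn2)
        rwa [iteratedDeriv_one] at this
      have h3 : 3 * K = K + (K + K) := by ring
      rw [h3]
      refine min_le_rpow (abs_nonneg _) α.coe_nonneg (by exact_mod_cast hα1) hK (by positivity) ?_ ?_
      · refine abs_sub_le_of_abs_deriv_le hd (fun z => ?_) x y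
        rw [← iteratedDeriv_one (f := f), ← iteratedDeriv_succ]
        exact abs_iteratedDeriv_le_of_holderNorm hK h hn2 z
      · exact (abs_sub _ _).trans (add_le_add (h1 x) (h1 y))
  refine ⟨hdiff, fun x => by linarith [h0 x], fun x => by linarith [h1 x], fun x t => ?_⟩
  have hd : ∀ z ∈ uIcc x (x + t), HasDerivWithinAt (fun z => f z - deriv f x * z)
      (deriv f z - deriv f x) (uIcc x (x + t)) z := fun z _ => by
    have := (hdiff z).hasDerivAt.fun_sub ((hasDerivAt_id z).const_mul (deriv f x))
    exact (this.congr_deriv (by simp)).hasDerivWithinAt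
  have hb : ∀ z ∈ uIcc x (x + t), ‖deriv f z - deriv f x‖ ≤ 3 * K * |t| ^ (α : ℝ) := fun z hz => by
    refine (h2 z x).trans ?_
    have := abs_sub_left_of_mem_uIcc hz
    rw [add_sub_cancel_left] at this
    exact mul_le_mul_of_nonneg_left
      (Real.rpow_le_rpow (abs_nonneg _) this α.coe_nonneg) (by positivity)
  have h4 := (convex_uIcc x (x + t)).norm_image_sub_le_of_norm_hasDerivWithin_le hd hb
    left_mem_uIcc right_mem_uIcc
  have e1 : f (x + t) - deriv f x * (x + t) - (f x - deriv f x * x) =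
      f (x + t) - f x - deriv f x * t := by ring
  rw [e1, Real.norm_eq_abs, Real.norm_eq_abs, add_sub_cancel_left] at h4
  refine h4.trans (le_of_eq ?_)
  rcases eq_or_ne t 0 with rfl | ht
  · have : (1 : ℝ) + α ≠ 0 := by positivity
    simp [Real.zero_rpow this]
  · rw [Real.rpow_add (abs_pos.2 ht), Real.rpow_one]; ring

theorem holderNorm_comp_add_const (n : ℕ) (α : ℝ≥0) (f : ℝ → ℝ) (c : ℝ) :
    holderNorm n α (fun x => f (x + c)) = holderNorm n α f := by
  have h1 : ∀ j, iteratedDeriv j (fun x => f (x + c)) = fun x => iteratedDeriv j f (x + c) :=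
    fun j => iteratedDeriv_comp_add_const j f c
  have key : ∀ (g : ℝ → ℝ) (C : ℝ≥0) (c : ℝ), HolderWith C α g →
      HolderWith C α fun x => g (x + c) := by
    intro g C c hg x y
    simpa using hg (x + c) (y + c)
  unfold holderNorm
  simp only [h1]
  congr 1
  · refine Finset.sum_congr rfl fun j _ => ?_
    exact (Equiv.addRight c).surjective.iSup_comp (g := fun x => ‖iteratedDeriv j f x‖ₑ)
  · unfold eHolderNorm
    refine iInf_congr fun C => iInf_congr_Prop ⟨fun h => ?_, fun h => key _ _ _ h⟩ fun _ => rfl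
    simpa using key _ _ (-c) h

/-! ### Orthogonal expansions on `[-π, π]` -/

open Real MeasureTheory intervalIntegral in
theorem integral_cos_int_mul (m : ℤ) :
    ∫ x in (-π)..π, Real.cos (m * x) = if m = 0 then 2 * π else 0 := by
  split_ifs with hm
  · subst hm; simp; ring
  · have h0 : (m : ℝ) ≠ 0 := by exact_mod_cast hm
    rw [intervalIntegral.integral_comp_mul_left (fun x => Real.cos x) h0, integral_cos]
    simp [Real.sin_int_mul_pi]

/-- Bounded measurable functions. -/
def BddMeas (u : ℝ → ℝ) : Prop := Measurable u ∧ ∃ C, ∀ x, |u x| ≤ C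

theorem BddMeas.mul {u v : ℝ → ℝ} (hu : BddMeas u) (hv : BddMeas v) :
    BddMeas fun x => u x * v x := by
  obtain ⟨hu, C, hC⟩ := hu
  obtain ⟨hv, D, hD⟩ := hv
  refine ⟨hu.mul hv, C * D, fun x => ?_⟩
  rw [abs_mul]
  exact mul_le_mul (hC x) (hD x) (abs_nonneg _) ((abs_nonneg _).trans (hC x))

theorem BddMeas.add {u v : ℝ → ℝ} (hu : BddMeas u) (hv : BddMeas v) :
    BddMeas fun x => u x + v x := by
  obtain ⟨hu, C, hC⟩ := hu
  obtain ⟨hv, D, hD⟩ := hv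
  exact ⟨hu.add hv, C + D, fun x => (abs_add_le _ _).trans (add_le_add (hC x) (hD x))⟩

theorem BddMeas.const (c : ℝ) : BddMeas fun _ => c := ⟨measurable_const, |c|, fun _ => le_rfl⟩

theorem BddMeas.const_mul {u : ℝ → ℝ} (c : ℝ) (hu : BddMeas u) : BddMeas fun x => c * u x :=
  (BddMeas.const c).mul hu

theorem BddMeas.neg {u : ℝ → ℝ} (hu : BddMeas u) : BddMeas fun x => -u x := by
  obtain ⟨hu, C, hC⟩ := hu
  exact ⟨hu.neg, C, fun x => by rw [abs_neg]; exact hC x⟩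

theorem BddMeas.sub {u v : ℝ → ℝ} (hu : BddMeas u) (hv : BddMeas v) :
    BddMeas fun x => u x - v x := by
  simpa [sub_eq_add_neg] using hu.add hv.neg

theorem BddMeas.pow {u : ℝ → ℝ} (hu : BddMeas u) (n : ℕ) : BddMeas fun x => u x ^ n := by
  obtain ⟨hu, C, hC⟩ := hu
  refine ⟨hu.pow_const n, C ^ n, fun x => ?_⟩
  rw [abs_pow]
  exact pow_le_pow_left₀ (abs_nonneg _) (hC x) n

theorem BddMeas.intervalIntegrable {u : ℝ → ℝ} (hu : BddMeas u) (a b : ℝ) :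
    IntervalIntegrable u MeasureTheory.volume a b := by
  obtain ⟨hm, C, hC⟩ := hu
  rw [intervalIntegrable_iff]
  exact MeasureTheory.Measure.integrableOn_of_bounded (M := C) (by simp)
    hm.aestronglyMeasurable (Eventually.of_forall hC)

/-- The integral over a period. -/
def perInt (u : ℝ → ℝ) : ℝ := ∫ x in (-Real.pi)..Real.pi, u x

theorem neg_pi_le_pi : -Real.pi ≤ Real.pi := by linarith [Real.pi_pos]

theorem perInt_add {u v : ℝ → ℝ} (hu : BddMeas u) (hv : BddMeas v) :
    perInt (fun x => u x + v x) = perInt u + perInt v :=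
  intervalIntegral.integral_add (hu.intervalIntegrable _ _) (hv.intervalIntegrable _ _)

theorem perInt_sub {u v : ℝ → ℝ} (hu : BddMeas u) (hv : BddMeas v) :
    perInt (fun x => u x - v x) = perInt u - perInt v :=
  intervalIntegral.integral_sub (hu.intervalIntegrable _ _) (hv.intervalIntegrable _ _)

theorem perInt_const_mul (c : ℝ) (u : ℝ → ℝ) : perInt (fun x => c * u x) = c * perInt u :=
  intervalIntegral.integral_const_mul c u

theorem perInt_mono {u v : ℝ → ℝ} (hu : BddMeas u) (hv : BddMeas v) (h : ∀ x, u x ≤ v x) :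
    perInt u ≤ perInt v :=
  intervalIntegral.integral_mono_on neg_pi_le_pi (hu.intervalIntegrable _ _)
    (hv.intervalIntegrable _ _) fun x _ => h x

theorem perInt_nonneg {u : ℝ → ℝ} (h : ∀ x, 0 ≤ u x) : 0 ≤ perInt u :=
  intervalIntegral.integral_nonneg neg_pi_le_pi fun x _ => h x

theorem tendsto_perInt {F : ℕ → ℝ → ℝ} {f : ℝ → ℝ} {C : ℝ} (hF : ∀ n, Measurable (F n))
    (hC : ∀ n x, |F n x| ≤ C) (hlim : ∀ x, Tendsto (fun n => F n x) atTop (𝓝 (f x))) :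
    Tendsto (fun n => perInt (F n)) atTop (𝓝 (perInt f)) :=
  intervalIntegral.tendsto_integral_filter_of_dominated_convergence (fun _ => C)
    (Eventually.of_forall fun n => (hF n).aestronglyMeasurable)
    (Eventually.of_forall fun n => Eventually.of_forall fun x _ => hC n x)
    (by simp) (Eventually.of_forall fun x _ => hlim x)

/-- A uniformly bounded orthogonal family on `[-π, π]` with square norms `ν`. -/
structure IsOrthoFamily (φ : ℕ → ℝ → ℝ) (ν : ℕ → ℝ) : Prop where
  meas : ∀ k, Measurable (φ k)
  bound : ∀ k x, |φ k x| ≤ 1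
  ortho : ∀ j k, perInt (fun x => φ j x * φ k x) = if j = k then ν k else 0

section Ortho

variable {φ : ℕ → ℝ → ℝ} {ν : ℕ → ℝ}

theorem IsOrthoFamily.bddMeas (hφ : IsOrthoFamily φ ν) (k : ℕ) : BddMeas (φ k) :=
  ⟨hφ.meas k, 1, hφ.bound k⟩

theorem IsOrthoFamily.nu_nonneg (hφ : IsOrthoFamily φ ν) (k : ℕ) : 0 ≤ ν k := by
  have := hφ.ortho k k
  rw [if_pos rfl] at this
  rw [← this]
  exact perInt_nonneg fun x => mul_self_nonneg _

/-- The projections are subtracted one at a time. Writing the coefficients as `ν k * t k` avoids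
division, so the zero function `sin (0 · x)`, with `ν 0 = 0`, is admitted. -/
theorem IsOrthoFamily.bessel (hφ : IsOrthoFamily φ ν) {u : ℝ → ℝ} (hu : BddMeas u) {t : ℕ → ℝ}
    (s : Finset ℕ) (ht : ∀ k ∈ s, perInt (fun x => u x * φ k x) = ν k * t k) :
    ∑ k ∈ s, ν k * t k ^ 2 ≤ perInt fun x => u x ^ 2 := by
  have key : ∀ s : Finset ℕ, (∀ k ∈ s, perInt (fun x => u x * φ k x) = ν k * t k) →
      BddMeas (fun x => u x - ∑ k ∈ s, t k * φ k x) ∧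
      (∀ j ∉ s, perInt (fun x => (u x - ∑ k ∈ s, t k * φ k x) * φ j x) =
        perInt fun x => u x * φ j x) ∧
      perInt (fun x => (u x - ∑ k ∈ s, t k * φ k x) ^ 2) =
        perInt (fun x => u x ^ 2) - ∑ k ∈ s, ν k * t k ^ 2 := by
    intro s
    induction s using Finset.induction_on with
    | empty => intro _; simpa using hu
    | insert i s hi ih =>
      intro ht
      obtain ⟨h1, h2, h3⟩ := ih fun k hk => ht k (Finset.mem_insert_of_mem hk)
      set v := fun x => u x - ∑ k ∈ s, t k * φ k x with hv
      have hi' := hφ.bddMeas i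
      have e : (fun x => u x - ∑ k ∈ insert i s, t k * φ k x) = fun x => v x - t i * φ i x := by
        ext x; rw [Finset.sum_insert hi, hv]; ring
      have e' : ∀ x, u x - ∑ k ∈ insert i s, t k * φ k x = v x - t i * φ i x := fun x => congrFun e x
      refine ⟨?_, ?_, ?_⟩
      · rw [e]; exact h1.sub (hi'.const_mul _)
      · intro j hj
        have hij : i ≠ j := fun h => hj (h ▸ Finset.mem_insert_self i s)
        have e2 : (fun x => (u x - ∑ k ∈ insert i s, t k * φ k x) * φ j x) =
            fun x => v x * φ j x - t i * (φ i x * φ j x) := by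
          ext x; rw [e' x]; ring
        rw [e2, perInt_sub (h1.mul (hφ.bddMeas j)) ((hi'.mul (hφ.bddMeas j)).const_mul _),
          perInt_const_mul, hφ.ortho, if_neg hij, mul_zero, sub_zero]
        exact h2 j fun h => hj (Finset.mem_insert_of_mem h)
      · have e2 : (fun x => (u x - ∑ k ∈ insert i s, t k * φ k x) ^ 2) =
            fun x => v x ^ 2 - (2 * t i) * (v x * φ i x) + t i ^ 2 * (φ i x * φ i x) := by
          ext x; rw [e' x]; ring
        have a1 := h1.pow 2
        have a2 := (h1.mul hi').const_mul (2 * t i)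
        have a3 := (hi'.mul hi').const_mul (t i ^ 2)
        rw [e2, perInt_add (a1.sub a2) a3, perInt_sub a1 a2, perInt_const_mul, perInt_const_mul,
          hφ.ortho, if_pos rfl, h3, h2 i hi, ht i (Finset.mem_insert_self i s),
          Finset.sum_insert hi]
        ring
  obtain ⟨-, -, h3⟩ := key s ht
  have := perInt_nonneg (u := fun x => (u x - ∑ k ∈ s, t k * φ k x) ^ 2) fun x => sq_nonneg _
  linarith

variable {c : ℕ → ℝ}

theorem IsOrthoFamily.summable (hφ : IsOrthoFamily φ ν) (hc : Summable fun k => |c k|) (x : ℝ) :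
    Summable fun k => c k * φ k x :=
  Summable.of_norm_bounded hc fun k => by
    rw [Real.norm_eq_abs, abs_mul]
    exact mul_le_of_le_one_right (abs_nonneg _) (hφ.bound k x)

theorem IsOrthoFamily.abs_tsum_le (hφ : IsOrthoFamily φ ν) (hc : Summable fun k => |c k|) (x : ℝ) :
    |∑' k, c k * φ k x| ≤ ∑' k, |c k| := by
  rw [← Real.norm_eq_abs]
  refine tsum_of_norm_bounded hc.hasSum fun k => ?_
  rw [Real.norm_eq_abs, abs_mul]
  exact mul_le_of_le_one_right (abs_nonneg _) (hφ.bound k x)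

theorem IsOrthoFamily.bddMeas_tsum (hφ : IsOrthoFamily φ ν) (hc : Summable fun k => |c k|) :
    BddMeas fun x => ∑' k, c k * φ k x := by
  refine ⟨?_, _, hφ.abs_tsum_le hc⟩
  refine measurable_of_tendsto_metrizable (f := fun (n : ℕ) x => ∑ k ∈ Finset.range n, c k * φ k x)
    (fun n => ?_) ?_
  · exact Finset.measurable_sum _ fun k _ => (hφ.meas k).const_mul _
  · exact tendsto_pi_nhds.2 fun x => (hφ.summable hc x).hasSum.tendsto_sum_nat

theorem IsOrthoFamily.hasSum_perInt (hφ : IsOrthoFamily φ ν) (hc : Summable fun k => |c k|)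
    {v : ℝ → ℝ} (hv : BddMeas v) :
    HasSum (fun k => c k * perInt (fun x => v x * φ k x))
      (perInt fun x => v x * ∑' k, c k * φ k x) := by
  obtain ⟨hvm, D, hD⟩ := hv
  have h := intervalIntegral.hasSum_integral_of_dominated_convergence
    (μ := MeasureTheory.volume) (a := -Real.pi) (b := Real.pi)
    (F := fun k x => c k * (v x * φ k x)) (f := fun x => v x * ∑' k, c k * φ k x)
    (fun k _ => |c k| * D) (fun k => (((hvm.mul (hφ.meas k)).const_mul _)).aestronglyMeasurable)
    (fun k => Eventually.of_forall fun x _ => ?_)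
    (Eventually.of_forall fun x _ => hc.mul_right D) (by simp)
    (Eventually.of_forall fun x _ => ?_)
  · simp only [intervalIntegral.integral_const_mul] at h
    exact h
  · rw [Real.norm_eq_abs, abs_mul, abs_mul]
    have h1 : |v x| * |φ k x| ≤ D * 1 :=
      mul_le_mul (hD x) (hφ.bound k x) (abs_nonneg _) ((abs_nonneg _).trans (hD x))
    rw [mul_one] at h1
    gcongr
  · have e : (fun k => c k * (v x * φ k x)) = fun k => v x * (c k * φ k x) := by ext k; ring
    rw [e]
    exact (hφ.summable hc x).hasSum.mul_left (v x)

theorem IsOrthoFamily.perInt_tsum_mul (hφ : IsOrthoFamily φ ν) (hc : Summable fun k => |c k|)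
    (j : ℕ) : perInt (fun x => (∑' k, c k * φ k x) * φ j x) = ν j * c j := by
  have h := (hφ.hasSum_perInt hc (hφ.bddMeas j)).tsum_eq
  simp only [hφ.ortho] at h
  rw [tsum_eq_single j (fun k hk => by simp [hk.symm])] at h
  simp only [if_true] at h
  rw [mul_comm (ν j), h]
  congr 1; ext x; ring

theorem IsOrthoFamily.parseval (hφ : IsOrthoFamily φ ν) (hc : Summable fun k => |c k|) :
    HasSum (fun k => ν k * c k ^ 2) (perInt fun x => (∑' k, c k * φ k x) ^ 2) := by
  have h := hφ.hasSum_perInt hc (hφ.bddMeas_tsum hc)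
  simp only [hφ.perInt_tsum_mul hc] at h
  have e : (fun x => (∑' k, c k * φ k x) ^ 2) =
      fun x => (∑' k, c k * φ k x) * ∑' k, c k * φ k x := by ext x; ring
  have e2 : (fun k => ν k * c k ^ 2) = fun k => c k * (ν k * c k) := by ext k; ring
  rw [e, e2]
  exact h

end Ortho

def cosNorm (k : ℕ) : ℝ := if k = 0 then 2 * Real.pi else Real.pi

def sinNorm (k : ℕ) : ℝ := if k = 0 then 0 else Real.pi

theorem isOrthoFamily_cos : IsOrthoFamily (fun k x => Real.cos (k * x)) cosNorm := by
  refine ⟨fun k => by fun_prop, fun k x => Real.abs_cos_le_one _, fun j k => ?_⟩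
  have e : (fun x : ℝ => Real.cos (j * x) * Real.cos (k * x)) = fun x =>
      (1 / 2) * (Real.cos ((j - k : ℤ) * x) + Real.cos ((j + k : ℤ) * x)) := by
    ext x
    push_cast
    rw [sub_mul, add_mul, Real.cos_sub, Real.cos_add]; ring
  have hb : ∀ m : ℤ, BddMeas fun x : ℝ => Real.cos (m * x) := fun m =>
    ⟨by fun_prop, 1, fun x => Real.abs_cos_le_one _⟩
  rw [e, perInt_const_mul, perInt_add (hb _) (hb _), perInt, perInt, integral_cos_int_mul,
    integral_cos_int_mul]
  rcases eq_or_ne j k with rfl | hjk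
  · rcases eq_or_ne j 0 with rfl | hj
    · simp [cosNorm]; ring
    · have : (j : ℤ) + j ≠ 0 := by omega
      simp [cosNorm, hj, this]
  · have h1 : (j : ℤ) - k ≠ 0 := by omega
    have h2 : (j : ℤ) + k ≠ 0 := by omega
    simp [hjk, h1, h2]

theorem isOrthoFamily_sin : IsOrthoFamily (fun k x => Real.sin (k * x)) sinNorm := by
  refine ⟨fun k => by fun_prop, fun k x => Real.abs_sin_le_one _, fun j k => ?_⟩
  have e : (fun x : ℝ => Real.sin (j * x) * Real.sin (k * x)) = fun x =>
      (1 / 2) * (Real.cos ((j - k : ℤ) * x) - Real.cos ((j + k : ℤ) * x)) := by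
    ext x
    push_cast
    rw [sub_mul, add_mul, Real.cos_sub, Real.cos_add]; ring
  have hb : ∀ m : ℤ, BddMeas fun x : ℝ => Real.cos (m * x) := fun m =>
    ⟨by fun_prop, 1, fun x => Real.abs_cos_le_one _⟩
  rw [e, perInt_const_mul, perInt_sub (hb _) (hb _), perInt, perInt, integral_cos_int_mul,
    integral_cos_int_mul]
  rcases eq_or_ne j k with rfl | hjk
  · rcases eq_or_ne j 0 with rfl | hj
    · simp [sinNorm]
    · have : (j : ℤ) + j ≠ 0 := by omega
      simp [sinNorm, hj, this]
  · have h1 : (j : ℤ) - k ≠ 0 := by omega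
    have h2 : (j : ℤ) + k ≠ 0 := by omega
    simp [hjk, h1, h2]

/-! ### Energy identities for the Dirichlet-Neumann operator -/

/-- Identifies a limit of regularised series whose formal limit series need not converge absolutely.
Coefficients pass to the limit by dominated convergence, and Bessel gives one half of Parseval. The
other half follows from Parseval for each regularised series together with `|p n k| ≤ |P k|`.
Completeness of the trigonometric system is not used. -/
theorem IsOrthoFamily.multiplier_limit {φ : ℕ → ℝ → ℝ} {ν : ℕ → ℝ} (hφ : IsOrthoFamily φ ν)
    {c : ℕ → ℝ} (hc : Summable fun k => |c k|) {p : ℕ → ℕ → ℝ} {P : ℕ → ℝ} {F : ℝ → ℝ} {C : ℝ}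
    (hp : ∀ n k, |p n k| ≤ |P k|) (hpB : ∀ n, ∃ B, ∀ k, |p n k| ≤ B)
    (hlim : ∀ k, Tendsto (fun n => p n k) atTop (𝓝 (P k)))
    (hC : ∀ n x, |∑' k, (p n k * c k) * φ k x| ≤ C)
    (hF : ∀ x, Tendsto (fun n => ∑' k, (p n k * c k) * φ k x) atTop (𝓝 (F x))) :
    BddMeas F ∧ (∀ k, perInt (fun x => F x * φ k x) = ν k * (P k * c k)) ∧
      HasSum (fun k => ν k * (P k * c k) ^ 2) (perInt fun x => F x ^ 2) := by
  have hs : ∀ n, Summable fun k => |p n k * c k| := fun n => by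
    obtain ⟨B, hB⟩ := hpB n
    refine (hc.mul_left B).of_nonneg_of_le (fun k => abs_nonneg _) fun k => ?_
    rw [abs_mul]; gcongr; exact hB k
  have hmeas : ∀ n, Measurable fun x => ∑' k, (p n k * c k) * φ k x := fun n =>
    (hφ.bddMeas_tsum (hs n)).1
  have hFb : BddMeas F := ⟨measurable_of_tendsto_metrizable hmeas (tendsto_pi_nhds.2 hF), C,
    fun x => le_of_tendsto (hF x).abs (Eventually.of_forall fun n => hC n x)⟩
  have hcoef : ∀ k, perInt (fun x => F x * φ k x) = ν k * (P k * c k) := fun k => by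
    have h1 : Tendsto (fun n => perInt fun x => (∑' k, (p n k * c k) * φ k x) * φ k x) atTop
        (𝓝 (perInt fun x => F x * φ k x)) := by
      refine tendsto_perInt (C := C) (fun n => (hmeas n).mul (hφ.meas k)) (fun n x => ?_)
        fun x => (hF x).mul_const _
      rw [abs_mul]
      have := mul_le_mul (hC n x) (hφ.bound k x) (abs_nonneg _) ((abs_nonneg _).trans (hC n x))
      simpa using this
    simp only [hφ.perInt_tsum_mul (hs _)] at h1
    exact tendsto_nhds_unique h1 (((hlim k).mul_const _).const_mul _)
  have hnn : ∀ k, 0 ≤ ν k * (P k * c k) ^ 2 := fun k => mul_nonneg (hφ.nu_nonneg k) (sq_nonneg _)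
  have hbes : ∀ s : Finset ℕ, ∑ k ∈ s, ν k * (P k * c k) ^ 2 ≤ perInt fun x => F x ^ 2 :=
    fun s => hφ.bessel hFb s fun k _ => hcoef k
  have hsum : Summable fun k => ν k * (P k * c k) ^ 2 := summable_of_sum_le hnn hbes
  refine ⟨hFb, hcoef, ?_⟩
  have hle : ∑' k, ν k * (P k * c k) ^ 2 ≤ perInt fun x => F x ^ 2 :=
    hsum.tsum_le_of_sum_le hbes
  have hge : perInt (fun x => F x ^ 2) ≤ ∑' k, ν k * (P k * c k) ^ 2 := by
    have h1 : Tendsto (fun n => perInt fun x => (∑' k, (p n k * c k) * φ k x) ^ 2) atTop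
        (𝓝 (perInt fun x => F x ^ 2)) := by
      refine tendsto_perInt (C := C ^ 2) (fun n => (hmeas n).pow_const 2) (fun n x => ?_)
        fun x => (hF x).pow 2
      rw [abs_pow]
      exact pow_le_pow_left₀ (abs_nonneg _) (hC n x) 2
    refine le_of_tendsto h1 (Eventually.of_forall fun n => ?_)
    have h2 := hφ.parseval (hs n)
    rw [← h2.tsum_eq]
    refine h2.summable.tsum_le_tsum (fun k => ?_) hsum
    refine mul_le_mul_of_nonneg_left ?_ (hφ.nu_nonneg k)
    rw [mul_pow, mul_pow]
    exact mul_le_mul_of_nonneg_right (sq_le_sq.2 (hp n k)) (sq_nonneg _)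
  rw [le_antisymm hge hle]
  exact hsum.hasSum

section DN

variable {h : ℝ}

theorem hasDerivAt_stripProfile_zero (h : ℝ) (k : ℕ) :
    HasDerivAt (stripProfile h k) (dnSymbol h k) 0 := by
  refine (hasDerivAt_stripProfile h k 0).congr_deriv ?_
  simp [dnSymbol]

/-- The derivative of the profile is nondecreasing on `[-h, 0]`, so it never exceeds its value at
the top, the symbol. This is the domination required by `multiplier_limit`. -/
theorem stripProfile_quotient_mem (hh : 0 < h) (k : ℕ) {t : ℝ} (ht0 : 0 < t) (hth : t ≤ h) :
    (1 - stripProfile h k (-t)) / t ∈ Icc 0 (dnSymbol h k) := by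
  refine ⟨div_nonneg (sub_nonneg.2
    (stripProfile_mem_Icc hh k ⟨by linarith, by linarith⟩).2) ht0.le, ?_⟩
  rw [div_le_iff₀ ht0]
  have hdiff : Differentiable ℝ (stripProfile h k) := fun y =>
    (hasDerivAt_stripProfile h k y).differentiableAt
  have h1 := (convex_Icc (-t) 0).image_sub_le_mul_sub_of_deriv_le (C := dnSymbol h k)
    hdiff.continuous.continuousOn hdiff.differentiableOn (fun y hy => ?_)
    (-t) ⟨le_rfl, by linarith⟩ 0 ⟨by linarith, le_rfl⟩ (by linarith)
  · rw [stripProfile_top hh] at h1; linarith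
  · rw [interior_Icc] at hy
    rw [(hasDerivAt_stripProfile h k y).deriv, dnSymbol]
    split_ifs with hk
    · exact le_rfl
    · have := sinh_nat_mul_pos hh hk
      gcongr
      rw [Real.cosh_le_cosh, abs_of_nonneg, abs_of_nonneg (by positivity)]
      · gcongr; linarith [hy.2]
      · exact mul_nonneg (by positivity) (by linarith [hy.1])

theorem tendsto_stripProfile_quotient (hh : 0 < h) (k : ℕ) :
    Tendsto (fun n : ℕ => (1 - stripProfile h k (-(h / (n + 1)))) / (h / (n + 1))) atTop
      (𝓝 (dnSymbol h k)) := by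
  have ht : Tendsto (fun n : ℕ => -(h / ((n : ℝ) + 1))) atTop (𝓝[≠] 0) := by
    refine tendsto_nhdsWithin_iff.2 ⟨?_, Eventually.of_forall fun n => ?_⟩
    · have := (tendsto_one_div_add_atTop_nhds_zero_nat (𝕜 := ℝ)).const_mul (-h)
      simpa [div_eq_mul_inv] using this
    · have : 0 < h / ((n : ℝ) + 1) := by positivity
      simpa using this.ne'
  have h1 := (hasDerivAt_iff_tendsto_slope.1 (hasDerivAt_stripProfile_zero h k)).comp ht
  refine h1.congr fun n => ?_
  simp only [Function.comp_apply, slope_def_field, stripProfile_top hh, sub_zero]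
  rw [div_neg, ← neg_div, neg_sub]

/-- The vertical difference quotients of the extension are Fourier series with multipliers `(1 -
stripProfile h k (-t))/t`. They are uniformly bounded by the barrier estimate and converge pointwise
to the normal derivative, so `multiplier_limit` applies. -/
theorem dn_energy (hh : 0 < h) {a : ℝ} (ha0 : 0 < a) (ha1 : a < 1) :
    ∃ C > 0, ∀ (c : ℕ → ℝ) (K : ℝ) (v : ℝ → ℝ), (Summable fun k => |c k|) →
      HolderFlat a K (cosSeries c) → HasDN h (cosSeries c) v →
      BddMeas v ∧ (∀ x, |v x| ≤ C * K) ∧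
      (∀ k : ℕ, perInt (fun x => v x * Real.cos (k * x)) = cosNorm k * (dnSymbol h k * c k)) ∧
      HasSum (fun k => cosNorm k * (dnSymbol h k * c k) ^ 2) (perInt fun x => v x ^ 2) := by
  obtain ⟨C, hC, hdec⟩ := exists_linear_decay hh ha0 ha1
  refine ⟨C, hC, fun c K v hc hf ⟨W, hW, hv⟩ => ?_⟩
  set t : ℕ → ℝ := fun n => h / ((n : ℝ) + 1) with ht
  have ht0 : ∀ n, 0 < t n := fun n => by positivity
  have hth : ∀ n, t n ≤ h := fun n => div_le_self hh.le (by linarith [n.cast_nonneg (α := ℝ)])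
  have hWt : ∀ x n, (cosSeries c x - W ⟨x, -t n⟩) / t n =
      ∑' k, ((1 - stripProfile h k (-t n)) / t n * c k) * Real.cos (k * x) := by
    intro x n
    have hz : (⟨x, -t n⟩ : ℂ) ∈ closedStrip h := ⟨by simpa using hth n, by simpa using (ht0 n).le⟩
    rw [hW.unique hh (isStripExtension_stripHol hh hc) _ hz]
    have h1 := hasSum_im_stripHol hh hc hz
    have h2 := (isOrthoFamily_cos.summable hc x).hasSum
    have h3 := (h2.sub h1).mul_right (t n)⁻¹
    rw [div_eq_mul_inv, ← cosSeries] at *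
    rw [← h3.tsum_eq]
    refine tsum_congr fun k => ?_
    simp only [div_eq_mul_inv]; ring
  have hb : ∀ n x, |∑' k, ((1 - stripProfile h k (-t n)) / t n * c k) * Real.cos (k * x)| ≤
      C * K := by
    intro n x
    rw [← hWt, abs_div, abs_of_pos (ht0 n), div_le_iff₀ (ht0 n)]
    exact hdec _ K W hf hW x (t n) ⟨(ht0 n).le, hth n⟩
  have hlim : ∀ x, Tendsto (fun n => ∑' k, ((1 - stripProfile h k (-t n)) / t n * c k) *
      Real.cos (k * x)) atTop (𝓝 (v x)) := by
    intro x
    have h1 := hasDerivWithinAt_iff_tendsto_slope.1 (hv x)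
    have h2 : Tendsto (fun n => -t n) atTop (𝓝[Iic 0 \ {0}] 0) := by
      refine tendsto_nhdsWithin_iff.2 ⟨?_, Eventually.of_forall fun n => ?_⟩
      · have := (tendsto_one_div_add_atTop_nhds_zero_nat (𝕜 := ℝ)).const_mul (-h)
        simpa [div_eq_mul_inv, ht] using this
      · exact ⟨by simpa using (ht0 n).le, by simpa using (ht0 n).ne'⟩
    refine (h1.comp h2).congr fun n => ?_
    rw [← hWt, Function.comp_apply, slope_def_field, hW.top, sub_zero, div_neg, ← neg_div, neg_sub]
  have hp : ∀ n k, |(1 - stripProfile h k (-t n)) / t n| ≤ |dnSymbol h k| := fun n k => by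
    have := stripProfile_quotient_mem hh k (ht0 n) (hth n)
    rw [abs_of_nonneg this.1, abs_of_pos (dnSymbol_pos hh k)]
    exact this.2
  have hpB : ∀ n, ∃ B, ∀ k, |(1 - stripProfile h k (-t n)) / t n| ≤ B := fun n =>
    ⟨1 / t n, fun k => by
      have := stripProfile_quotient_mem hh k (ht0 n) (hth n)
      rw [abs_of_nonneg this.1]
      have h4 := (stripProfile_mem_Icc hh k (y := -t n) ⟨by linarith [hth n], by linarith [ht0 n]⟩).1
      have := ht0 n
      gcongr
      linarith⟩
  obtain ⟨h1, h2, h3⟩ := isOrthoFamily_cos.multiplier_limit hc hp hpB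
    (fun k => tendsto_stripProfile_quotient hh k) hb hlim
  exact ⟨h1, fun x => le_of_tendsto (hlim x).abs (Eventually.of_forall fun n => hb n x), h2, h3⟩

/-- Symmetric difference quotients turn cosine series into sine series with multipliers `-sin
(kt)/t`, dominated by `k`. -/
theorem deriv_energy {a K : ℝ} {c : ℕ → ℝ} (hc : Summable fun k => |c k|)
    (hf : HolderFlat a K (cosSeries c)) :
    BddMeas (deriv (cosSeries c)) ∧
      HasSum (fun k : ℕ => Real.pi * (k * c k) ^ 2) (perInt fun x => deriv (cosSeries c) x ^ 2) := by
  set t : ℕ → ℝ := fun n => 1 / ((n : ℝ) + 1) with ht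
  have ht0 : ∀ n, 0 < t n := fun n => by positivity
  have hdq : ∀ x n, (cosSeries c (x + t n) - cosSeries c (x - t n)) / (2 * t n) =
      ∑' k : ℕ, (-(Real.sin (k * t n) / t n) * c k) * Real.sin (k * x) := by
    intro x n
    have h1 := (isOrthoFamily_cos.summable hc (x + t n)).hasSum
    have h2 := (isOrthoFamily_cos.summable hc (x - t n)).hasSum
    have h3 := (h1.sub h2).mul_right (2 * t n)⁻¹
    rw [div_eq_mul_inv, cosSeries, cosSeries, ← h3.tsum_eq]
    refine tsum_congr fun k => ?_
    rw [mul_add, mul_sub, Real.cos_add, Real.cos_sub]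
    have := (ht0 n).ne'
    field_simp
    ring
  have hb : ∀ n x, |∑' k : ℕ, (-(Real.sin (k * t n) / t n) * c k) * Real.sin (k * x)| ≤ K := by
    intro n x
    have := ht0 n
    rw [← hdq, abs_div, abs_of_pos (by positivity : 0 < 2 * t n), div_le_iff₀ (by positivity)]
    refine (abs_sub_le_of_abs_deriv_le hf.diff hf.deriv_bound _ _).trans (le_of_eq ?_)
    rw [add_sub_sub_cancel, abs_of_pos (by positivity)]; ring
  have htt : Tendsto t atTop (𝓝[≠] 0) := tendsto_nhdsWithin_iff.2
    ⟨tendsto_one_div_add_atTop_nhds_zero_nat, Eventually.of_forall fun n => (ht0 n).ne'⟩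
  have hlim : ∀ x, Tendsto (fun n => ∑' k : ℕ, (-(Real.sin (k * t n) / t n) * c k) *
      Real.sin (k * x)) atTop (𝓝 (deriv (cosSeries c) x)) := by
    intro x
    have h1 : HasDerivAt (fun s => (cosSeries c (x + s) - cosSeries c (x - s)) / 2)
        (deriv (cosSeries c) x) 0 := by
      have e1 := (hf.diff x).hasDerivAt
      have e2 : HasDerivAt (fun s => cosSeries c (x + s)) (deriv (cosSeries c) x) 0 :=
        HasDerivAt.comp_const_add x 0 (by simpa using e1)
      have e3 : HasDerivAt (fun s => cosSeries c (x - s)) (-deriv (cosSeries c) x) 0 :=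
        HasDerivAt.comp_const_sub x 0 (by simpa using e1)
      exact ((e2.fun_sub e3).div_const 2).congr_deriv (by ring)
    refine ((hasDerivAt_iff_tendsto_slope.1 h1).comp htt).congr fun n => ?_
    rw [← hdq, Function.comp_apply, slope_def_field]
    have := (ht0 n).ne'
    simp
    field_simp
  have hp : ∀ n (k : ℕ), |-(Real.sin (k * t n) / t n)| ≤ |-(k : ℝ)| := fun n k => by
    have := ht0 n
    rw [abs_neg, abs_neg, abs_div, abs_of_pos this, div_le_iff₀ this, Nat.abs_cast]
    refine (Real.abs_sin_le_abs (x := k * t n)).trans (le_of_eq ?_)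
    rw [abs_mul, Nat.abs_cast, abs_of_pos this]
  have hpB : ∀ n, ∃ B, ∀ k : ℕ, |-(Real.sin (k * t n) / t n)| ≤ B := fun n => ⟨1 / t n, fun k => by
    have := ht0 n
    rw [abs_neg, abs_div, abs_of_pos this]
    gcongr
    exact Real.abs_sin_le_one _⟩
  have hpl : ∀ k : ℕ, Tendsto (fun n => -(Real.sin (k * t n) / t n)) atTop (𝓝 (-(k : ℝ))) :=
    fun k => by
    have h1 : HasDerivAt (fun s : ℝ => -Real.sin (k * s)) (-(k : ℝ)) 0 := by
      have := (((hasDerivAt_id (0 : ℝ)).const_mul (k : ℝ)).sin).fun_neg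
      refine this.congr_deriv ?_
      simp
    refine ((hasDerivAt_iff_tendsto_slope.1 h1).comp htt).congr fun n => ?_
    rw [Function.comp_apply, slope_def_field]
    simp [neg_div]
  obtain ⟨h1, -, h3⟩ := isOrthoFamily_sin.multiplier_limit hc hp hpB hpl hb hlim
  refine ⟨h1, ?_⟩
  have e : (fun k : ℕ => Real.pi * (k * c k) ^ 2) =
      fun k => sinNorm k * (-(k : ℝ) * c k) ^ 2 := by
    ext k
    rcases eq_or_ne k 0 with rfl | hk
    · simp
    · simp [sinNorm, hk]
  rw [e]; exact h3

end DN

/-! ### Local uniqueness of solutions with prescribed first Fourier coefficient -/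

theorem HolderFlat.sub {a K K' : ℝ} {f g : ℝ → ℝ} (hf : HolderFlat a K f)
    (hg : HolderFlat a K' g) : HolderFlat a (K + K') fun x => f x - g x := by
  have hd : ∀ x, deriv (fun x => f x - g x) x = deriv f x - deriv g x := fun x =>
    deriv_fun_sub (hf.diff x) (hg.diff x)
  refine ⟨hf.diff.fun_sub hg.diff, fun x => ?_, fun x => ?_, fun x t => ?_⟩
  · exact (abs_sub _ _).trans (add_le_add (hf.bound x) (hg.bound x))
  · rw [hd]; exact (abs_sub _ _).trans (add_le_add (hf.deriv_bound x) (hg.deriv_bound x))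
  · rw [hd, add_mul]
    have e : f (x + t) - g (x + t) - (f x - g x) - (deriv f x - deriv g x) * t =
        (f (x + t) - f x - deriv f x * t) - (g (x + t) - g x - deriv g x * t) := by ring
    rw [e]
    exact (abs_sub _ _).trans (add_le_add (hf.taylor x t) (hg.taylor x t))

theorem HolderFlat.mono {a K K' : ℝ} {f : ℝ → ℝ} (hf : HolderFlat a K f) (h : K ≤ K') :
    HolderFlat a K' f :=
  ⟨hf.diff, fun x => (hf.bound x).trans h, fun x => (hf.deriv_bound x).trans h,
    fun x t => (hf.taylor x t).trans (by gcongr)⟩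

theorem HolderFlat.half_sq {a K : ℝ} (ha0 : 0 ≤ a) (ha1 : a ≤ 1) {f : ℝ → ℝ}
    (hf : HolderFlat a K f) : HolderFlat a (3 * K ^ 2) fun x => f x ^ 2 / 2 := by
  have hK := hf.nonneg
  have hd : ∀ x, deriv (fun x => f x ^ 2 / 2) x = f x * deriv f x := fun x => by
    have := ((hf.diff x).hasDerivAt.fun_pow 2).div_const 2
    rw [this.deriv]; simp; ring
  have hb2 : ∀ x, f x ^ 2 ≤ K ^ 2 := fun x => sq_le_sq' (by linarith [(abs_le.1 (hf.bound x)).1])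
    (abs_le.1 (hf.bound x)).2
  refine ⟨(hf.diff.fun_pow 2).div_const 2, fun x => ?_, fun x => ?_, fun x t => ?_⟩
  · rw [abs_of_nonneg (by positivity)]; nlinarith [hb2 x, sq_nonneg (f x)]
  · rw [hd, abs_mul]
    nlinarith [mul_le_mul (hf.bound x) (hf.deriv_bound x) (abs_nonneg _) hK, sq_nonneg K]
  · rw [hd]
    -- The first term contributes `K²` to the constant. The second contributes at most `2K²`, by the
    -- Lipschitz bound for `|t| ≤ 1` and the sup bound for `|t| ≥ 1`.
    have e : f (x + t) ^ 2 / 2 - f x ^ 2 / 2 - f x * deriv f x * t =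
        f x * (f (x + t) - f x - deriv f x * t) + (f (x + t) - f x) ^ 2 / 2 := by ring
    have h1 : |f x * (f (x + t) - f x - deriv f x * t)| ≤ K * (K * |t| ^ (1 + a)) := by
      rw [abs_mul]
      exact mul_le_mul (hf.bound x) (hf.taylor x t) (abs_nonneg _) hK
    have h2 : |(f (x + t) - f x) ^ 2 / 2| ≤ 2 * K ^ 2 * |t| ^ (1 + a) := by
      rw [abs_of_nonneg (by positivity), ← sq_abs]
      have h3 : |f (x + t) - f x| ≤ K * |t| := by
        simpa using abs_sub_le_of_abs_deriv_le hf.diff hf.deriv_bound (x + t) x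
      have h4 : |f (x + t) - f x| ≤ 2 * K :=
        (abs_sub _ _).trans (by linarith [hf.bound x, hf.bound (x + t)])
      rcases le_total |t| 1 with ht | ht
      · have h5 : |t| ^ 2 ≤ |t| ^ (1 + a) := by
          rw [← Real.rpow_natCast]
          rcases (abs_nonneg t).eq_or_lt with h0 | h0
          · rw [← h0, Real.zero_rpow (by norm_num), Real.zero_rpow (by linarith)]
          · exact Real.rpow_le_rpow_of_exponent_ge h0 ht (by push_cast; linarith)
        have h6 := pow_le_pow_left₀ (abs_nonneg _) h3 2
        rw [mul_pow] at h6
        have := mul_le_mul_of_nonneg_left h5 (sq_nonneg K)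
        have h7 : 0 ≤ K ^ 2 * |t| ^ (1 + a) := by positivity
        linarith
      · have h5 : 1 ≤ |t| ^ (1 + a) := Real.one_le_rpow ht (by linarith)
        have h6 := pow_le_pow_left₀ (abs_nonneg _) h4 2
        have := mul_le_mul_of_nonneg_left h5 (sq_nonneg K)
        nlinarith
    rw [e]
    refine (abs_add_le _ _).trans ((add_le_add h1 h2).trans (le_of_eq (by ring)))

/-- A general solution has only absolutely summable coefficients, hence the weight `1` in place of
`wbase`. -/
theorem exists_cosSeries_half_sq {c : ℕ → ℝ} (hc : Summable fun k => |c k|) :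
    ∃ e : ℕ → ℝ, (Summable fun k => |e k|) ∧ cosSeries e = fun x => cosSeries c x ^ 2 / 2 := by
  set b : L1 := (1 / 2 : ℝ) • cosMul isWeight_one (L1.mk c hc) (L1.mk c hc)
  refine ⟨cf b, summable_abs_cf b, funext fun x => ?_⟩
  have h1 := evalCos_eq_cosSeries isWeight_one x b
  have h2 := evalCos_eq_cosSeries isWeight_one x (L1.mk c hc)
  simp only [one_pow, mul_one, cf_mk] at h1 h2
  rw [← h1, ← h2, map_smul, evalCos_cosMul, smul_eq_mul]
  ring

theorem cosSeries_sub {c e : ℕ → ℝ} (hc : Summable fun k => |c k|) (he : Summable fun k => |e k|) :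
    cosSeries (fun k => c k - e k) = fun x => cosSeries c x - cosSeries e x := by
  ext x
  simp only [cosSeries, sub_mul]
  exact (isOrthoFamily_cos.summable hc x).tsum_sub (isOrthoFamily_cos.summable he x)

theorem HasDN.sub {h : ℝ} {f g u v : ℝ → ℝ} (hf : HasDN h f u) (hg : HasDN h g v) :
    HasDN h (fun x => f x - g x) fun x => u x - v x := by
  obtain ⟨F, hF, hu⟩ := hf
  obtain ⟨G, hG, hv⟩ := hg
  refine ⟨fun z => F z - G z, ⟨fun z hz => ?_, hF.continuousOn.sub hG.continuousOn, ?_,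
    fun x => by simp [hF.bottom, hG.bottom], fun x => by simp [hF.top, hG.top]⟩,
    fun x => (hu x).fun_sub (hv x)⟩
  · exact (hF.harmonic z hz).sub (hG.harmonic z hz)
  · obtain ⟨C, hC⟩ := hF.bounded
    obtain ⟨D, hD⟩ := hG.bounded
    exact ⟨C + D, fun z hz => (abs_sub _ _).trans (add_le_add (hC z hz) (hD z hz))⟩

theorem perInt_dn_sq_le {h : ℝ} (hh : 0 < h) {c : ℕ → ℝ} (hc : Summable fun k => |c k|) {I J : ℝ}
    (hI : HasSum (fun k => cosNorm k * (dnSymbol h k * c k) ^ 2) I)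
    (hJ : HasSum (fun k : ℕ => Real.pi * (k * c k) ^ 2) J) :
    I ≤ 2 * J + 2 / h ^ 2 * perInt fun x => cosSeries c x ^ 2 := by
  refine hasSum_le (fun k => ?_) hI
    ((hJ.mul_left 2).add ((isOrthoFamily_cos.parseval hc).mul_left (2 / h ^ 2)))
  have h1 := dnSymbol_le hh k
  have h2 := dnSymbol_pos hh k
  have h3 : dnSymbol h k ^ 2 ≤ 2 * k ^ 2 + 2 / h ^ 2 := by
    have h4 := pow_le_pow_left₀ h2.le h1 2
    have h5 : 2 / h ^ 2 = 2 * (1 / h) ^ 2 := by field_simp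
    rw [h5]
    nlinarith [sq_nonneg ((k : ℝ) - 1 / h)]
  have h4 := isOrthoFamily_cos.nu_nonneg k
  have h5 : cosNorm k * (k : ℝ) ^ 2 = Real.pi * k ^ 2 := by
    rcases eq_or_ne k 0 with rfl | hk
    · simp
    · simp [cosNorm, hk]
  calc cosNorm k * (dnSymbol h k * c k) ^ 2 = cosNorm k * c k ^ 2 * dnSymbol h k ^ 2 := by ring
    _ ≤ cosNorm k * c k ^ 2 * (2 * k ^ 2 + 2 / h ^ 2) := by gcongr
    _ = 2 * (cosNorm k * k ^ 2) * c k ^ 2 + 2 / h ^ 2 * (cosNorm k * c k ^ 2) := by ring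
    _ = _ := by rw [h5]; ring

theorem abs_mul_le_mul {a b A B : ℝ} (ha : |a| ≤ A) (hb : |b| ≤ B) : |a * b| ≤ A * B := by
  rw [abs_mul]
  exact mul_le_mul ha hb (abs_nonneg _) ((abs_nonneg _).trans ha)

theorem abs_add_le_add {a b A B : ℝ} (ha : |a| ≤ A) (hb : |b| ≤ B) : |a + b| ≤ A + B :=
  (abs_add_le _ _).trans (add_le_add ha hb)

theorem abs_sub_le_add {a b A B : ℝ} (ha : |a| ≤ A) (hb : |b| ≤ B) : |a - b| ≤ A + B :=
  (abs_sub _ _).trans (add_le_add ha hb)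

set_option maxHeartbeats 800000 in
/-- The linearization of the wave equation at `0`, evaluated on the difference of two solutions,
is of higher order. -/
theorem abs_linear_part_le {g γ l lam m μ f w f' w' F W F2 W2 L B σ : ℝ} (hL : 1 ≤ L) (hB0 : 0 ≤ B)
    (hB1 : B ≤ 1) (hσ : 0 ≤ σ) (hγ : |γ| ≤ L) (hg : |g| ≤ L) (hl : |l| ≤ L) (hlam : |lam| ≤ L)
    (hμ : |μ| ≤ B) (hf : |f| ≤ B) (hf' : |f'| ≤ B) (hF : |F| ≤ L * B) (hF2 : |F2| ≤ L * B)
    (hw : |w| ≤ B) (hw' : |w'| ≤ B) (hW : |W| ≤ L * B) (hW2 : |W2| ≤ L * B)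
    (kw : |w| ≤ L * σ) (kw' : |w'| ≤ L * σ) (kW : |W| ≤ L * σ) (kW2 : |W2| ≤ L * σ * B)
    (hfeq : (l + γ * (F2 - f - f * F)) ^ 2 = (l ^ 2 + m - 2 * g * f) * (f' ^ 2 + F ^ 2 + 2 * F + 1))
    (hweq : (lam + γ * (W2 - w - w * W)) ^ 2 =
      (lam ^ 2 + μ - 2 * g * w) * (w' ^ 2 + W ^ 2 + 2 * W + 1)) :
    |(m - μ) + (-2 * g + 2 * l * γ) * (f - w) + 2 * l ^ 2 * (F - W) +
      (l - lam) * (2 * γ * w + 2 * (l + lam) * W)| ≤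
    22 * L ^ 4 * (|F2 - W2| + B * (|f - w| + |f' - w'| + |F - W| + |m - μ| + |l - lam| * σ)) := by
  have hL0 : 0 ≤ L := by linarith
  have hLB : B ≤ L * B := le_mul_of_one_le_left hB0 hL
  have hBB : B * B ≤ B := mul_le_of_le_one_right hB0 hB1
  have p12 : L ≤ L ^ 2 := by nlinarith
  have p23 : L ^ 2 ≤ L ^ 3 := pow_le_pow_right₀ hL (by norm_num)
  have p34 : L ^ 3 ≤ L ^ 4 := pow_le_pow_right₀ hL (by norm_num)
  have h2 : |(2 : ℝ)| ≤ 2 := by norm_num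
  have h1 : |(1 : ℝ)| ≤ 1 := by norm_num
  have hN : ∀ {u U U2 : ℝ}, |u| ≤ B → |U| ≤ L * B → |U2| ≤ L * B → |U2 - u - u * U| ≤ 3 * (L * B) :=
    fun hu hU hU2 => (abs_sub_le_add (abs_sub_le_add hU2 hu) (abs_mul_le_mul hu hU)).trans
      (by nlinarith [mul_le_mul_of_nonneg_left hBB hL0])
  set S := (F2 - f - f * F) + (W2 - w - w * W) with hS
  have bS : |S| ≤ 6 * (L * B) :=
    (abs_add_le_add (hN hf hF hF2) (hN hw hW hW2)).trans (by linarith)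
  set P := f' ^ 2 + F ^ 2 + 2 * F with hP
  have bP : |P| ≤ 4 * (L ^ 2 * B) := by
    rw [hP, sq, sq]
    refine (abs_add_le_add (abs_add_le_add (abs_mul_le_mul hf' hf') (abs_mul_le_mul hF hF))
      (abs_mul_le_mul h2 hF)).trans ?_
    have e1 := mul_le_mul_of_nonneg_left hBB (sq_nonneg L)
    have e2 := mul_le_mul_of_nonneg_right p12 hB0
    have e3 := mul_nonneg (sq_nonneg L) hB0
    linarith
  set q := μ - 2 * g * w with hq
  have bq : |q| ≤ 3 * (L * B) :=
    (abs_sub_le_add hμ (abs_mul_le_mul (abs_mul_le_mul h2 hg) hw)).trans (by linarith)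
  have b2lγ : |2 * l * γ| ≤ 2 * L ^ 2 :=
    (abs_mul_le_mul (abs_mul_le_mul h2 hl) hγ).trans (le_of_eq (by ring))
  have bγ2 : |γ ^ 2| ≤ L ^ 2 := by rw [abs_pow]; exact pow_le_pow_left₀ (abs_nonneg _) hγ 2
  have bl2 : |l ^ 2| ≤ L ^ 2 := by rw [abs_pow]; exact pow_le_pow_left₀ (abs_nonneg _) hl 2
  have bγS : |γ ^ 2 * S| ≤ 6 * (L ^ 3 * B) := (abs_mul_le_mul bγ2 bS).trans (le_of_eq (by ring))
  have z1 : L ^ 3 * B ≤ L ^ 3 := mul_le_of_le_one_right (by positivity) hB1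
  have z2 : L ^ 2 * B ≤ L ^ 3 * B := mul_le_mul_of_nonneg_right p23 hB0
  have z3 : L ^ 3 * B ≤ L ^ 4 * B := mul_le_mul_of_nonneg_right p34 hB0
  have z4 : L ^ 4 * B * B ≤ L ^ 4 * B := mul_le_of_le_one_right (by positivity) hB1
  have z5 : L ^ 3 * B * B ≤ L ^ 3 * B := mul_le_of_le_one_right (by positivity) hB1
  have z6 : L ^ 2 * B * B ≤ L ^ 2 * B := mul_le_of_le_one_right (by positivity) hB1
  have z7 : L * B ≤ L ^ 2 * B := mul_le_mul_of_nonneg_right p12 hB0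
  have cU : |2 * l * γ + γ ^ 2 * S| ≤ 22 * L ^ 4 :=
    (abs_add_le_add b2lγ bγS).trans (by linarith [pow_nonneg hL0 4])
  have cd : |2 * g * P - (2 * l * γ * W + γ ^ 2 * S * (1 + W))| ≤ 22 * L ^ 4 * B := by
    refine (abs_sub_le_add (abs_mul_le_mul (abs_mul_le_mul h2 hg) bP) (abs_add_le_add
      (abs_mul_le_mul b2lγ hW) (abs_mul_le_mul bγS (abs_add_le_add h1 hW)))).trans
      ((le_of_eq (by ring : _ = 16 * (L ^ 3 * B) + 6 * (L ^ 4 * B * B))).trans (by linarith))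
  have cD : |-(2 * l * γ * f + γ ^ 2 * S * f + l ^ 2 * (F + W) + q * (F + W + 2))| ≤
      22 * L ^ 4 * B := by
    rw [abs_neg]
    refine (abs_add_le_add (abs_add_le_add (abs_add_le_add (abs_mul_le_mul b2lγ hf)
      (abs_mul_le_mul bγS hf)) (abs_mul_le_mul bl2 (abs_add_le_add hF hW)))
      (abs_mul_le_mul bq (abs_add_le_add (abs_add_le_add hF hW) h2))).trans
      ((le_of_eq (by ring : _ = 2 * (L ^ 2 * B) + 6 * (L ^ 3 * B * B) + 2 * (L ^ 3 * B) +
        6 * (L ^ 2 * B * B) + 6 * (L * B))).trans (by linarith))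
  have cd' : |-(l ^ 2 * (f' + w') + q * (f' + w'))| ≤ 22 * L ^ 4 * B := by
    rw [abs_neg]
    refine (abs_add_le_add (abs_mul_le_mul bl2 (abs_add_le_add hf' hw'))
      (abs_mul_le_mul bq (abs_add_le_add hf' hw'))).trans
      ((le_of_eq (by ring : _ = 2 * (L ^ 2 * B) + 6 * (L * (B * B)))).trans ?_)
    linarith [mul_le_mul_of_nonneg_left hBB hL0]
  have cm : |-P| ≤ 22 * L ^ 4 * B := by
    rw [abs_neg]
    exact bP.trans (by linarith)
  have cl : |2 * γ * (W2 - w * W) - (l + lam) * (w' ^ 2 + W ^ 2)| ≤ 22 * L ^ 4 * B * σ := by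
    rw [sq, sq]
    refine (abs_sub_le_add (abs_mul_le_mul (abs_mul_le_mul h2 hγ) (abs_sub_le_add kW2
      (abs_mul_le_mul kw hW))) (abs_mul_le_mul (abs_add_le_add hl hlam) (abs_add_le_add
      (abs_mul_le_mul kw' hw') (abs_mul_le_mul kW hW)))).trans
      ((le_of_eq (by ring : _ = 4 * (L ^ 2 * B * σ) + 4 * (L ^ 3 * B * σ))).trans ?_)
    have e1 := mul_le_mul_of_nonneg_right z2 hσ
    have e2 := mul_le_mul_of_nonneg_right z3 hσ
    have e3 : 0 ≤ L ^ 4 * B * σ := by positivity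
    linarith
  -- An exact identity: the difference of the two equations with its linear part isolated. Every
  -- remaining coefficient carries a factor `B`, except that of `F2 - W2`, which is itself a
  -- difference of quadratic terms. The coefficient of `l - lam` also carries the factor `σ`, since
  -- it involves only the second solution.
  have key : (m - μ) + (-2 * g + 2 * l * γ) * (f - w) + 2 * l ^ 2 * (F - W) +
      (l - lam) * (2 * γ * w + 2 * (l + lam) * W) =
      -(0 - (2 * l * γ + γ ^ 2 * S) * (F2 - W2)
      - (2 * g * P - (2 * l * γ * W + γ ^ 2 * S * (1 + W))) * (f - w)
      - (-(2 * l * γ * f + γ ^ 2 * S * f + l ^ 2 * (F + W) + q * (F + W + 2))) * (F - W)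
      - (-(l ^ 2 * (f' + w') + q * (f' + w'))) * (f' - w')
      - (-P) * (m - μ)
      - (2 * γ * (W2 - w * W) - (l + lam) * (w' ^ 2 + W ^ 2)) * (l - lam)) := by
    rw [hS, hP, hq]
    linear_combination hweq - hfeq
  rw [key, abs_neg]
  have t0 : |(0 : ℝ)| ≤ 0 := by simp
  refine (abs_sub_le_add (abs_sub_le_add (abs_sub_le_add (abs_sub_le_add (abs_sub_le_add
    (abs_sub_le_add t0 (abs_mul_le_mul cU le_rfl)) (abs_mul_le_mul cd le_rfl))
    (abs_mul_le_mul cD le_rfl)) (abs_mul_le_mul cd' le_rfl)) (abs_mul_le_mul cm le_rfl))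
    (abs_mul_le_mul cl le_rfl)).trans (le_of_eq (by ring))

/-- At `lamStar` both lower bounds hold with `2κ`, by transversality and `dnSymbol_linear_lower`.
Moving `l` and `lam` by `δ` changes the expressions by `O(δ)` and `O(δk)` respectively, which costs
at most half. -/
theorem exists_coercive {g γ h lamStar : ℝ} (hh : 0 < h) (hcr : IsCritical g γ h lamStar) :
    ∃ κ > 0, ∃ δ > 0, ∀ l lam : ℝ, |l - lamStar| < δ → |lam - lamStar| < δ →
      κ ≤ |2 * γ + 2 * (l + lam) * dnSymbol h 1| ∧
      ∀ k : ℕ, 2 ≤ k → κ * k ≤ |-2 * g + 2 * l * γ + 2 * l ^ 2 * dnSymbol h k| := by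
  have ht := tanh_pos' hh
  set τ := lamStar ^ 2 * Real.tanh h
  have hτ : 0 < τ := mul_pos (pow_pos (abs_pos.2 hcr.ne_zero) 2 |>.trans_eq (sq_abs _)) ht
  set κ := min |2 * (γ + 2 * lamStar * dnSymbol h 1)| τ / 2 with hκ
  have hκ1 : 2 * κ ≤ |2 * (γ + 2 * lamStar * dnSymbol h 1)| := by
    have := min_le_left |2 * (γ + 2 * lamStar * dnSymbol h 1)| τ
    rw [hκ]; linarith
  have hκ2 : 2 * κ ≤ τ := by
    have := min_le_right |2 * (γ + 2 * lamStar * dnSymbol h 1)| τ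
    rw [hκ]; linarith
  have hκ0 : 0 < κ :=
    half_pos (lt_min (abs_pos.2 (mul_ne_zero two_ne_zero hcr.transversal)) hτ)
  have hg1 := dnSymbol_pos hh 1
  set N := 2 * |γ| + 2 * (2 * |lamStar| + 1) * (1 + 1 / h) with hN
  have hN0 : 0 ≤ N := by positivity
  set D := 4 * dnSymbol h 1 + N with hD
  have hD0 : 0 < D := by positivity
  have hδD : min 1 (κ / D) * D ≤ κ := by
    have := mul_le_mul_of_nonneg_right (min_le_right 1 (κ / D)) hD0.le
    rwa [div_mul_cancel₀ _ hD0.ne'] at this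
  set δ := min 1 (κ / D) with hδ
  have hδ0 : 0 < δ := lt_min one_pos (by positivity)
  have hδ1 : δ ≤ 1 := min_le_left _ _
  have hsub : ∀ {a b e E : ℝ}, 2 * E ≤ |a| → |b - a| ≤ e → e ≤ E → E ≤ |b| := by
    intro a b e E h1 h2 h3
    have := abs_sub_abs_le_abs_sub a b
    rw [abs_sub_comm] at this
    linarith
  refine ⟨κ, hκ0, δ, hδ0, fun l lam hl hlam => ⟨?_, fun k hk => ?_⟩⟩
  · refine hsub hκ1 (e := δ * (4 * dnSymbol h 1)) ?_ ?_
    · have e : 2 * γ + 2 * (l + lam) * dnSymbol h 1 - 2 * (γ + 2 * lamStar * dnSymbol h 1) =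
          ((l - lamStar) + (lam - lamStar)) * (2 * dnSymbol h 1) := by ring
      rw [e]
      refine (abs_mul_le_mul (abs_add_le_add hl.le hlam.le)
        (abs_of_pos (by positivity)).le).trans (le_of_eq (by ring))
    · rw [hD, mul_add] at hδD
      linarith [mul_nonneg hδ0.le hN0]
  · have hk1 : (1 : ℝ) ≤ k := by exact_mod_cast (by omega : 1 ≤ k)
    refine hsub (a := -2 * g + 2 * lamStar * γ + 2 * lamStar ^ 2 * dnSymbol h k)
      (e := δ * (N * k)) ?_ ?_ ?_
    · have h1 := dnSymbol_linear_lower hh hcr hk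
      have h2 := mul_le_mul_of_nonneg_right hκ2 (by linarith : (0 : ℝ) ≤ k)
      refine le_trans ?_ (le_abs_self _)
      linarith
    · have e : -2 * g + 2 * l * γ + 2 * l ^ 2 * dnSymbol h k -
          (-2 * g + 2 * lamStar * γ + 2 * lamStar ^ 2 * dnSymbol h k) =
          (l - lamStar) * (2 * γ + 2 * ((l - lamStar) + 2 * lamStar) * dnSymbol h k) := by ring
      rw [e]
      refine abs_mul_le_mul hl.le ?_
      have h2 : |(2 : ℝ)| ≤ 2 := by norm_num
      have h3 : |dnSymbol h k| ≤ (1 + 1 / h) * k := by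
        rw [abs_of_pos (dnSymbol_pos hh k)]
        refine (dnSymbol_le hh k).trans ?_
        have : 1 / h ≤ 1 / h * k := le_mul_of_one_le_right (by positivity) hk1
        linarith
      refine (abs_add_le_add (abs_mul_le_mul h2 le_rfl) (abs_mul_le_mul (abs_mul_le_mul h2
        (abs_add_le_add (hl.le.trans hδ1) (abs_mul_le_mul h2 le_rfl))) h3)).trans ?_
      have h4 : 2 * |γ| ≤ 2 * |γ| * k := le_mul_of_one_le_right (by positivity) hk1
      rw [hN]
      linarith
    · have h1 : δ * N ≤ κ := by
        rw [hD, mul_add] at hδD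
        linarith [mul_pos hδ0 hg1]
      have := mul_le_mul_of_nonneg_right h1 (by linarith : (0 : ℝ) ≤ k)
      linarith

/-- Here `d` is the difference of the coefficients, `q` those of the second solution, `θ` the
difference of the `μ` and `τ` that of the `λ`. As `d` vanishes at modes `0` and `1`, mode `0`
isolates `θ` and mode `1` isolates `τ q 1`. The modes `k ≥ 2` control `d` up to the coupling `τ b
q`, which is moved to the right. -/
theorem coercive_estimates {h κ θ τ N J Y : ℝ} (hκ : 0 < κ) {R : ℝ → ℝ}
    (hR : BddMeas R) {d q A b : ℕ → ℝ}
    (hcoef : ∀ k : ℕ, perInt (fun x => R x * Real.cos (k * x)) =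
      cosNorm k * ((if k = 0 then θ else 0) + A k * d k + τ * (b k * q k)))
    (hd0 : d 0 = 0) (hd1 : d 1 = 0) (hq0 : q 0 = 0) (hb1 : κ ≤ |b 1|)
    (hA : ∀ k : ℕ, 2 ≤ k → κ * k ≤ |A k|) (hb : ∀ k : ℕ, 1 ≤ k → |b k| ≤ N * dnSymbol h k)
    (hJ : HasSum (fun k : ℕ => Real.pi * (k * d k) ^ 2) J)
    (hY : HasSum (fun k => cosNorm k * (dnSymbol h k * q k) ^ 2) Y) :
    θ ^ 2 ≤ perInt (fun x => R x ^ 2) ∧ (κ * (τ * q 1)) ^ 2 ≤ perInt (fun x => R x ^ 2) ∧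
      κ ^ 2 * J ≤ 2 * perInt (fun x => R x ^ 2) + 2 * (N * τ) ^ 2 * Y := by
  have hbes := fun s : Finset ℕ => isOrthoFamily_cos.bessel hR s fun k _ => hcoef k
  have hpi := Real.pi_gt_three
  refine ⟨?_, ?_, ?_⟩
  · have := hbes {0}
    simp only [Finset.sum_singleton, if_true, hd0, hq0, cosNorm, mul_zero, add_zero] at this
    nlinarith [sq_nonneg θ]
  · have := hbes {1}
    simp only [Finset.sum_singleton, one_ne_zero, if_false, hd1, cosNorm, mul_zero, zero_add]
      at this
    have h1 : (κ * (τ * q 1)) ^ 2 ≤ (τ * (b 1 * q 1)) ^ 2 := by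
      have h2 : κ ^ 2 ≤ b 1 ^ 2 := by
        rw [← sq_abs (b 1)]; exact pow_le_pow_left₀ hκ.le hb1 2
      have := mul_le_mul_of_nonneg_right h2 (sq_nonneg (τ * q 1))
      nlinarith
    nlinarith [sq_nonneg (τ * (b 1 * q 1))]
  · rw [← (hJ.mul_left (κ ^ 2)).tsum_eq]
    refine (hJ.mul_left (κ ^ 2)).summable.tsum_le_of_sum_le fun s => ?_
    have hYs : ∑ k ∈ s, cosNorm k * (dnSymbol h k * q k) ^ 2 ≤ Y :=
      sum_le_hasSum s (fun k _ => mul_nonneg (isOrthoFamily_cos.nu_nonneg k) (sq_nonneg _)) hY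
    refine le_trans ?_ (add_le_add (mul_le_mul_of_nonneg_left (hbes s) zero_le_two)
      (mul_le_mul_of_nonneg_left hYs (by positivity)))
    rw [Finset.mul_sum, Finset.mul_sum, ← Finset.sum_add_distrib]
    refine Finset.sum_le_sum fun k _ => ?_
    have hν := isOrthoFamily_cos.nu_nonneg k
    rcases lt_or_ge k 2 with hk | hk
    · have h0 : (k : ℝ) * d k = 0 := by interval_cases k <;> simp [hd0, hd1]
      rw [h0]
      simp only [ne_eq, OfNat.ofNat_ne_zero, not_false_eq_true, zero_pow, mul_zero]
      positivity
    · have hk0 : k ≠ 0 := by omega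
      have e : cosNorm k = Real.pi := by simp [cosNorm, hk0]
      rw [e, if_neg hk0, zero_add]
      have h1 : (κ * (k * d k)) ^ 2 ≤ (A k * d k) ^ 2 := by
        have h2 : (κ * k) ^ 2 ≤ A k ^ 2 := by
          rw [← sq_abs (A k)]; exact pow_le_pow_left₀ (by positivity) (hA k hk) 2
        have := mul_le_mul_of_nonneg_right h2 (sq_nonneg (d k))
        nlinarith
      have h3 : (τ * (b k * q k)) ^ 2 ≤ (N * τ) ^ 2 * (dnSymbol h k * q k) ^ 2 := by
        have h4 : b k ^ 2 ≤ (N * dnSymbol h k) ^ 2 := by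
          rw [← sq_abs (b k)]; exact pow_le_pow_left₀ (abs_nonneg _) (hb k (by omega)) 2
        have := mul_le_mul_of_nonneg_right h4 (sq_nonneg (τ * q k))
        nlinarith
      have h5 : (A k * d k) ^ 2 ≤ 2 * (A k * d k + τ * (b k * q k)) ^ 2 +
          2 * (τ * (b k * q k)) ^ 2 := by
        nlinarith [sq_nonneg (A k * d k + 2 * (τ * (b k * q k)))]
      have h6 : (κ * (k * d k)) ^ 2 ≤ 2 * (A k * d k + τ * (b k * q k)) ^ 2 +
          2 * ((N * τ) ^ 2 * (dnSymbol h k * q k) ^ 2) := by linarith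
      have h7 := mul_le_mul_of_nonneg_left h6 Real.pi_pos.le
      linarith [h7, mul_pow κ ((k : ℝ) * d k) 2]

theorem perInt_const (c : ℝ) : perInt (fun _ => c) = 2 * Real.pi * c := by
  rw [perInt, intervalIntegral.integral_const, smul_eq_mul]; ring

/-- Upper bound for the square integral of a function dominated by small multiples. -/
theorem perInt_sq_le {M B θ₁ θ₂ : ℝ} {R U d d' D : ℝ → ℝ} (hR : BddMeas R) (hU : BddMeas U)
    (hd : BddMeas d) (hd' : BddMeas d') (hD : BddMeas D)
    (hle : ∀ x, |R x| ≤ M * (|U x| + B * (|d x| + |d' x| + |D x| + θ₁ + θ₂))) :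
    perInt (fun x => R x ^ 2) ≤ 2 * M ^ 2 * (perInt (fun x => U x ^ 2) +
      5 * B ^ 2 * (perInt (fun x => d x ^ 2) + perInt (fun x => d' x ^ 2) +
        perInt (fun x => D x ^ 2) + 2 * Real.pi * (θ₁ ^ 2 + θ₂ ^ 2))) := by
  have b1 := (((hd.pow 2).add (hd'.pow 2)).add (hD.pow 2)).add (BddMeas.const (θ₁ ^ 2 + θ₂ ^ 2))
  have b2 := (hU.pow 2).add (b1.const_mul (5 * B ^ 2))
  have h1 := perInt_mono (hR.pow 2) (b2.const_mul (2 * M ^ 2)) fun x => by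
    have h2 := pow_le_pow_left₀ (abs_nonneg _) (hle x) 2
    rw [sq_abs, mul_pow] at h2
    refine h2.trans ?_
    rw [mul_comm 2, mul_assoc]
    refine mul_le_mul_of_nonneg_left ?_ (sq_nonneg M)
    have h3 : (|U x| + B * (|d x| + |d' x| + |D x| + θ₁ + θ₂)) ^ 2 ≤ 2 * (|U x| ^ 2 +
        B ^ 2 * (|d x| + |d' x| + |D x| + θ₁ + θ₂) ^ 2) := by
      nlinarith [sq_nonneg (|U x| - B * (|d x| + |d' x| + |D x| + θ₁ + θ₂))]
    refine h3.trans (mul_le_mul_of_nonneg_left ?_ zero_le_two)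
    have h4 : ∀ a b c d e : ℝ, (a + b + c + d + e) ^ 2 ≤
        5 * (a ^ 2 + b ^ 2 + c ^ 2 + (d ^ 2 + e ^ 2)) := fun a b c d e => by
      nlinarith [sq_nonneg (a - b), sq_nonneg (a - c), sq_nonneg (a - d), sq_nonneg (a - e),
        sq_nonneg (b - c), sq_nonneg (b - d), sq_nonneg (b - e), sq_nonneg (c - d),
        sq_nonneg (c - e), sq_nonneg (d - e)]
    have h5 := mul_le_mul_of_nonneg_left (h4 |d x| |d' x| |D x| θ₁ θ₂) (sq_nonneg B)
    simp only [sq_abs] at h5 ⊢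
    linarith
  rwa [perInt_const_mul, perInt_add (hU.pow 2) (b1.const_mul _), perInt_const_mul,
    perInt_add (((hd.pow 2).add (hd'.pow 2)).add (hD.pow 2)) (BddMeas.const _),
    perInt_add ((hd.pow 2).add (hd'.pow 2)) (hD.pow 2), perInt_add (hd.pow 2) (hd'.pow 2),
    perInt_const] at h1

theorem HolderFlat.bddMeas {a K : ℝ} {f : ℝ → ℝ} (hf : HolderFlat a K f) : BddMeas f :=
  ⟨hf.diff.continuous.measurable, K, hf.bound⟩

/-- If the higher-order part is bounded by a small multiple of the whole, everything vanishes. -/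
theorem eq_zero_of_absorb {h M B K₁ K₂ c c' Q U E E' I J D S T : ℝ} (hQ : Q ≤ 2 * M ^ 2 * (U +
      5 * B ^ 2 * (I + J + D + 2 * Real.pi * (S + T)))) (hU : U ≤ 2 * E' + 2 / h ^ 2 * E)
    (hE : E ≤ B ^ 2 * I) (hE' : E' ≤ 2 * B ^ 2 * (J + I)) (hD : D ≤ 2 * J + 2 / h ^ 2 * I)
    (hIJ : I ≤ J) (hJ0 : 0 ≤ J) (hS0 : 0 ≤ S) (hT0 : 0 ≤ T) (hJ : J ≤ c * Q) (hS : S ≤ Q)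
    (hT : T ≤ c' * Q) (hK₁ : K₁ = 2 * M ^ 2 * ((8 + 2 / h ^ 2) + 5 * (4 + 2 / h ^ 2 + 2 * Real.pi)))
    (hK₂ : K₂ = c + 1 + c') (hK₂0 : 0 < K₂) (hBK : B ^ 2 * (K₁ * K₂) ≤ 1 / 2) :
    J = 0 ∧ S = 0 ∧ T = 0 := by
  have hpi := Real.pi_pos
  have hh2 : 0 ≤ 2 / h ^ 2 := by positivity
  have hB2 : 0 ≤ B ^ 2 := sq_nonneg B
  obtain ⟨V, hV⟩ : ∃ x, x = J + S + T := ⟨_, rfl⟩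
  have hV1 : V ≤ K₂ * Q := by rw [hV, hK₂]; linarith
  have hQV : Q ≤ B ^ 2 * K₁ * V := by
    have u3 : U ≤ B ^ 2 * ((8 + 2 / h ^ 2) * J) := by
      have i1 := mul_le_mul_of_nonneg_left hIJ hB2
      have i2 := mul_le_mul_of_nonneg_left (hE.trans i1) hh2
      linarith
    have u4 : D ≤ (2 + 2 / h ^ 2) * J := by
      have i2 := mul_le_mul_of_nonneg_left hIJ hh2
      linarith
    have hJV : J ≤ V := by linarith
    have hSV : S + T ≤ V := by linarith
    have v1 : U ≤ B ^ 2 * ((8 + 2 / h ^ 2) * V) := u3.trans (by gcongr)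
    have v2 : I + J + D + 2 * Real.pi * (S + T) ≤ (4 + 2 / h ^ 2 + 2 * Real.pi) * V := by
      have i1 := mul_le_mul_of_nonneg_left hJV hh2
      have i2 := mul_le_mul_of_nonneg_left hSV (by positivity : 0 ≤ 2 * Real.pi)
      linarith
    have v3 := mul_le_mul_of_nonneg_left v2 (by positivity : 0 ≤ 5 * B ^ 2)
    refine hQ.trans ((mul_le_mul_of_nonneg_left (add_le_add v1 v3)
      (by positivity)).trans (le_of_eq ?_))
    rw [hK₁]; ring
  have hV0 : 0 ≤ V := by rw [hV]; positivity
  have hVz : V ≤ 0 := by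
    have i1 := mul_le_mul_of_nonneg_left hQV hK₂0.le
    have i2 := mul_le_mul_of_nonneg_right hBK hV0
    linarith
  exact ⟨by linarith, by linarith, by linarith⟩

/-- Square integrals of a difference of squares and of its derivative. -/
theorem perInt_half_sq_sub_le {B : ℝ} {f w f' w' : ℝ → ℝ} (hf : BddMeas f) (hw : BddMeas w)
    (hf' : BddMeas f') (hw' : BddMeas w') (bf : ∀ x, |f x| ≤ B) (bw : ∀ x, |w x| ≤ B)
    (bf' : ∀ x, |f' x| ≤ B) (bw' : ∀ x, |w' x| ≤ B) :
    perInt (fun x => (f x ^ 2 / 2 - w x ^ 2 / 2) ^ 2) ≤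
        B ^ 2 * perInt (fun x => (f x - w x) ^ 2) ∧
      perInt (fun x => ((f x + w x) / 2 * (f' x - w' x) +
        (f' x + w' x) / 2 * (f x - w x)) ^ 2) ≤ 2 * B ^ 2 *
          (perInt (fun x => (f' x - w' x) ^ 2) + perInt fun x => (f x - w x) ^ 2) := by
  have key : ∀ {a b : ℝ}, |a| ≤ B → |b| ≤ B → ((a + b) / 2) ^ 2 ≤ B ^ 2 := fun ha hb => by
    have := abs_add_le_add ha hb
    refine sq_le_sq' ?_ ?_ <;> linarith [abs_le.1 this]
  have md := hf.sub hw
  have md' := hf'.sub hw'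
  have ms : BddMeas fun x => (f x + w x) / 2 := by
    simpa [div_eq_inv_mul] using (hf.add hw).const_mul (2⁻¹)
  have ms' : BddMeas fun x => (f' x + w' x) / 2 := by
    simpa [div_eq_inv_mul] using (hf'.add hw').const_mul (2⁻¹)
  constructor
  · rw [← perInt_const_mul]
    have e : (fun x => (f x ^ 2 / 2 - w x ^ 2 / 2) ^ 2) =
        fun x => ((f x + w x) / 2 * (f x - w x)) ^ 2 := by ext x; ring
    rw [e]
    refine perInt_mono ((ms.mul md).pow 2) ((md.pow 2).const_mul _) fun x => ?_
    rw [mul_pow]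
    exact mul_le_mul_of_nonneg_right (key (bf x) (bw x)) (sq_nonneg _)
  · rw [← perInt_add (md'.pow 2) (md.pow 2), ← perInt_const_mul]
    refine perInt_mono (((ms.mul md').add (ms'.mul md)).pow 2)
      (((md'.pow 2).add (md.pow 2)).const_mul _) fun x => ?_
    have k3 := mul_le_mul_of_nonneg_right (key (bf x) (bw x)) (sq_nonneg (f' x - w' x))
    have k4 := mul_le_mul_of_nonneg_right (key (bf' x) (bw' x)) (sq_nonneg (f x - w x))
    nlinarith [sq_nonneg ((f x + w x) / 2 * (f' x - w' x) - (f' x + w' x) / 2 * (f x - w x))]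

set_option maxHeartbeats 800000 in
/-- Two small solutions with the same first Fourier coefficient `s`, one of which has size `O(s)`,
agree. -/
theorem exists_rigidity {g γ h lamStar a : ℝ} (hh : 0 < h) (hcr : IsCritical g γ h lamStar)
    (ha0 : 0 < a) (ha1 : a < 1) {A : ℝ} (hA : 0 < A) :
    ∃ δ > 0, ∀ (l m lam μ s : ℝ) (p q : ℕ → ℝ), (Summable fun k => |p k|) →
      (Summable fun k => |q k|) → p 0 = 0 → q 0 = 0 → p 1 = s → q 1 = s →
      |l - lamStar| < δ → |lam - lamStar| < δ → |μ| < δ → |s| < δ →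
      HolderFlat a δ (cosSeries p) → HolderFlat a (A * |s|) (cosSeries q) →
      SolvesEq g γ h l m (cosSeries p) → SolvesEq g γ h lam μ (cosSeries q) →
      p = q ∧ m = μ ∧ (s ≠ 0 → l = lam) := by
  obtain ⟨κ, hκ, δ₀, hδ₀, hco⟩ := exists_coercive hh hcr
  obtain ⟨C, hC, hen⟩ := dn_energy hh ha0 ha1
  -- `L` dominates all parameters and all size constants in `abs_linear_part_le`; the factor `3`
  -- accompanying `C` is the one from `HolderFlat.half_sq`.
  obtain ⟨L, hL⟩ : ∃ x, x = 2 + |lamStar| + |γ| + |g| + 3 * C + A + 3 * C * A := ⟨_, rfl⟩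
  have hCA : 0 < C * A := mul_pos hC hA
  have hlS := abs_nonneg lamStar
  have hγ0 := abs_nonneg γ
  have hg0 := abs_nonneg g
  have hL1 : 1 ≤ L := by linarith
  have hL0 : 0 < L := by linarith
  have hpi := Real.pi_pos
  obtain ⟨M, hM⟩ : ∃ x, x = 22 * L ^ 4 := ⟨_, rfl⟩
  obtain ⟨K₁, hK₁⟩ : ∃ x, x = 2 * M ^ 2 * ((8 + 2 / h ^ 2) + 5 * (4 + 2 / h ^ 2 + 2 * Real.pi)) := ⟨_, rfl⟩
  obtain ⟨K₂, hK₂⟩ : ∃ x, x = (2 + 2 * (6 * L) ^ 2 * (2 * Real.pi * L ^ 2) / κ ^ 2) / κ ^ 2 + 1 + 1 / κ ^ 2 := ⟨_, rfl⟩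
  have hM0 : 0 < M := by rw [hM]; positivity
  have hK₁0 : 0 < K₁ := by rw [hK₁]; positivity
  have hK₂0 : 0 < K₂ := by rw [hK₂]; positivity
  -- With `V` the total squared size of the differences and `Q` the square integral of the
  -- remainder, the pointwise bound gives `Q ≤ B² K₁ V` and coercivity gives `V ≤ K₂ Q`. This `B`
  -- makes the product of the constants at most `1/2`.
  obtain ⟨B, hB⟩ : ∃ x, x = 1 / (1 + 2 * (K₁ * K₂)) := ⟨_, rfl⟩
  have hB0 : 0 < B := by rw [hB]; positivity
  have hB1 : B ≤ 1 := by
    rw [hB, div_le_one (by positivity)]; linarith [mul_pos hK₁0 hK₂0]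
  have hBK : B ^ 2 * (K₁ * K₂) ≤ 1 / 2 := by
    have h1 : B * (1 + 2 * (K₁ * K₂)) = 1 := by
      rw [hB]; exact one_div_mul_cancel (by positivity)
    have h2 := mul_pos hB0 (mul_pos hK₁0 hK₂0)
    have h3 := mul_le_of_le_one_left h2.le hB1
    linarith
  -- The last entry gives both `δ ≤ B` and `A|s| ≤ B`, so both solutions have size at most `B`.
  obtain ⟨δ, hδ⟩ : ∃ x, x = min (min 1 δ₀) (B / (1 + A)) := ⟨_, rfl⟩
  have hδ0 : 0 < δ := by rw [hδ]; exact lt_min (lt_min one_pos hδ₀) (by positivity)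
  have hδ1 : δ ≤ 1 := hδ.le.trans <| (min_le_left _ _).trans (min_le_left _ _)
  have hδδ : δ ≤ δ₀ := hδ.le.trans <| (min_le_left _ _).trans (min_le_right _ _)
  have hδB : δ * (1 + A) ≤ B := (le_div_iff₀ (by linarith)).1 (hδ.le.trans (min_le_right _ _))
  have hδA : 0 < δ * A := mul_pos hδ0 hA
  refine ⟨δ, hδ0, fun l m lam μ s p q hp hq hp0 hq0 hp1 hq1 hl hlam hμ hs hf hw hfs hws => ?_⟩
  set f := cosSeries p with hfdef
  set w := cosSeries q with hwdef
  obtain ⟨σ, hσ⟩ : ∃ x, x = |s| := ⟨_, rfl⟩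
  have hσ0 : 0 ≤ σ := hσ ▸ abs_nonneg s
  rw [← hσ] at hs hw
  have hAσ : A * σ ≤ B := by
    have := mul_le_mul_of_nonneg_left hs.le hA.le
    linarith
  obtain ⟨F, F₂, hF, hF₂, hfeq⟩ := hfs
  obtain ⟨W, W₂, hW, hW₂, hweq⟩ := hws
  have hfB : HolderFlat a B f := hf.mono (by linarith)
  have hwB : HolderFlat a B w := hw.mono hAσ
  -- the difference
  have hd : (Summable fun k => |p k - q k|) :=
    (hp.add hq).of_nonneg_of_le (fun k => abs_nonneg _) fun k => abs_sub _ _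
  have hdS := cosSeries_sub hp hq
  have hdflat : HolderFlat a (B + B) (cosSeries fun k => p k - q k) := by
    rw [hdS]; exact hfB.sub hwB
  have hDN : HasDN h (cosSeries fun k => p k - q k) fun x => F x - W x := by
    rw [hdS]; exact hF.sub hW
  have hdd : ∀ x, deriv (cosSeries fun k => p k - q k) x = deriv f x - deriv w x := fun x => by
    rw [hdS]; exact deriv_fun_sub (hf.diff x) (hw.diff x)
  -- the difference of the squares
  obtain ⟨p₂, hp₂, hp₂e⟩ := exists_cosSeries_half_sq hp
  obtain ⟨q₂, hq₂, hq₂e⟩ := exists_cosSeries_half_sq hq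
  have he : (Summable fun k => |p₂ k - q₂ k|) :=
    (hp₂.add hq₂).of_nonneg_of_le (fun k => abs_nonneg _) fun k => abs_sub _ _
  have heS := cosSeries_sub hp₂ hq₂
  rw [hp₂e, hq₂e] at heS
  have hf2 := hfB.half_sq ha0.le ha1.le
  have hw2 := hw.half_sq ha0.le ha1.le
  have heflat : HolderFlat a (3 * B ^ 2 + 3 * (A * σ) ^ 2) (cosSeries fun k => p₂ k - q₂ k) := by
    rw [heS]; exact hf2.sub hw2
  have heDN : HasDN h (cosSeries fun k => p₂ k - q₂ k) fun x => F₂ x - W₂ x := by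
    rw [heS]; exact hF₂.sub hW₂
  have hed : ∀ x, deriv (cosSeries fun k => p₂ k - q₂ k) x =
      (f x + w x) / 2 * (deriv f x - deriv w x) + (deriv f x + deriv w x) / 2 * (f x - w x) := by
    intro x
    rw [heS]
    have h1 := (((hf.diff x).hasDerivAt.fun_pow 2).div_const 2).fun_sub
      (((hw.diff x).hasDerivAt.fun_pow 2).div_const 2)
    rw [h1.deriv]
    push_cast
    ring
  -- energy identities
  obtain ⟨mF, bF, cF, -⟩ := hen p B F hp hfB hF
  obtain ⟨mW, bW, cW, sW⟩ := hen q (A * σ) W hq hw hW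
  obtain ⟨mD, -, cD, sD⟩ := hen _ _ _ hd hdflat hDN
  obtain ⟨mU, -, -, sU⟩ := hen _ _ _ he heflat heDN
  obtain ⟨-, bF₂, -, -⟩ := hen p₂ _ F₂ hp₂ (by rw [hp₂e]; exact hf2) (by rw [hp₂e]; exact hF₂)
  obtain ⟨-, bW₂, -, -⟩ := hen q₂ _ W₂ hq₂ (by rw [hq₂e]; exact hw2) (by rw [hq₂e]; exact hW₂)
  obtain ⟨md', sd'⟩ := deriv_energy hd hdflat
  obtain ⟨me', se'⟩ := deriv_energy he heflat
  have hWle := perInt_dn_sq_le hh hd sD sd'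
  have hUle := perInt_dn_sq_le hh he sU se'
  have sd : HasSum (fun k => cosNorm k * (p k - q k) ^ 2)
      (perInt fun x => cosSeries (fun k => p k - q k) x ^ 2) := isOrthoFamily_cos.parseval hd
  have cd : ∀ k : ℕ, perInt (fun x => cosSeries (fun k => p k - q k) x * Real.cos (k * x)) =
      cosNorm k * (p k - q k) := isOrthoFamily_cos.perInt_tsum_mul hd
  have cw : ∀ k : ℕ, perInt (fun x => w x * Real.cos (k * x)) = cosNorm k * q k :=
    isOrthoFamily_cos.perInt_tsum_mul hq
  have md := hdflat.bddMeas
  simp only [hdd] at sd' hWle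
  simp only [hed] at hUle
  simp only [hdS] at hWle sd cd md
  simp only [heS] at hUle
  rw [funext hdd] at md'
  have mw := hwB.bddMeas
  obtain ⟨I, hI⟩ : ∃ x, x = perInt fun x => (f x - w x) ^ 2 := ⟨_, rfl⟩
  obtain ⟨J, hJ⟩ : ∃ x, x = perInt fun x => (deriv f x - deriv w x) ^ 2 := ⟨_, rfl⟩
  rw [← hI] at sd hWle
  rw [← hJ] at sd' hWle
  have hJ0 : 0 ≤ J := by rw [hJ]; exact perInt_nonneg fun x => sq_nonneg _
  -- Poincaré's inequality, from the vanishing mean of the difference.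
  have hIJ : I ≤ J := by
    refine hasSum_le (fun k => ?_) sd sd'
    rcases eq_or_ne k 0 with rfl | hk
    · simp [hp0, hq0]
    · have hk1 : (1 : ℝ) ≤ k := by exact_mod_cast Nat.one_le_iff_ne_zero.2 hk
      rw [cosNorm, if_neg hk, mul_pow]
      refine mul_le_mul_of_nonneg_left ?_ hpi.le
      exact le_mul_of_one_le_left (sq_nonneg _) (one_le_pow₀ hk1)
  -- pointwise bounds
  have hlL : |l| ≤ L := by
    have := abs_sub_abs_le_abs_sub l lamStar
    linarith
  have hlamL : |lam| ≤ L := by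
    have := abs_sub_abs_le_abs_sub lam lamStar
    linarith
  have hδB' : δ ≤ B := by linarith
  have hCL : 3 * C ≤ L := by linarith
  have hAL : A ≤ L := by linarith
  have hCAL : 3 * C * A ≤ L := by linarith
  have hAσ0 : 0 ≤ A * σ := mul_nonneg hA.le hσ0
  have hBB : B ^ 2 ≤ B := by rw [sq]; exact mul_le_of_le_one_right hB0.le hB1
  have kW : ∀ x, |W x| ≤ L * σ := fun x => (bW x).trans (by
    have := mul_le_mul_of_nonneg_right (by linarith : C * A ≤ L) hσ0
    linarith)
  have kW₂ : ∀ x, |W₂ x| ≤ L * σ * B := fun x => (bW₂ x).trans (by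
    have h1 : (A * σ) ^ 2 ≤ (A * σ) * B := by
      rw [sq]; exact mul_le_mul_of_nonneg_left hAσ hAσ0
    have h2 := mul_le_mul_of_nonneg_left h1 hC.le
    have h3 := mul_le_mul_of_nonneg_right hCAL (mul_nonneg hσ0 hB0.le)
    linarith)
  have hCB : C * B ≤ L * B := mul_le_mul_of_nonneg_right (by linarith) hB0.le
  have hC3 : C * (3 * B ^ 2) ≤ L * B := by
    have h1 := mul_le_mul_of_nonneg_left hBB hC.le
    have h2 := mul_le_mul_of_nonneg_right hCL hB0.le
    linarith
  have hR : ∀ x, |(m - μ) + (-2 * g + 2 * l * γ) * (f x - w x) + 2 * l ^ 2 * (F x - W x) +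
      (l - lam) * (2 * γ * w x + 2 * (l + lam) * W x)| ≤ M * (|F₂ x - W₂ x| + B * (|f x - w x| +
        |deriv f x - deriv w x| + |F x - W x| + |m - μ| + |l - lam| * σ)) := fun x => by
    rw [hM]
    have hAL' := mul_le_mul_of_nonneg_right hAL hσ0
    refine abs_linear_part_le hL1 hB0.le hB1 hσ0 (by linarith) (by linarith) hlL hlamL
      (by linarith) (hfB.bound x) (hfB.deriv_bound x) ((bF x).trans hCB) ((bF₂ x).trans hC3)
      (hwB.bound x) (hwB.deriv_bound x) ((bW x).trans ?_) ((bW₂ x).trans ?_)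
      ((hw.bound x).trans hAL') ((hw.deriv_bound x).trans hAL') (kW x) (kW₂ x) (hfeq x) (hweq x)
    · exact (mul_le_mul_of_nonneg_left hAσ hC.le).trans hCB
    · refine le_trans ?_ hC3
      have := pow_le_pow_left₀ hAσ0 hAσ 2
      gcongr
  -- integrated bounds
  obtain ⟨R, hRdef⟩ : ∃ R : ℝ → ℝ, R = fun x => (m - μ) + (-2 * g + 2 * l * γ) * (f x - w x) +
    2 * l ^ 2 * (F x - W x) + (l - lam) * (2 * γ * w x + 2 * (l + lam) * W x) := ⟨_, rfl⟩
  have mR : BddMeas R := by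
    rw [hRdef]
    exact (((BddMeas.const _).add (md.const_mul _)).add (mD.const_mul _)).add
      (((mw.const_mul _).add (mW.const_mul _)).const_mul _)
  have hRle := perInt_sq_le mR mU md md' mD fun x => by rw [hRdef]; exact hR x
  rw [← hI, ← hJ] at hRle
  -- The linear part has constant coefficients, so its Fourier coefficients are those of the
  -- differences times the linearised symbol.
  have cR : ∀ k : ℕ, perInt (fun x => R x * Real.cos (k * x)) = cosNorm k *
      ((if k = 0 then m - μ else 0) + (-2 * g + 2 * l * γ + 2 * l ^ 2 * dnSymbol h k) *
        (p k - q k) + (l - lam) * ((2 * γ + 2 * (l + lam) * dnSymbol h k) * q k)) := fun k => by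
    have mc := isOrthoFamily_cos.bddMeas k
    have m0 := isOrthoFamily_cos.bddMeas 0
    have c0 := isOrthoFamily_cos.ortho 0 k
    have e : (fun x => R x * Real.cos (k * x)) = fun x =>
        (((m - μ) * (Real.cos ((0 : ℕ) * x) * Real.cos (k * x)) +
        (-2 * g + 2 * l * γ) * ((f x - w x) * Real.cos (k * x))) +
        2 * l ^ 2 * ((F x - W x) * Real.cos (k * x))) +
        ((l - lam) * (2 * γ) * (w x * Real.cos (k * x)) +
        (l - lam) * (2 * (l + lam)) * (W x * Real.cos (k * x))) := by
      ext x
      rw [hRdef]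
      simp only [Nat.cast_zero, zero_mul, Real.cos_zero]
      ring
    have b1 := (m0.mul mc).const_mul (m - μ)
    have b2 := (md.mul mc).const_mul (-2 * g + 2 * l * γ)
    have b3 := (mD.mul mc).const_mul (2 * l ^ 2)
    have b4 := (mw.mul mc).const_mul ((l - lam) * (2 * γ))
    have b5 := (mW.mul mc).const_mul ((l - lam) * (2 * (l + lam)))
    rw [e, perInt_add ((b1.add b2).add b3) (b4.add b5), perInt_add (b1.add b2) b3,
      perInt_add b1 b2, perInt_add b4 b5, perInt_const_mul, perInt_const_mul, perInt_const_mul,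
      perInt_const_mul, perInt_const_mul, c0, cd, cD, cw, cW]
    rcases eq_or_ne k 0 with rfl | hk
    · simp only [if_true]; ring
    · rw [if_neg hk.symm, if_neg hk]; ring
  have hcol := hco l lam (hl.trans_le hδδ) (hlam.trans_le hδδ)
  obtain ⟨h1, h2, h3⟩ := coercive_estimates (N := 6 * L) hκ mR cR (by simp [hp0, hq0])
    (by simp [hp1, hq1]) hq0 hcol.1 hcol.2 (fun k hk => by
      have hg1 : 1 ≤ dnSymbol h k := le_trans (by exact_mod_cast hk) (dnSymbol_ge hh k)
      have e2 : |(2 : ℝ)| ≤ 2 := by norm_num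
      refine (abs_add_le_add (abs_mul_le_mul e2 (by linarith : |γ| ≤ L)) (abs_mul_le_mul
        (abs_mul_le_mul e2 (abs_add_le_add hlL hlamL))
        (abs_of_pos (dnSymbol_pos hh k)).le)).trans ?_
      have := mul_le_mul_of_nonneg_left hg1 hL0.le
      linarith) sd' sW
  obtain ⟨Q, hQ⟩ : ∃ x, x = perInt fun x => R x ^ 2 := ⟨_, rfl⟩
  rw [← hQ] at h1 h2 h3 hRle
  have hQ0 : 0 ≤ Q := (sq_nonneg _).trans h1
  -- The second solution has size `O(|s|)`. Hence the coupling term is of order `(l - lam)² s²`,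
  -- which mode `1` already controls.
  have hY : perInt (fun x => W x ^ 2) ≤ 2 * Real.pi * L ^ 2 * σ ^ 2 := by
    have := perInt_mono (mW.pow 2) (BddMeas.const ((L * σ) ^ 2)) fun x => by
      rw [← sq_abs]; exact pow_le_pow_left₀ (abs_nonneg _) (kW x) 2
    rw [perInt_const] at this
    linarith [mul_pow L σ 2]
  obtain ⟨T, hT⟩ : ∃ x, x = ((l - lam) * s) ^ 2 := ⟨_, rfl⟩
  have hσs : σ ^ 2 = s ^ 2 := by rw [hσ, sq_abs]
  have hT0 : 0 ≤ T := hT ▸ sq_nonneg _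
  have hT1 : T ≤ 1 / κ ^ 2 * Q := by
    rw [one_div_mul_eq_div, le_div_iff₀ (by positivity), hT]
    rw [hq1, mul_pow] at h2
    linarith only [h2]
  have hJ1 : J ≤ (2 + 2 * (6 * L) ^ 2 * (2 * Real.pi * L ^ 2) / κ ^ 2) / κ ^ 2 * Q := by
    rw [div_mul_eq_mul_div, le_div_iff₀ (by positivity)]
    have h4 := mul_le_mul_of_nonneg_left hY (by positivity : 0 ≤ 2 * (6 * L * (l - lam)) ^ 2)
    have h5 : 2 * (6 * L * (l - lam)) ^ 2 * (2 * Real.pi * L ^ 2 * σ ^ 2) =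
        2 * (6 * L) ^ 2 * (2 * Real.pi * L ^ 2) * T := by rw [hσs, hT]; ring
    have h6 := mul_le_mul_of_nonneg_left hT1
      (by positivity : 0 ≤ 2 * (6 * L) ^ 2 * (2 * Real.pi * L ^ 2))
    have h7 : 2 * (6 * L) ^ 2 * (2 * Real.pi * L ^ 2) * (1 / κ ^ 2 * Q) =
      2 * (6 * L) ^ 2 * (2 * Real.pi * L ^ 2) / κ ^ 2 * Q := by ring
    linarith only [h3, h4, h5, h6, h7]
  have hθ : |m - μ| ^ 2 + (|l - lam| * σ) ^ 2 = (m - μ) ^ 2 + T := by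
    rw [hT, mul_pow, mul_pow, sq_abs, sq_abs, hσs]
  rw [hθ] at hRle
  have mw' : BddMeas (deriv w) := (deriv_energy hq hw).1
  have mf' : BddMeas (deriv f) := (deriv_energy hp hf).1
  obtain ⟨u1, u2⟩ := perInt_half_sq_sub_le hf.bddMeas mw mf' mw' hfB.bound hwB.bound
    hfB.deriv_bound hwB.deriv_bound
  rw [← hI] at u1 u2
  rw [← hJ] at u2
  obtain ⟨hJz, hsq, hTz⟩ := eq_zero_of_absorb hRle hUle u1 u2 hWle hIJ hJ0 (sq_nonneg _) hT0 hJ1 h1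
    hT1 hK₁ hK₂ hK₂0 hBK
  refine ⟨funext fun k => ?_, sub_eq_zero.1 (pow_eq_zero_iff two_ne_zero |>.1 hsq), fun hs0 => ?_⟩
  · rcases eq_or_ne k 0 with rfl | hk
    · rw [hp0, hq0]
    · rw [hJz] at sd'
      have := congrFun ((hasSum_zero_iff_of_nonneg fun k => by positivity).1 sd') k
      simpa [hpi.ne', hk, sub_eq_zero] using this
  · rw [hT] at hTz
    have := pow_eq_zero_iff two_ne_zero |>.1 hTz
    exact sub_eq_zero.1 ((mul_eq_zero.1 this).resolve_right hs0)

/-! ### Mean values and translations -/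

theorem hasMean_of_bounded_error {f : ℝ → ℝ} {c E : ℝ}
    (h : ∀ R > 0, |(∫ x in (-R)..R, f x) - 2 * R * c| ≤ E) : HasMean f c := by
  have hE : Tendsto (fun R : ℝ => E / 2 * R⁻¹) atTop (𝓝 0) := by
    simpa using tendsto_inv_atTop_zero.const_mul (E / 2)
  refine tendsto_iff_norm_sub_tendsto_zero.2 (squeeze_zero' (Eventually.of_forall fun _ =>
    norm_nonneg _) ?_ hE)
  filter_upwards [eventually_gt_atTop 0] with R hR
  have e : (1 / (2 * R)) * (∫ x in (-R)..R, f x) - c =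
      (1 / (2 * R)) * ((∫ x in (-R)..R, f x) - 2 * R * c) := by field_simp
  rw [e, Real.norm_eq_abs, abs_mul, abs_of_pos (by positivity)]
  have := mul_le_mul_of_nonneg_left (h R hR) (by positivity : 0 ≤ 1 / (2 * R))
  refine this.trans (le_of_eq (by field_simp))

/-- Each mode `k ≥ 1` contributes at most `2|c k|` to the integral over any symmetric interval, so
the total error stays bounded as the interval grows. -/
theorem hasMean_cosSeries {c : ℕ → ℝ} (hc : Summable fun k => |c k|) :
    HasMean (cosSeries c) (c 0) := by
  refine hasMean_of_bounded_error (E := 2 * ∑' k, |c k|) fun R hR => ?_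
  have h1 : HasSum (fun k : ℕ => ∫ x in (-R)..R, c k * Real.cos (k * x))
      (∫ x in (-R)..R, cosSeries c x) := by
    refine intervalIntegral.hasSum_integral_of_dominated_convergence (fun k _ => |c k|)
      (fun k => (by fun_prop : Continuous fun x : ℝ => c k * Real.cos (k * x)).aestronglyMeasurable)
      (fun k => Eventually.of_forall fun x _ => ?_) (Eventually.of_forall fun x _ => hc)
      (by simp) (Eventually.of_forall fun x _ => (isOrthoFamily_cos.summable hc x).hasSum)
    rw [Real.norm_eq_abs, abs_mul]
    exact mul_le_of_le_one_right (abs_nonneg _) (Real.abs_cos_le_one _)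
  have h2 : HasSum (fun k : ℕ => if k = 0 then 2 * R * c 0 else 0) (2 * R * c 0) := hasSum_ite_eq 0 _
  have h3 := h1.sub h2
  rw [← h3.tsum_eq, ← Real.norm_eq_abs]
  refine tsum_of_norm_bounded (hc.hasSum.mul_left 2) fun k => ?_
  rw [intervalIntegral.integral_const_mul, Real.norm_eq_abs]
  rcases eq_or_ne k 0 with rfl | hk
  · have e : c 0 * (R + R) - 2 * R * c 0 = 0 := by ring
    simp [e]
  · have hk0 : (k : ℝ) ≠ 0 := by exact_mod_cast hk
    have hk1 : (1 : ℝ) ≤ k := by exact_mod_cast Nat.one_le_iff_ne_zero.2 hk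
    rw [if_neg hk, sub_zero, intervalIntegral.integral_comp_mul_left _ hk0, integral_cos, abs_mul,
      mul_comm]
    refine mul_le_mul_of_nonneg_right ?_ (abs_nonneg _)
    rw [smul_eq_mul]
    refine (abs_mul_le_mul (A := 1) (B := 1 + 1) ?_ (abs_sub_le_add (Real.abs_sin_le_one _)
      (Real.abs_sin_le_one _))).trans (by norm_num)
    rw [abs_inv, Nat.abs_cast]
    exact inv_le_one_of_one_le₀ hk1

theorem HasMean.unique {f : ℝ → ℝ} {a b : ℝ} (ha : HasMean f a) (hb : HasMean f b) : a = b :=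
  tendsto_nhds_unique ha hb

theorem IsHolder.bounded {n : ℕ} {α : ℝ≥0} {f : ℝ → ℝ} (hf : IsHolder n α f) :
    ∃ K, 0 ≤ K ∧ ∀ x, |f x| ≤ K := by
  refine ⟨(holderNorm n α f).toReal, ENNReal.toReal_nonneg, fun x => ?_⟩
  simpa using abs_iteratedDeriv_le_of_holderNorm ENNReal.toReal_nonneg
    (by rw [ENNReal.ofReal_toReal hf.2.ne]) (Nat.zero_le n) x

theorem IsHolder.comp_add_const {n : ℕ} {α : ℝ≥0} {f : ℝ → ℝ} (hf : IsHolder n α f) (c : ℝ) :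
    IsHolder n α fun x => f (x + c) :=
  ⟨hf.1.comp (contDiff_id.add contDiff_const), by rw [holderNorm_comp_add_const]; exact hf.2⟩

theorem HasMean.comp_add_const {f : ℝ → ℝ} (hf : HasMean f 0) (hc : Continuous f) {K : ℝ}
    (hK : ∀ x, |f x| ≤ K) (c : ℝ) : HasMean (fun x => f (x + c)) 0 := by
  have hc' : Continuous fun x => f (x + c) := by fun_prop
  have key : HasMean (fun x => f (x + c) - f x) 0 := by
    refine hasMean_of_bounded_error (E := K * |c| + K * |c|) fun R hR => ?_
    have hi : ∀ a b, IntervalIntegrable f MeasureTheory.volume a b := fun a b =>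
      hc.intervalIntegrable a b
    rw [intervalIntegral.integral_sub (hc'.intervalIntegrable _ _) (hi _ _),
      intervalIntegral.integral_comp_add_right, mul_zero, sub_zero]
    have e : (∫ x in (-R + c)..(R + c), f x) - ∫ x in (-R)..R, f x =
        (∫ x in R..(R + c), f x) - ∫ x in (-R)..(-R + c), f x := by
      rw [intervalIntegral.integral_interval_sub_interval_comm (hi _ _) (hi _ _) (hi _ _)]
      rw [intervalIntegral.integral_symm R (R + c), intervalIntegral.integral_symm (-R) (-R + c)]
      ring
    have hb : ∀ a, |∫ x in a..(a + c), f x| ≤ K * |c| := fun a => by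
      have := intervalIntegral.norm_integral_le_of_norm_le_const (a := a) (b := a + c) (C := K)
        (f := f) fun x _ => hK x
      simpa using this
    rw [e]
    exact abs_sub_le_add (hb _) (hb _)
  have h := Tendsto.add hf key
  rw [add_zero] at h
  refine h.congr fun R => ?_
  rw [← mul_add]
  beta_reduce
  rw [intervalIntegral.integral_sub (hc'.intervalIntegrable _ _) (hc.intervalIntegrable _ _),
    add_sub_cancel]

theorem HarmonicAt.comp_add_const {W : ℂ → ℝ} {z : ℂ} (c : ℂ)
    (h : InnerProductSpace.HarmonicAt W (z + c)) :
    InnerProductSpace.HarmonicAt (fun z => W (z + c)) z := by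
  refine ⟨h.1.comp z (contDiffAt_id.add contDiffAt_const), ?_⟩
  have h2 := h.2
  have ht : Tendsto (fun y : ℂ => y + c) (𝓝 z) (𝓝 (z + c)) :=
    (continuous_id.add continuous_const).tendsto z
  filter_upwards [ht.eventually h2] with y hy
  rw [InnerProductSpace.laplacian_eq_iteratedFDeriv_complexPlane] at hy ⊢
  simp only [iteratedFDeriv_comp_add_right]
  exact hy

theorem HasDN.comp_add_const {h : ℝ} {f v : ℝ → ℝ} (hf : HasDN h f v) (c : ℝ) :
    HasDN h (fun x => f (x + c)) fun x => v (x + c) := by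
  obtain ⟨W, hW, hv⟩ := hf
  have hs : ∀ z : ℂ, (z + c).im = z.im := fun z => by simp
  have hm : ∀ x y : ℝ, (⟨x, y⟩ : ℂ) + c = ⟨x + c, y⟩ := fun x y => by
    apply Complex.ext <;> simp
  refine ⟨fun z => W (z + c), ⟨fun z hz => ?_, ?_, ?_, fun x => ?_, fun x => ?_⟩, fun x => ?_⟩
  · exact HarmonicAt.comp_add_const _ (hW.harmonic _ (by simpa [strip] using hz))
  · exact hW.continuousOn.comp (continuous_id.add continuous_const).continuousOn
      fun z hz => by simpa [closedStrip] using hz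
  · obtain ⟨C, hC⟩ := hW.bounded
    exact ⟨C, fun z hz => hC _ (by simpa [closedStrip] using hz)⟩
  · rw [hm]; exact hW.bottom _
  · rw [hm]; exact hW.top _
  · simp only [hm]; exact hv _

theorem SolvesEq.comp_add_const {g γ h l m : ℝ} {f : ℝ → ℝ} (hf : SolvesEq g γ h l m f) (c : ℝ) :
    SolvesEq g γ h l m fun x => f (x + c) := by
  obtain ⟨G, G₂, h1, h2, h3⟩ := hf
  refine ⟨_, _, h1.comp_add_const c, h2.comp_add_const c, fun x => ?_⟩
  rw [deriv_comp_add_const]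
  exact h3 (x + c)

/-! ### The curve of even solutions -/

/-- With `β_k = 0` the sine terms vanish. The constant merges with the mode `k = 0`, and vanishing
mean kills their sum. -/
theorem MemE0.exists_cosSeries {n : ℕ} {α : ℝ≥0} {f : ℝ → ℝ}
    (hf : MemE0 (fun k : ℕ => (k : ℝ)) (fun _ : ℕ => (0 : ℝ)) n α f) :
    ∃ p : ℕ → ℝ, (Summable fun k => |p k|) ∧ p 0 = 0 ∧ f = cosSeries p := by
  obtain ⟨-, ⟨c, A, B, hA, -, hf⟩, hmean⟩ := hf
  have h0 : HasSum (fun k : ℕ => if k = 0 then |c| else 0) |c| := hasSum_ite_eq 0 _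
  set p : ℕ → ℝ := fun k => (if k = 0 then c else 0) + A k with hp
  have hps : Summable fun k => |p k| := by
    refine (h0.summable.add hA).of_nonneg_of_le (fun k => abs_nonneg _) fun k => ?_
    refine (abs_add_le _ _).trans (add_le_add ?_ le_rfl)
    split_ifs <;> simp
  have hfp : f = cosSeries p := by
    ext x
    have h1 : HasSum (fun k : ℕ => if k = 0 then c else 0) c := hasSum_ite_eq 0 _
    have h2 := h1.add (isOrthoFamily_cos.summable hA x).hasSum
    rw [hf x, cosSeries]
    have e : (fun k => p k * Real.cos (k * x)) =
        fun k : ℕ => (if k = 0 then c else 0) + A k * Real.cos (k * x) := by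
      ext k
      rcases eq_or_ne k 0 with rfl | hk
      · simp [hp]
      · simp [hp, hk]
    rw [e, h2.tsum_eq]
    simp
  refine ⟨p, hps, ?_, hfp⟩
  rw [hfp] at hmean
  exact (hasMean_cosSeries hps).unique hmean

theorem abs_perInt_le {u : ℝ → ℝ} {K : ℝ} (hK : ∀ x, |u x| ≤ K) : |perInt u| ≤ 2 * Real.pi * K := by
  have := intervalIntegral.norm_integral_le_of_norm_le_const (a := -Real.pi) (b := Real.pi)
    (f := u) fun x _ => hK x
  rw [sub_neg_eq_add, abs_of_pos (by linarith [Real.pi_pos])] at this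
  refine this.trans (le_of_eq (by ring))

theorem abs_coeff_one_le {p : ℕ → ℝ} (hp : Summable fun k => |p k|) {K : ℝ}
    (hK : ∀ x, |cosSeries p x| ≤ K) : |p 1| ≤ 2 * K := by
  have h1 := isOrthoFamily_cos.perInt_tsum_mul hp 1
  have h2 := abs_perInt_le (u := fun x => cosSeries p x * Real.cos ((1 : ℕ) * x)) (K := K * 1)
    fun x => abs_mul_le_mul (hK x) (Real.abs_cos_le_one _)
  have h3 : perInt (fun x => cosSeries p x * Real.cos ((1 : ℕ) * x)) = Real.pi * p 1 := by
    rw [← show cosNorm 1 = Real.pi by simp [cosNorm]]; exact h1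
  rw [h3, abs_mul, abs_of_pos Real.pi_pos] at h2
  have := Real.pi_pos
  have h4 : Real.pi * |p 1| ≤ Real.pi * (2 * K) := by linarith
  exact le_of_mul_le_mul_left h4 this

theorem continuous_profile : Continuous profile :=
  continuous_const.add opP.continuous

theorem waveCoeff_profile_zero (s : ℝ) (ξ : L1) : waveCoeff (s • profile ξ) 0 = 0 := by
  simp [waveCoeff, cf_opJ]

theorem waveCoeff_profile_one (s : ℝ) (ξ : L1) : waveCoeff (s • profile ξ) 1 = s := by
  simp [waveCoeff, cf_opJ, profile, cf_delta, cf_opP, wbase]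
  rw [mul_assoc, ← Real.exp_add]
  simp

theorem wave_profile_zero : wave (profile 0) = Real.cos := by
  ext x
  rw [profile, map_zero, add_zero, wave_smul, Pi.smul_apply, wave_eq_evalCos]
  have : opJ (L1.delta 1) = L1.delta 1 := L1.ext_cf fun k => by
    rw [cf_opJ, cf_delta]
    split_ifs with hk <;> simp [hk]
  rw [this, evalCos_delta]
  simp [wbase, ← mul_assoc, ← Real.exp_add]

theorem summable_abs_waveCoeff (a : L1) : Summable fun k => |waveCoeff a k| :=
  summable_of_summable_exp (by norm_num) (summable_waveCoeff a)

theorem exists_even_curve {g γ h lamStar : ℝ} (hh : 0 < h) (hcr : IsCritical g γ h lamStar) {n : ℕ}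
    (hn : 1 ≤ n) {α : ℝ≥0} (hα0 : 0 < α) (hα1 : α < 1) {η : ℝ} (hη : 0 < η) :
    ∃ (ε : ℝ) (lam μ : ℝ → ℝ) (b : ℝ → L1),
      IsBifurcationCurve g γ h (fun k : ℕ => (k : ℝ)) (fun _ : ℕ => (0 : ℝ)) n α lamStar Real.cos ε
        lam μ (fun s => wave (b s)) ∧
      ∀ s ∈ Ioo (-ε) ε, ‖b s‖ ≤ η ∧ waveCoeff (b s) 0 = 0 ∧
        ∀ x, |wave (b s) x - s * Real.cos x| ≤ |s| / 2 := by
  obtain ⟨ε₀, ξ, hε₀, hξ, hξ0, hred⟩ := exists_branch hh hcr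
  have hc0 : ContinuousAt ξ 0 := hξ 0 ⟨by linarith, hε₀⟩
  set P : ℝ := ‖profile 0‖ + 1 with hP
  have hP0 : 0 < P := by positivity
  set κ := waveConst n with hκ
  have hκ0 : 0 < κ := waveConst_pos n
  -- The wave at `s` has `ℓ¹` norm at most `|s| P`; `κ` converts this to a Hölder norm and `3` to a
  -- `HolderFlat` constant.
  set A := 3 * (κ * P) with hA
  have hA0 : 0 < A := by positivity
  obtain ⟨δ, hδ, hrig⟩ := exists_rigidity (a := α) hh hcr (by exact_mod_cast hα0)
    (by exact_mod_cast hα1) hA0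
  have hprof : ContinuousAt (fun s => profile (ξ s)) 0 := continuous_profile.continuousAt.comp hc0
  have hcf : ∀ k s, ContinuousAt ξ s → ContinuousAt (fun s => cf (ξ s) k) s := fun k s hs => by
    simp only [← coord_apply]
    exact (coord k).continuous.continuousAt.comp hs
  have ev : ∀ᶠ s in 𝓝 (0 : ℝ), s ∈ Ioo (-ε₀) ε₀ ∧ ‖profile (ξ s)‖ < P ∧ |cf (ξ s) 1| < δ ∧
      |s * cf (ξ s) 0| < δ ∧ |s| < δ ∧ A * |s| < h ∧ |s| * P < η ∧
      κ * ‖profile (ξ s) - profile 0‖ < 1 / 2 := by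
    have t1 : ∀ {u : ℝ → ℝ} {c : ℝ}, ContinuousAt u 0 → u 0 < c → ∀ᶠ s in 𝓝 (0 : ℝ), u s < c :=
      fun hu hc => hu.eventually (gt_mem_nhds hc)
    have cab : ContinuousAt (fun s : ℝ => |s|) 0 := continuous_abs.continuousAt
    filter_upwards [Ioo_mem_nhds (by linarith : -ε₀ < 0) hε₀,
      t1 hprof.norm (c := P) (by simp only [hξ0, hP]; linarith),
      t1 (hcf 1 0 hc0).abs (c := δ) (by simpa [hξ0] using hδ),
      t1 (continuousAt_id.mul (hcf 0 0 hc0)).abs (c := δ) (by simpa [hξ0] using hδ),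
      t1 cab (c := δ) (by simpa using hδ),
      t1 (cab.const_mul A) (c := h) (by simpa using hh),
      t1 (cab.mul_const P) (c := η) (by simpa using hη),
      t1 ((hprof.sub (continuousAt_const (y := profile 0))).norm.const_mul κ) (c := 1 / 2)
        (by simp [hξ0])] with s h1 h2 h3 h4 h5 h6 h7 h8
    exact ⟨h1, h2, h3, h4, h5, h6, h7, h8⟩
  obtain ⟨ε, hε, hball⟩ := Metric.eventually_nhds_iff_ball.1 ev
  have hall : ∀ s ∈ Ioo (-ε) ε, _ := fun s hs => hball s (by
    rw [Metric.mem_ball, dist_zero_right, Real.norm_eq_abs]; exact abs_lt.2 hs)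
  have hnorm : ∀ s ∈ Ioo (-ε) ε, ‖s • profile (ξ s)‖ ≤ |s| * P := fun s hs => by
    rw [norm_smul, Real.norm_eq_abs]
    exact mul_le_mul_of_nonneg_left (hall s hs).2.1.le (abs_nonneg _)
  have hαle : α ≤ 1 := hα1.le
  have hflat : ∀ s ∈ Ioo (-ε) ε, HolderFlat α (A * |s|) (wave (s • profile (ξ s))) := fun s hs => by
    have h1 := holderFlat_of_holderNorm hn hαle (by positivity) (contDiff_wave _ n)
      (holderNorm_wave_le n hαle (s • profile (ξ s)))
    refine h1.mono ?_
    have := mul_le_mul_of_nonneg_left (hnorm s hs) hκ0.le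
    rw [hA]; linarith
  have hdist : ∀ s, wave (s • profile (ξ s)) - s • Real.cos =
      wave (s • (profile (ξ s) - profile 0)) := fun s => by
    rw [smul_sub, wave_sub, wave_smul s (profile 0), wave_profile_zero]
  have hclose : ∀ s ∈ Ioo (-ε) ε, ∀ x,
      |wave (s • profile (ξ s)) x - s * Real.cos x| ≤ |s| / 2 := fun s hs x => by
    have h1 := abs_iteratedDeriv_le_of_holderNorm (by positivity)
      (holderNorm_wave_le n hαle (s • (profile (ξ s) - profile 0))) (Nat.zero_le n) x
    rw [iteratedDeriv_zero, ← hdist, norm_smul, Real.norm_eq_abs] at h1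
    refine h1.trans ?_
    have := mul_le_mul_of_nonneg_left (hall s hs).2.2.2.2.2.2.2.le (abs_nonneg s)
    linarith
  refine ⟨ε, fun s => lamStar + cf (ξ s) 1, fun s => s * cf (ξ s) 0, fun s => s • profile (ξ s),
    ?_, fun s hs => ⟨(hnorm s hs).trans (hall s hs).2.2.2.2.2.2.1.le, waveCoeff_profile_zero _ _,
      hclose s hs⟩⟩
  have hξc : ∀ s ∈ Ioo (-ε) ε, ContinuousAt ξ s := fun s hs => hξ s (hall s hs).1
  constructor
  · exact hε
  · simp [hξ0]
  · simp
  · beta_reduce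
    rw [wave_smul, zero_smul]
  · exact fun s hs => (continuousAt_const.add (hcf 1 s (hξc s hs))).continuousWithinAt
  · exact fun s hs => (continuousAt_id.mul (hcf 0 s (hξc s hs))).continuousWithinAt
  · intro s hs
    have h1 : ContinuousAt (fun t => t • profile (ξ t)) s :=
      continuousAt_id.smul (continuous_profile.continuousAt.comp (hξc s hs))
    have h2 : Tendsto (fun t => ENNReal.ofReal (κ * ‖t • profile (ξ t) - s • profile (ξ s)‖)) (𝓝 s)
        (𝓝 0) := by
      have h3 := ((h1.sub continuousAt_const).norm.const_mul κ :
        ContinuousAt (fun t => κ * ‖t • profile (ξ t) - s • profile (ξ s)‖) s)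
      have h4 := ENNReal.continuous_ofReal.continuousAt.comp h3
      have h5 := h4.tendsto
      simpa [Function.comp_def] using h5
    refine tendsto_of_tendsto_of_tendsto_of_le_of_le tendsto_const_nhds h2 (fun _ => zero_le)
      fun t => ?_
    beta_reduce
    rw [← wave_sub]
    exact holderNorm_wave_le n hαle _
  · intro s hs
    refine ⟨isHolder_wave n hαle _, ⟨0, waveCoeff (s • profile (ξ s)), fun _ => 0,
      summable_abs_waveCoeff _, by simp, fun x => ?_⟩, ?_⟩
    · simp [wave, cosSeries]
    · have := hasMean_cosSeries (summable_abs_waveCoeff (s • profile (ξ s)))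
      rwa [waveCoeff_profile_zero] at this
  · exact fun s hs => solvesEq_of_reduced hh (hred s (hall s hs).1)
  · intro s hs x
    have h1 := abs_le.1 ((hflat s hs).bound x)
    linarith [(hall s hs).2.2.2.2.2.1]
  · intro s hs hs0 h0
    have h1 := hclose s hs 0
    beta_reduce at h0
    rw [h0] at h1
    simp at h1
    have := abs_pos.2 hs0
    linarith
  · refine Asymptotics.isLittleO_iff.2 fun c hc => ?_
    have h1 : ∀ᶠ s in 𝓝 (0 : ℝ), |cf (ξ s) 0| < c :=
      (hcf 0 0 hc0).abs.eventually (gt_mem_nhds (by simpa [hξ0] using hc))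
    filter_upwards [h1] with s hs
    rw [norm_mul, mul_comm]
    exact mul_le_mul_of_nonneg_right hs.le (norm_nonneg _)
  · have h2 : Tendsto (fun s => ENNReal.ofReal (κ * ‖profile (ξ s) - profile 0‖)) (𝓝[≠] 0)
        (𝓝 0) := by
      have h3 := ((hprof.sub continuousAt_const).norm.const_mul κ :
        ContinuousAt (fun s => κ * ‖profile (ξ s) - profile 0‖) 0)
      have h4 := (ENNReal.continuous_ofReal.continuousAt.comp h3).tendsto
      refine Tendsto.mono_left ?_ nhdsWithin_le_nhds
      simpa [hξ0, Function.comp_def] using h4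
    refine tendsto_of_tendsto_of_tendsto_of_le_of_le tendsto_const_nhds h2 (fun _ => zero_le)
      fun s => ?_
    beta_reduce
    rw [hdist]
    refine ENNReal.div_le_of_le_mul ((holderNorm_wave_le n hαle _).trans (le_of_eq ?_))
    rw [← ofReal_norm, ← ENNReal.ofReal_mul (by positivity), norm_smul]
    congr 1; ring
  -- The `3` absorbs the loss in `holderFlat_of_holderNorm`. The `4` puts the first coefficient, at
  -- most `2δ'`, inside the parameter interval.
  · have hδ' : 0 < min (δ / 3) (ε / 4) := lt_min (by linarith) (by linarith)
    set δ' := min (δ / 3) (ε / 4) with hδ'def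
    have hd1 : δ' ≤ δ / 3 := min_le_left _ _
    have hd2 : δ' ≤ ε / 4 := min_le_right _ _
    refine ⟨δ', hδ', fun l m f hl hm hmem hf hne hsol => ?_⟩
    obtain ⟨p, hp, hp0, rfl⟩ := hmem.exists_cosSeries
    have hff := holderFlat_of_holderNorm hn hαle hδ'.le hmem.holder.1 hf.le
    have hp1 : |p 1| ≤ 2 * δ' := abs_coeff_one_le hp fun x => by
      simpa using abs_iteratedDeriv_le_of_holderNorm hδ'.le hf.le (Nat.zero_le n) x
    have hs : p 1 ∈ Ioo (-ε) ε := abs_lt.1 (by linarith)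
    obtain ⟨q1, q2, q3, q4, q5, -⟩ := hall _ hs
    -- The given solution is compared with the point of the curve whose parameter is its own first
    -- cosine coefficient.
    obtain ⟨e1, e2, e3⟩ := hrig l m (lamStar + cf (ξ (p 1)) 1) (p 1 * cf (ξ (p 1)) 0) (p 1) p
      (waveCoeff (p 1 • profile (ξ (p 1)))) hp (summable_abs_waveCoeff _) hp0
      (waveCoeff_profile_zero _ _) rfl (waveCoeff_profile_one _ _) (by linarith)
      (by simpa using q3) q4 q5 (hff.mono (by linarith)) (hflat _ hs) hsol
      (solvesEq_of_reduced hh (hred _ q1))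
    have hpw : cosSeries p = wave (p 1 • profile (ξ (p 1))) := congrArg cosSeries e1
    -- At parameter `0` the curve is trivial, so rigidity would force the given solution to be
    -- trivial as well.
    have hs0 : p 1 ≠ 0 := by
      intro h0
      rw [hpw, e2, h0] at hne
      have hz : wave ((0 : ℝ) • profile (ξ 0)) = 0 := by rw [wave_smul, zero_smul]
      rw [hz, zero_mul] at hne
      simp at hne
    exact ⟨p 1, hs, hs0, e3 hs0, e2, hpw⟩

/-! ### The shifted curve -/

theorem cos_two_mul_shift (k : ℕ) (x : ℝ) : Real.cos ((2 * k : ℕ) * (x + -(Real.pi / 2))) =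
    (-1) ^ k * Real.cos (2 * k * x) := by
  rw [← Real.cos_sub_nat_mul_pi]
  congr 1; push_cast; ring

theorem cos_two_mul_add_one_shift (k : ℕ) (x : ℝ) :
    Real.cos ((2 * k + 1 : ℕ) * (x + -(Real.pi / 2))) = (-1) ^ k * Real.sin ((2 * k + 1) * x) := by
  rw [← Real.sin_sub_nat_mul_pi, ← Real.cos_sub_pi_div_two]
  congr 1; push_cast; ring

theorem cos_two_mul_unshift (k : ℕ) (x : ℝ) : Real.cos (2 * k * (x + Real.pi / 2)) =
    (-1) ^ k * Real.cos ((2 * k : ℕ) * x) := by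
  rw [← Real.cos_add_nat_mul_pi]
  congr 1; push_cast; ring

theorem sin_two_mul_add_one_unshift (k : ℕ) (x : ℝ) :
    Real.sin ((2 * k + 1) * (x + Real.pi / 2)) = (-1) ^ k * Real.cos ((2 * k + 1 : ℕ) * x) := by
  rw [← Real.cos_add_nat_mul_pi, ← Real.sin_add_pi_div_two]
  congr 1; push_cast; ring

theorem MemE0.hasMean_comp_add_const {a b : ℕ → ℝ} {n : ℕ} {α : ℝ≥0} {f : ℝ → ℝ}
    (hf : MemE0 a b n α f) (c : ℝ) : HasMean (fun x => f (x + c)) 0 := by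
  obtain ⟨K, -, hK⟩ := hf.holder.bounded
  exact hf.mean_zero.comp_add_const hf.holder.1.continuous hK c

/-- Under the shift the even modes stay cosines and the odd modes become sines, each up to the sign
`(-1)^k`. -/
theorem MemE0.shift {n : ℕ} {α : ℝ≥0} {f : ℝ → ℝ}
    (hf : MemE0 (fun k : ℕ => (k : ℝ)) (fun _ : ℕ => (0 : ℝ)) n α f) :
    MemE0 (fun k : ℕ => 2 * (k : ℝ)) (fun k : ℕ => 2 * (k : ℝ) + 1) n α
      fun x => f (x + -(Real.pi / 2)) := by
  refine ⟨hf.holder.comp_add_const _, ?_, hf.hasMean_comp_add_const _⟩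
  obtain ⟨p, hp, -, rfl⟩ := hf.exists_cosSeries
  have ie : Function.Injective fun k : ℕ => 2 * k := fun a b h => by simpa using h
  have io : Function.Injective fun k : ℕ => 2 * k + 1 := fun a b h => by simpa using h
  refine ⟨0, fun k => (-1) ^ k * p (2 * k), fun k => (-1) ^ k * p (2 * k + 1), ?_, ?_, fun x => ?_⟩
  · simpa [abs_mul, Function.comp_def] using hp.comp_injective ie
  · simpa [abs_mul, Function.comp_def] using hp.comp_injective io
  · have hs := isOrthoFamily_cos.summable hp (x + -(Real.pi / 2))
    have key := tsum_even_add_odd (f := fun k : ℕ => p k * Real.cos (k * (x + -(Real.pi / 2))))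
      (hs.comp_injective ie) (hs.comp_injective io)
    rw [cosSeries, ← key, zero_add]
    congr 1
    · refine tsum_congr fun k => ?_
      rw [cos_two_mul_shift]; ring
    · refine tsum_congr fun k => ?_
      rw [cos_two_mul_add_one_shift]; ring

/-- The converse is what transfers completeness: any candidate in the mixed space is moved back to
the even space. The two coefficient sequences are interleaved into one. -/
theorem MemE0.unshift {n : ℕ} {α : ℝ≥0} {f : ℝ → ℝ}
    (hf : MemE0 (fun k : ℕ => 2 * (k : ℝ)) (fun k : ℕ => 2 * (k : ℝ) + 1) n α f) :
    MemE0 (fun k : ℕ => (k : ℝ)) (fun _ : ℕ => (0 : ℝ)) n α fun x => f (x + Real.pi / 2) := by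
  refine ⟨hf.holder.comp_add_const _, ?_, hf.hasMean_comp_add_const _⟩
  obtain ⟨c, A, B, hA, hB, hx⟩ := hf.expansion
  set p : ℕ → ℝ := fun k => (-1) ^ (k / 2) * if Even k then A (k / 2) else B (k / 2) with hp
  have pe : ∀ k, p (2 * k) = (-1) ^ k * A k := fun k => by simp [hp]
  have po : ∀ k, p (2 * k + 1) = (-1) ^ k * B k := fun k => by
    have : (2 * k + 1) / 2 = k := by omega
    simp [hp, this]
  have hps : Summable fun k => |p k| := by
    refine (HasSum.even_add_odd (f := fun k => |p k|) (m := ∑' k, |A k|) (m' := ∑' k, |B k|)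
      ?_ ?_).summable
    · simpa [pe, abs_mul] using hA.hasSum
    · simpa [po, abs_mul] using hB.hasSum
  refine ⟨c, p, fun _ => 0, hps, by simp, fun x => ?_⟩
  have ie : Function.Injective fun k : ℕ => 2 * k := fun a b h => by simpa using h
  have io : Function.Injective fun k : ℕ => 2 * k + 1 := fun a b h => by simpa using h
  have hs := isOrthoFamily_cos.summable hps x
  have key := tsum_even_add_odd (f := fun k : ℕ => p k * Real.cos (k * x))
    (hs.comp_injective ie) (hs.comp_injective io)
  rw [hx, ← key]
  simp only [pe, po, cos_two_mul_unshift, sin_two_mul_add_one_unshift, zero_mul, tsum_zero,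
    add_zero, add_assoc]
  congr 2
  · exact tsum_congr fun k => by ring
  · exact tsum_congr fun k => by ring

theorem IsBifurcationCurve.shift {g γ h lamStar ε : ℝ} {n : ℕ} {α : ℝ≥0} {lam μ : ℝ → ℝ}
    {v : ℝ → ℝ → ℝ} (hv : IsBifurcationCurve g γ h (fun k : ℕ => (k : ℝ)) (fun _ : ℕ => (0 : ℝ)) n α
      lamStar Real.cos ε lam μ v) :
    IsBifurcationCurve g γ h (fun k : ℕ => 2 * (k : ℝ)) (fun k : ℕ => 2 * (k : ℝ) + 1) n α lamStar
      Real.sin ε lam μ fun s x => v s (x + -(Real.pi / 2)) where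
  eps_pos := hv.eps_pos
  lam_zero := hv.lam_zero
  mu_zero := hv.mu_zero
  w_zero := by ext x; simp [hv.w_zero]
  lam_cont := hv.lam_cont
  mu_cont := hv.mu_cont
  w_cont := fun s hs => (hv.w_cont s hs).congr fun t =>
    (holderNorm_comp_add_const n α (v t - v s) (-(Real.pi / 2))).symm
  mem := fun s hs => (hv.mem s hs).shift
  solves := fun s hs => (hv.solves s hs).comp_add_const _
  above_bottom := fun s hs x => hv.above_bottom s hs _
  nontrivial := fun s hs hs0 h0 => hv.nontrivial s hs hs0 <| by
    ext x
    have := congrFun h0 (x + Real.pi / 2)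
    simpa using this
  mu_little := hv.mu_little
  w_little := by
    refine hv.w_little.congr fun s => ?_
    rw [← holderNorm_comp_add_const n α _ (-(Real.pi / 2))]
    congr 2
    ext x
    simp only [Pi.sub_apply, Pi.smul_apply, ← sub_eq_add_neg, Real.cos_sub_pi_div_two]
  complete := by
    obtain ⟨δ, hδ, hc⟩ := hv.complete
    refine ⟨δ, hδ, fun l m f hl hm hmem hf hne hsol => ?_⟩
    obtain ⟨s, hs, hs0, h1, h2, h3⟩ := hc l m (fun x => f (x + Real.pi / 2)) hl hm hmem.unshift
      (by rwa [holderNorm_comp_add_const]) (hne.imp_right fun h h0 => h <| by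
        ext x
        have := congrFun h0 (x + -(Real.pi / 2))
        simpa using this) (hsol.comp_add_const _)
    refine ⟨s, hs, hs0, h1, h2, ?_⟩
    ext x
    have := congrFun h3 (x + -(Real.pi / 2))
    simpa using this

theorem isAdmissible_even_odd :
    IsAdmissible (fun k : ℕ => 2 * (k : ℝ)) fun k : ℕ => 2 * (k : ℝ) + 1 := by
  have hsub : ∀ k l : ℕ, |2 * (k : ℝ) - 2 * l| = 2 * ((max k l - min k l : ℕ) : ℝ) := by
    intro k l
    rcases le_total k l with hkl | hkl
    · have h : (k : ℝ) ≤ l := by exact_mod_cast hkl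
      rw [max_eq_right hkl, min_eq_left hkl, abs_of_nonpos (by linarith), Nat.cast_sub hkl]; ring
    · have h : (l : ℝ) ≤ k := by exact_mod_cast hkl
      rw [max_eq_left hkl, min_eq_right hkl, abs_of_nonneg (by linarith), Nat.cast_sub hkl]; ring
  refine ⟨⟨0, fun k => ?_⟩, fun k l => ⟨⟨k + l, ?_⟩, ⟨max k l - min k l, ?_⟩, ⟨k + l + 1, ?_⟩,
    ⟨max k l - min k l, ?_⟩, ⟨k + l, ?_⟩, ?_⟩⟩
  · have : (0 : ℝ) < 2 * k + 1 := by positivity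
    simpa using this.ne
  · push_cast; ring
  · exact (hsub k l).symm
  · push_cast; ring
  · beta_reduce
    rw [← hsub]; congr 1; ring
  · push_cast; ring
  · rcases le_or_gt k l with hkl | hkl
    · have h : (k : ℝ) ≤ l := by exact_mod_cast hkl
      refine ⟨l - k, ?_⟩
      beta_reduce
      rw [abs_of_nonpos (by linarith), Nat.cast_sub hkl]; ring
    · have h : (l : ℝ) + 1 ≤ k := by exact_mod_cast hkl
      refine ⟨k - (l + 1), ?_⟩
      beta_reduce
      rw [abs_of_nonneg (by linarith), Nat.cast_sub hkl]; push_cast; ring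

/-! ### Conformal images of the strip -/

/-- A perturbation of the identity with Lipschitz constant below `1` is bijective with continuous
inverse, by the contraction argument behind the inverse function theorem. -/
theorem exists_homeomorph_add {E : Type*} [NormedAddCommGroup E] [NormedSpace ℝ E] [CompleteSpace E]
    (r : E → E) (hr : ∀ x y, ‖r x - r y‖ ≤ 1 / 2 * ‖x - y‖) : ∃ T : E ≃ₜ E, ∀ x, T x = x + r x := by
  have h1 : ApproximatesLinearOn (fun x => x + r x)
      ((ContinuousLinearEquiv.refl ℝ E : E ≃L[ℝ] E) : E →L[ℝ] E) univ (1 / 2 : ℝ≥0) := by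
    intro x _ y _
    have : x + r x - (y + r y) - (ContinuousLinearEquiv.refl ℝ E : E →L[ℝ] E) (x - y) =
        r x - r y := by
      simp only [ContinuousLinearEquiv.coe_refl, ContinuousLinearMap.coe_id', id_eq]; abel
    rw [this]
    simpa using hr x y
  have h2 : Subsingleton E ∨ (1 / 2 : ℝ≥0) <
      ‖((ContinuousLinearEquiv.refl ℝ E : E ≃L[ℝ] E).symm : E →L[ℝ] E)‖₊⁻¹ := by
    rcases subsingleton_or_nontrivial E with h | h
    · exact Or.inl h
    · right
      have : ‖((ContinuousLinearEquiv.refl ℝ E : E ≃L[ℝ] E).symm : E →L[ℝ] E)‖₊ = 1 := by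
        apply NNReal.eq
        exact ContinuousLinearMap.norm_id
      rw [this, inv_one]
      exact NNReal.coe_lt_coe.1 (by norm_num)
  exact ⟨h1.toHomeomorph _ h2, fun x => rfl⟩

/-- Projection of the plane to the strip `a ≤ y ≤ b`. -/
def clipIm {a b : ℝ} (hab : a ≤ b) (z : ℂ) : ℂ := ⟨z.re, projIcc a b hab z.im⟩

theorem norm_clipIm_sub_le {a b : ℝ} (hab : a ≤ b) (z w : ℂ) :
    ‖clipIm hab z - clipIm hab w‖ ≤ ‖z - w‖ := by
  rw [← abs_of_nonneg (norm_nonneg (clipIm hab z - clipIm hab w)), ← abs_of_nonneg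
    (norm_nonneg (z - w)), ← sq_le_sq, Complex.sq_norm, Complex.sq_norm, Complex.normSq_apply,
    Complex.normSq_apply]
  have h1 := abs_projIcc_sub_projIcc (c := z.im) (d := w.im) hab
  have h2 := sq_le_sq.2 h1
  simp only [clipIm, Complex.sub_re, Complex.sub_im]
  nlinarith

theorem clipIm_of_mem {a b : ℝ} (hab : a ≤ b) {z : ℂ} (hz : z.im ∈ Icc a b) : clipIm hab z = z := by
  rw [clipIm, projIcc_of_mem hab hz]

theorem clipIm_of_ge {a b : ℝ} (hab : a ≤ b) {z : ℂ} (hz : b ≤ z.im) :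
    clipIm hab z = ⟨z.re, b⟩ := by
  rw [clipIm, projIcc_of_right_le hab hz]

theorem clipIm_of_le {a b : ℝ} (hab : a ≤ b) {z : ℂ} (hz : z.im ≤ a) :
    clipIm hab z = ⟨z.re, a⟩ := by
  rw [clipIm, projIcc_of_le_left hab hz]

theorem clipIm_im_mem {a b : ℝ} (hab : a ≤ b) (z : ℂ) : (clipIm hab z).im ∈ Icc a b :=
  (projIcc a b hab z.im).2

theorem exists_bound_of_periodic {E : Type*} [NormedAddCommGroup E] {h : ℝ} {f : ℂ → E}
    (hf : ContinuousOn f (closedStrip h)) (hp : Function.Periodic f ((2 * Real.pi : ℝ) : ℂ)) :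
    ∃ C, ∀ z ∈ closedStrip h, ‖f z‖ ≤ C := by
  have hpi : 0 < 2 * Real.pi := by positivity
  have hc : IsCompact (Icc 0 (2 * Real.pi) ×ℂ Icc (-h) 0) := isCompact_Icc.reProdIm isCompact_Icc
  have hsub : Icc 0 (2 * Real.pi) ×ℂ Icc (-h) 0 ⊆ closedStrip h := fun z hz => hz.2
  obtain ⟨C, hC⟩ := hc.exists_bound_of_continuousOn (hf.mono hsub)
  refine ⟨C, fun z hz => ?_⟩
  rw [← hp.sub_zsmul_eq ⌊z.re / (2 * Real.pi)⌋]
  refine hC _ ⟨?_, ?_⟩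
  · have h1 := Int.floor_le (z.re / (2 * Real.pi))
    have h2 := Int.lt_floor_add_one (z.re / (2 * Real.pi))
    rw [le_div_iff₀ hpi] at h1
    rw [div_lt_iff₀ hpi] at h2
    simp only [mem_preimage, zsmul_eq_mul, Complex.sub_re, Complex.mul_re, Complex.intCast_re,
      Complex.intCast_im, Complex.ofReal_re, Complex.ofReal_im, zero_mul, sub_zero]
    constructor <;> linarith
  · simpa [closedStrip] using hz

/-- A conformal map `z + i h + Θ(z)` of the strip close to the identity, with boundary elevation
`h + v`, and a function `Θ₂` whose imaginary part has boundary values `v ^ 2 / 2`. -/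
structure IsConformalData (h : ℝ) (Θ Θ₂ : ℂ → ℂ) (v : ℝ → ℝ) : Prop where
  depth_pos : 0 < h
  diff : DifferentiableOn ℂ Θ (bigStrip h (1 / 2))
  diff₂ : DifferentiableOn ℂ Θ₂ (bigStrip h (1 / 2))
  bound : ∀ z ∈ bigStrip h (1 / 2), ‖deriv Θ z‖ ≤ 1 / 2
  periodic : Function.Periodic Θ ((2 * Real.pi : ℝ) : ℂ)
  periodic₂ : ∃ c : ℝ, ∀ z, Θ₂ (z + (2 * Real.pi : ℝ)) = Θ₂ z + c
  bottom : ∀ x : ℝ, (Θ ⟨x, -h⟩).im = 0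
  bottom₂ : ∀ x : ℝ, (Θ₂ ⟨x, -h⟩).im = 0
  top : ∀ x : ℝ, (Θ ⟨x, 0⟩).im = v x
  top₂ : ∀ x : ℝ, (Θ₂ ⟨x, 0⟩).im = v x ^ 2 / 2
  pos : ∀ x, 0 < h + v x

section Data

variable {h : ℝ} {Θ Θ₂ : ℂ → ℂ} {v : ℝ → ℝ}

theorem mem_bigStrip {h : ℝ} (hh : 0 < h) {z : ℂ} (hz : z.im ∈ Icc (-h - 1 / 4) (1 / 4)) :
    z ∈ bigStrip h (1 / 2) := by
  have h1 := hz.1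
  have h2 := hz.2
  change |z.im + h| < h + 1 / 2
  rw [abs_lt]
  constructor <;> linarith

theorem convex_bigStrip (h ρ : ℝ) : Convex ℝ (bigStrip h ρ) := by
  have : bigStrip h ρ = Complex.imLm ⁻¹' (Metric.ball (-h) (h + ρ)) := by
    ext z
    simp [bigStrip, Metric.mem_ball, Real.dist_eq]
  rw [this]
  exact (convex_ball _ _).linear_preimage _

theorem convex_closedStrip (h : ℝ) : Convex ℝ (closedStrip h) := by
  have : closedStrip h = Complex.imLm ⁻¹' (Icc (-h) 0) := by
    ext z; simp [closedStrip]
  rw [this]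
  exact (convex_Icc _ _).linear_preimage _

theorem closure_strip {h : ℝ} (hh : 0 < h) : closure (strip h) = closedStrip h := by
  have : strip h = Complex.im ⁻¹' Ioo (-h) 0 := by ext z; simp [strip]
  rw [this, Complex.closure_preimage_im, closure_Ioo (by linarith)]
  ext z; simp [closedStrip]

theorem IsConformalData.norm_sub_le (hP : IsConformalData h Θ Θ₂ v) {z w : ℂ}
    (hz : z ∈ bigStrip h (1 / 2)) (hw : w ∈ bigStrip h (1 / 2)) :
    ‖Θ z - Θ w‖ ≤ 1 / 2 * ‖z - w‖ :=
  (convex_bigStrip h _).norm_image_sub_le_of_norm_deriv_le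
    (fun _ hx => hP.diff.differentiableAt ((isOpen_bigStrip h _).mem_nhds hx)) hP.bound hw hz

/-- The conformal map. -/
def confMap (h : ℝ) (Θ : ℂ → ℂ) (z : ℂ) : ℂ := z + (h * Complex.I + Θ z)

theorem IsConformalData.exists_clipHomeo (hP : IsConformalData h Θ Θ₂ v) {a b : ℝ} (hab : a ≤ b)
    (hs : Icc a b ⊆ Icc (-h - 1 / 4) (1 / 4)) :
    ∃ T : ℂ ≃ₜ ℂ, ∀ z, T z = z + (h * Complex.I + Θ (clipIm hab z)) := by
  refine exists_homeomorph_add _ fun z w => ?_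
  rw [add_sub_add_left_eq_sub]
  refine (hP.norm_sub_le (mem_bigStrip hP.depth_pos (hs (clipIm_im_mem hab z)))
    (mem_bigStrip hP.depth_pos (hs (clipIm_im_mem hab w)))).trans ?_
  gcongr
  exact norm_clipIm_sub_le hab z w

theorem IsConformalData.exists_lineHomeo (hP : IsConformalData h Θ Θ₂ v) {y : ℝ}
    (hy : y ∈ Icc (-h - 1 / 4) (1 / 4)) :
    ∃ U : ℝ ≃ₜ ℝ, ∀ x, U x = x + (Θ ⟨x, y⟩).re := by
  refine exists_homeomorph_add (fun x => (Θ ⟨x, y⟩).re) fun x x' => ?_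
  have h1 := hP.norm_sub_le (mem_bigStrip hP.depth_pos (z := ⟨x, y⟩) hy)
    (mem_bigStrip hP.depth_pos (z := ⟨x', y⟩) hy)
  have h2 : ‖(⟨x, y⟩ : ℂ) - ⟨x', y⟩‖ = ‖x - x'‖ := by
    have : (⟨x, y⟩ : ℂ) - ⟨x', y⟩ = ((x - x' : ℝ) : ℂ) := by apply Complex.ext <;> simp
    rw [this, Complex.norm_real]
  rw [h2] at h1
  refine le_trans ?_ h1
  rw [← Complex.sub_re]
  exact Complex.abs_re_le_norm _

/-- The image of the strip is the region below a graph. -/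
theorem IsConformalData.exists_graph (hP : IsConformalData h Θ Θ₂ v) :
    ∃ U : ℝ ≃ₜ ℝ, (∀ x, U x = x + (Θ ⟨x, 0⟩).re) ∧
      fluidDomain (fun X => h + v (U.symm X)) = confMap h Θ '' strip h ∧
      closure (fluidDomain fun X => h + v (U.symm X)) = confMap h Θ '' closedStrip h := by
  have hh := hP.depth_pos
  obtain ⟨U, hU⟩ := hP.exists_lineHomeo (y := 0) ⟨by linarith, by norm_num⟩
  obtain ⟨B, hB⟩ := hP.exists_lineHomeo (y := -h) ⟨by linarith, by linarith⟩
  have hab : -h ≤ 0 := by linarith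
  -- Freezing `Θ` at its boundary values outside the strip extends the map to a homeomorphism of the
  -- plane. It sends points above the strip vertically above the graph, and points below it to the
  -- lower half plane. Bijectivity therefore forces the strip onto the region between.
  obtain ⟨T, hT⟩ := hP.exists_clipHomeo hab (Icc_subset_Icc (by linarith) (by norm_num))
  have htop : ∀ z : ℂ, 0 ≤ z.im → T z = ⟨U z.re, h + v z.re + z.im⟩ := fun z hz => by
    rw [hT, clipIm_of_ge hab hz, hU, ← hP.top]
    apply Complex.ext
    · simp
    · simp; ring
  have hbot : ∀ z : ℂ, z.im ≤ -h → T z = ⟨B z.re, z.im + h⟩ := fun z hz => by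
    rw [hT, clipIm_of_le hab hz, hB]
    apply Complex.ext
    · simp
    · simp [hP.bottom]
  set η := fun X => h + v (U.symm X) with hη
  have hmem : ∀ z, T z ∈ fluidDomain η ↔ z ∈ strip h := by
    intro z
    constructor
    · intro hz
      refine ⟨?_, ?_⟩
      · by_contra hc
        rw [hbot z (not_lt.1 hc)] at hz
        have h1 := hz.1
        simp only at h1
        linarith [not_lt.1 hc]
      · by_contra hc
        rw [htop z (not_lt.1 hc)] at hz
        have h1 := hz.2
        simp only [hη, Homeomorph.symm_apply_apply] at h1
        linarith [not_lt.1 hc]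
    · intro hz
      refine ⟨?_, ?_⟩
      · by_contra hc
        rw [not_lt] at hc
        have h1 := hbot ⟨B.symm (T z).re, (T z).im - h⟩ (by simpa using hc)
        simp only [Homeomorph.apply_symm_apply, sub_add_cancel] at h1
        have h2 := T.injective h1
        have h3 := hz.1
        rw [← h2] at h3
        simp only at h3
        linarith
      · by_contra hc
        rw [not_lt] at hc
        have h1 := htop ⟨U.symm (T z).re, (T z).im - η (T z).re⟩ (by simpa using hc)
        simp only [Homeomorph.apply_symm_apply, hη, add_sub_cancel] at h1
        have h2 := T.injective h1
        have h3 := hz.2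
        rw [← h2] at h3
        simp only [hη] at h3 hc
        linarith
  have himg : fluidDomain η = T '' strip h := by
    ext ζ
    constructor
    · intro hζ
      refine ⟨T.symm ζ, (hmem _).1 (by rwa [T.apply_symm_apply]), T.apply_symm_apply ζ⟩
    · rintro ⟨z, hz, rfl⟩
      exact (hmem z).2 hz
  have hTc : ∀ z ∈ closedStrip h, T z = confMap h Θ z := fun z hz => by
    rw [hT, clipIm_of_mem hab hz, confMap]
  refine ⟨U, hU, ?_, ?_⟩
  · rw [himg]
    exact image_congr fun z hz => hTc z (strip_subset_closedStrip h hz)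
  · rw [himg, ← T.image_closure, closure_strip hh]
    exact image_congr hTc

/-- The inverse of the conformal map is holomorphic near the closed strip. -/
theorem IsConformalData.exists_inverse (hP : IsConformalData h Θ Θ₂ v) :
    ∃ (S : ℂ → ℂ) (N M : Set ℂ), IsOpen N ∧ IsOpen M ∧ closedStrip h ⊆ N ∧
      N ⊆ bigStrip h (1 / 2) ∧ M = confMap h Θ '' N ∧ (∀ z ∈ N, S (confMap h Θ z) = z) ∧
      ∀ z ∈ N, HasDerivAt S (1 + deriv Θ z)⁻¹ (confMap h Θ z) := by
  have hh := hP.depth_pos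
  have hab : -h - 1 / 4 ≤ 1 / 4 := by linarith
  -- Clipping to a strip larger by `1/4` on each side keeps the map holomorphic on an open
  -- neighbourhood of the closed strip, so derivatives up to the boundary are ordinary ones.
  obtain ⟨T, hT⟩ := hP.exists_clipHomeo hab le_rfl
  set N : Set ℂ := Complex.im ⁻¹' Ioo (-h - 1 / 4) (1 / 4) with hN
  have hNo : IsOpen N := isOpen_Ioo.preimage Complex.continuous_im
  have hTN : ∀ z ∈ N, T z = confMap h Θ z := fun z hz => by
    rw [hT, clipIm_of_mem hab (Ioo_subset_Icc_self hz), confMap]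
  have hNb : N ⊆ bigStrip h (1 / 2) := fun z hz => mem_bigStrip hh (Ioo_subset_Icc_self hz)
  have hinv : ∀ z ∈ N, T.symm (confMap h Θ z) = z := fun z hz => by
    rw [← hTN z hz, T.symm_apply_apply]
  refine ⟨T.symm, N, T '' N, hNo, T.isOpen_image.2 hNo, fun z hz => ⟨?_, ?_⟩, hNb,
    image_congr hTN, hinv, fun z hz => ?_⟩
  · linarith [hz.1]
  · linarith [hz.2]
  · have h1 : HasDerivAt T (1 + deriv Θ z) z := by
      have h2 := (hP.diff.differentiableAt ((isOpen_bigStrip h _).mem_nhds (hNb hz))).hasDerivAt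
      have h3 : HasDerivAt (confMap h Θ) (1 + deriv Θ z) z :=
        (hasDerivAt_id z).fun_add (h2.const_add (h * Complex.I))
      exact h3.congr_of_eventuallyEq (eventually_of_mem (hNo.mem_nhds hz) hTN)
    refine HasDerivAt.of_local_left_inverse T.symm.continuous.continuousAt
      (by rw [hinv z hz]; exact h1) ?_ (Eventually.of_forall T.apply_symm_apply)
    intro h0
    have h4 := hP.bound z (hNb hz)
    rw [eq_neg_of_add_eq_zero_right h0, norm_neg, norm_one] at h4
    norm_num at h4

end Data

/-! ### The stream function -/

theorem Function.Periodic.exists_abs_le {f : ℝ → ℝ} {T : ℝ} (hT : 0 < T)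
    (hp : Function.Periodic f T) (hf : Continuous f) : ∃ C, ∀ x, |f x| ≤ C := by
  obtain ⟨C, hC⟩ := (isCompact_Icc (a := (0 : ℝ)) (b := T)).exists_bound_of_continuousOn
    hf.continuousOn
  refine ⟨C, fun x => ?_⟩
  obtain ⟨y, hy, hxy⟩ := hp.exists_mem_Ico₀ hT x
  rw [hxy]
  exact hC y (Ico_subset_Icc_self hy)

theorem Function.Periodic.iteratedDeriv {f : ℝ → ℝ} {T : ℝ} (hp : Function.Periodic f T) (j : ℕ) :
    Function.Periodic (iteratedDeriv j f) T := fun x => by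
  have h1 : (fun x => f (x + T)) = f := funext hp
  have h2 := congrFun (iteratedDeriv_comp_add_const j f T) x
  rw [h1] at h2
  exact h2.symm

theorem isHolder_of_periodic {f : ℝ → ℝ} {T : ℝ} (hT : 0 < T) (hp : Function.Periodic f T)
    (hf : ContDiff ℝ 2 f) {α : ℝ≥0} (hα : α ≤ 1) : IsHolder 1 α f := by
  have hc : ∀ j : ℕ, j ≤ 2 → Continuous (iteratedDeriv j f) := fun j hj =>
    hf.continuous_iteratedDeriv j (by exact_mod_cast hj)
  obtain ⟨C₀, h0⟩ := Function.Periodic.exists_abs_le hT (Function.Periodic.iteratedDeriv hp 0)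
    (hc 0 (by norm_num))
  obtain ⟨C₁, h1⟩ := Function.Periodic.exists_abs_le hT (Function.Periodic.iteratedDeriv hp 1)
    (hc 1 (by norm_num))
  obtain ⟨C₂, h2⟩ := Function.Periodic.exists_abs_le hT (Function.Periodic.iteratedDeriv hp 2)
    (hc 2 (by norm_num))
  set C := max C₀ (max C₁ C₂)
  have h0' : ∀ x, |iteratedDeriv 0 f x| ≤ C := fun x => (h0 x).trans (le_max_left _ _)
  have h1' : ∀ x, |iteratedDeriv 1 f x| ≤ C := fun x =>
    (h1 x).trans ((le_max_left _ _).trans (le_max_right _ _))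
  have h2' : ∀ x, |iteratedDeriv 2 f x| ≤ C := fun x =>
    (h2 x).trans ((le_max_right _ _).trans (le_max_right _ _))
  have hC0 : 0 ≤ C := (abs_nonneg _).trans (h0' 0)
  refine ⟨hf.of_le (by norm_num), lt_of_le_of_lt (holderNorm_le (M := fun _ => C)
    (K := ⟨C + (C + C), by positivity⟩) (fun _ => hC0) (fun j hj x => ?_) fun x y => ?_)
    ENNReal.ofReal_lt_top⟩
  · interval_cases j
    · exact h0' x
    · exact h1' x
  · refine min_le_rpow (abs_nonneg _) α.coe_nonneg (by exact_mod_cast hα) hC0 (by positivity) ?_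
      (abs_sub_le_add (h1' x) (h1' y))
    refine abs_sub_le_of_abs_deriv_le (hf.differentiable_iteratedDeriv 1 (by norm_num))
      (fun z => ?_) x y
    rw [← iteratedDeriv_succ]
    exact h2' z

/-- The real linear functional `w ↦ Im (d w)`. -/
def imMul (d : ℂ) : ℂ →L[ℝ] ℝ := Complex.imCLM.comp (d • (1 : ℂ →L[ℝ] ℂ))

theorem imMul_apply (d w : ℂ) : imMul d w = (d * w).im := by simp [imMul]

theorem imMul_sub (d e : ℂ) : imMul (d - e) = imMul d - imMul e := by
  ext w; simp [imMul_apply, sub_mul]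

theorem norm_imMul (d : ℂ) : ‖imMul d‖ = ‖d‖ := by
  refine le_antisymm (ContinuousLinearMap.opNorm_le_bound _ (norm_nonneg _) fun w => ?_) ?_
  · rw [imMul_apply, ← norm_mul]
    exact Complex.abs_im_le_norm _
  · rcases eq_or_ne d 0 with rfl | hd
    · simp
    -- The functional attains its norm at `i` times the conjugate of `d`.
    · have h1 := (imMul d).le_opNorm (Complex.I * (starRingEnd ℂ) d)
      have e : d * (Complex.I * (starRingEnd ℂ) d) = ((‖d‖ ^ 2 : ℝ) : ℂ) * Complex.I := by
        rw [← Complex.normSq_eq_norm_sq, Complex.normSq_eq_conj_mul_self]; ring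
      rw [imMul_apply, e, Complex.im_ofReal_mul, Complex.I_im, mul_one, norm_mul, Complex.norm_I,
        one_mul, Complex.norm_conj, Real.norm_of_nonneg (sq_nonneg _), sq] at h1
      exact le_of_mul_le_mul_right h1 (norm_pos_iff.2 hd)

/-- A holomorphic function whose imaginary part is `ψ + γ Y ^ 2 / 2` in the conformal variable. -/
def potential (h m γ : ℝ) (Θ Θ₂ : ℂ → ℂ) (z : ℂ) : ℂ :=
  (m / h : ℝ) * z + γ * ((h / 2 : ℝ) * (z + h * Complex.I) + h * Θ z + Θ₂ z)

/-- The derivative of the potential in the physical variable. -/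
def velocity (h m γ : ℝ) (Θ Θ₂ : ℂ → ℂ) (z : ℂ) : ℂ :=
  ((m / h : ℝ) + γ * ((h / 2 : ℝ) + h * deriv Θ z + deriv Θ₂ z)) / (1 + deriv Θ z)

section Data

variable {h : ℝ} {Θ Θ₂ : ℂ → ℂ} {v : ℝ → ℝ}

theorem IsConformalData.hasDerivAt (hP : IsConformalData h Θ Θ₂ v) {z : ℂ}
    (hz : z ∈ bigStrip h (1 / 2)) : HasDerivAt Θ (deriv Θ z) z :=
  (hP.diff.differentiableAt ((isOpen_bigStrip h _).mem_nhds hz)).hasDerivAt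

theorem IsConformalData.hasDerivAt₂ (hP : IsConformalData h Θ Θ₂ v) {z : ℂ}
    (hz : z ∈ bigStrip h (1 / 2)) : HasDerivAt Θ₂ (deriv Θ₂ z) z :=
  (hP.diff₂.differentiableAt ((isOpen_bigStrip h _).mem_nhds hz)).hasDerivAt

theorem IsConformalData.one_add_deriv_ne (hP : IsConformalData h Θ Θ₂ v) {z : ℂ}
    (hz : z ∈ bigStrip h (1 / 2)) : 1 + deriv Θ z ≠ 0 := by
  intro h0
  have h4 := hP.bound z hz
  rw [eq_neg_of_add_eq_zero_right h0, norm_neg, norm_one] at h4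
  norm_num at h4

theorem IsConformalData.hasDerivAt_potential (hP : IsConformalData h Θ Θ₂ v) (m γ : ℝ) {z : ℂ}
    (hz : z ∈ bigStrip h (1 / 2)) : HasDerivAt (potential h m γ Θ Θ₂)
      (velocity h m γ Θ Θ₂ z * (1 + deriv Θ z)) z := by
  have h1 : HasDerivAt (fun z : ℂ => z + h * Complex.I) 1 z := (hasDerivAt_id z).add_const _
  have h2 := ((h1.const_mul ((h / 2 : ℝ) : ℂ)).fun_add
    ((hP.hasDerivAt hz).const_mul (h : ℂ))).fun_add (hP.hasDerivAt₂ hz)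
  have h3 := ((hasDerivAt_id z).const_mul ((m / h : ℝ) : ℂ)).fun_add (h2.const_mul (γ : ℂ))
  refine h3.congr_deriv ?_
  rw [velocity, div_mul_cancel₀ _ (hP.one_add_deriv_ne hz)]
  ring

theorem IsConformalData.differentiableOn_velocity (hP : IsConformalData h Θ Θ₂ v) (m γ : ℝ) :
    DifferentiableOn ℂ (velocity h m γ Θ Θ₂) (bigStrip h (1 / 2)) := by
  have h1 := hP.diff.deriv (isOpen_bigStrip h _)
  have h2 := hP.diff₂.deriv (isOpen_bigStrip h _)
  exact ((((h1.const_mul (h : ℂ)).const_add ((h / 2 : ℝ) : ℂ)).fun_add h2 |>.const_mul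
    (γ : ℂ)).const_add ((m / h : ℝ) : ℂ)).fun_div (h1.const_add 1)
    fun z hz => hP.one_add_deriv_ne hz

theorem IsConformalData.periodic_velocity (hP : IsConformalData h Θ Θ₂ v) (m γ : ℝ) :
    Function.Periodic (velocity h m γ Θ Θ₂) ((2 * Real.pi : ℝ) : ℂ) := fun z => by
  have h1 : deriv Θ (z + (2 * Real.pi : ℝ)) = deriv Θ z := by
    rw [← deriv_comp_add_const, show (fun z => Θ (z + (2 * Real.pi : ℝ))) = Θ from
      funext hP.periodic]
  have h2 : deriv Θ₂ (z + (2 * Real.pi : ℝ)) = deriv Θ₂ z := by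
    obtain ⟨c, hc⟩ := hP.periodic₂
    rw [← deriv_comp_add_const, show (fun z => Θ₂ (z + (2 * Real.pi : ℝ))) = fun z => Θ₂ z + c from
      funext hc, deriv_add_const]
  rw [velocity, velocity, h1, h2]

theorem IsConformalData.velocity_bounds (hP : IsConformalData h Θ Θ₂ v) (m γ : ℝ) :
    ∃ C D : ℝ, 0 ≤ C ∧ 0 ≤ D ∧ (∀ z ∈ closedStrip h, ‖velocity h m γ Θ Θ₂ z‖ ≤ C) ∧
      ∀ z ∈ closedStrip h, ∀ w ∈ closedStrip h,
        ‖velocity h m γ Θ Θ₂ z - velocity h m γ Θ Θ₂ w‖ ≤ D * ‖z - w‖ := by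
  have hsub := closedStrip_subset_bigStrip (ρ := 1 / 2) hP.depth_pos (by norm_num)
  have h1 := hP.differentiableOn_velocity m γ
  have h2 := h1.deriv (isOpen_bigStrip h _)
  have hper := hP.periodic_velocity m γ
  have hper' : Function.Periodic (deriv (velocity h m γ Θ Θ₂)) ((2 * Real.pi : ℝ) : ℂ) :=
    fun z => by
    rw [← deriv_comp_add_const, show (fun z => velocity h m γ Θ Θ₂ (z + (2 * Real.pi : ℝ))) =
      velocity h m γ Θ Θ₂ from funext hper]
  obtain ⟨C, hC⟩ := exists_bound_of_periodic (h1.continuousOn.mono hsub) hper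
  obtain ⟨D, hD⟩ := exists_bound_of_periodic (h2.continuousOn.mono hsub) hper'
  have h0 : (0 : ℂ) ∈ closedStrip h := ⟨by simpa using hP.depth_pos.le, by simp⟩
  refine ⟨C, D, (norm_nonneg _).trans (hC 0 h0), (norm_nonneg _).trans (hD 0 h0), hC,
    fun z hz w hw => ?_⟩
  exact (convex_closedStrip h).norm_image_sub_le_of_norm_deriv_le
    (fun x hx => h1.differentiableAt ((isOpen_bigStrip h _).mem_nhds (hsub hx))) hD hw hz

theorem IsConformalData.im_confMap_bound (hP : IsConformalData h Θ Θ₂ v) :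
    ∃ C, 0 ≤ C ∧ (∀ z ∈ closedStrip h, ‖Θ z‖ ≤ C) ∧
      ∀ z ∈ closedStrip h, |(confMap h Θ z).im| ≤ C := by
  have hsub := closedStrip_subset_bigStrip (ρ := 1 / 2) hP.depth_pos (by norm_num)
  obtain ⟨C, hC⟩ := exists_bound_of_periodic (hP.diff.continuousOn.mono hsub) hP.periodic
  have h0 : (0 : ℂ) ∈ closedStrip h := ⟨by simpa using hP.depth_pos.le, by simp⟩
  have hC0 := (norm_nonneg _).trans (hC 0 h0)
  have hh := hP.depth_pos
  refine ⟨h + C, by linarith, fun z hz => by linarith [hC z hz], fun z hz => ?_⟩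
  have e : (confMap h Θ z).im = (z.im + h) + (Θ z).im := by simp [confMap]; ring
  rw [e]
  refine abs_add_le_add ?_ ((Complex.abs_im_le_norm _).trans (hC z hz))
  rw [abs_of_nonneg (by linarith [hz.1])]
  linarith [hz.2]

/-- The inverse map is `2`-Lipschitz; this gives injectivity and carries Hölder bounds from the
strip to the fluid domain. -/
theorem IsConformalData.norm_sub_le_confMap (hP : IsConformalData h Θ Θ₂ v) {z w : ℂ}
    (hz : z ∈ bigStrip h (1 / 2)) (hw : w ∈ bigStrip h (1 / 2)) :
    ‖z - w‖ ≤ 2 * ‖confMap h Θ z - confMap h Θ w‖ := by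
  have h1 := hP.norm_sub_le hz hw
  have e : z - w = (confMap h Θ z - confMap h Θ w) - (Θ z - Θ w) := by
    simp only [confMap]; ring
  have h2 := _root_.norm_sub_le (confMap h Θ z - confMap h Θ w) (Θ z - Θ w)
  rw [← e] at h2
  linarith

theorem IsConformalData.hasDerivAt_confMap (hP : IsConformalData h Θ Θ₂ v) {z : ℂ}
    (hz : z ∈ bigStrip h (1 / 2)) : HasDerivAt (confMap h Θ) (1 + deriv Θ z) z :=
  (hasDerivAt_id z).fun_add ((hP.hasDerivAt hz).const_add (h * Complex.I))

/-- A derivative within the closed fluid domain is unique because the domain is the image of a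
convex set with interior under a map with invertible derivative. `fderivWithin` can then be computed
from the holomorphic extension. -/
theorem IsConformalData.uniqueDiffOn_image (hP : IsConformalData h Θ Θ₂ v) :
    UniqueDiffOn ℝ (confMap h Θ '' closedStrip h) := by
  have hh := hP.depth_pos
  rintro _ ⟨z, hz, rfl⟩
  have hzb := closedStrip_subset_bigStrip (ρ := 1 / 2) hh (by norm_num) hz
  have h1 := (hP.hasDerivAt_confMap hzb).complexToReal_fderiv.hasFDerivWithinAt (s := closedStrip h)
  have hint : (interior (closedStrip h)).Nonempty := by
    refine ⟨⟨0, -h / 2⟩, interior_maximal (strip_subset_closedStrip h) (isOpen_strip h) ?_⟩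
    constructor <;> simp only <;> linarith
  refine h1.uniqueDiffWithinAt (uniqueDiffOn_convex (convex_closedStrip h) hint z hz) ?_
  refine Function.Surjective.denseRange fun w => ⟨w / (1 + deriv Θ z), ?_⟩
  simp only [smul_apply, one_apply_eq_self, smul_eq_mul]
  exact mul_div_cancel₀ _ (hP.one_add_deriv_ne hzb)

theorem contDiff_half_sq_im (γ : ℝ) : ContDiff ℝ 2 fun z : ℂ => γ / 2 * z.im ^ 2 :=
  contDiff_const.mul (contDiff_im.pow 2)

theorem laplacian_half_sq_im (γ : ℝ) (z : ℂ) :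
    Laplacian.laplacian ((fun z => γ / 2 * z.im ^ 2) : ℂ → ℝ) z = γ := by
  rw [laplacian_eq_lines (contDiff_half_sq_im γ).contDiffAt]
  have h1 : (fun t : ℝ => γ / 2 * (z + t • (1 : ℂ)).im ^ 2) = fun _ => γ / 2 * z.im ^ 2 := by
    ext t; simp
  have h2 : (fun t : ℝ => γ / 2 * (z + t • Complex.I).im ^ 2) =
      fun t => γ / 2 * (z.im + t) ^ 2 := by
    ext t; simp
  have h3 : deriv (fun t : ℝ => γ / 2 * (z.im + t) ^ 2) = fun t => γ * (z.im + t) := by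
    ext t
    have := ((((hasDerivAt_id t).const_add z.im).fun_pow 2).const_mul (γ / 2))
    simp only [id] at this
    rw [this.deriv]; push_cast; ring
  rw [h1, h2, h3]
  have h4 : HasDerivAt (fun t : ℝ => γ * (z.im + t)) (γ * 1) 0 :=
    ((hasDerivAt_id (0 : ℝ)).const_add z.im).const_mul γ
  rw [h4.deriv]
  simp

/-- Composing the potential with the inverse conformal map gives a holomorphic `p` near the closed
domain, and `ψ = Im p - γY²/2`. The first term is harmonic and the second has Laplacian `-γ`. The
gradient is the functional `imMul` of `p' - γY`, of the same norm. -/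
theorem IsConformalData.exists_stream (hP : IsConformalData h Θ Θ₂ v) (m γ : ℝ) {α : ℝ≥0}
    (hα : α ≤ 1) : ∃ ψ : ℂ → ℝ,
      IsC1Holder α (confMap h Θ '' closedStrip h) ψ ∧ ContDiffOn ℝ 2 ψ (confMap h Θ '' strip h) ∧
      (∀ z ∈ confMap h Θ '' strip h, Laplacian.laplacian ψ z = -γ) ∧
      (∀ z ∈ closedStrip h, ψ (confMap h Θ z) =
        (potential h m γ Θ Θ₂ z).im - γ / 2 * (confMap h Θ z).im ^ 2) ∧
      ∀ z ∈ closedStrip h, ‖fderivWithin ℝ ψ (confMap h Θ '' closedStrip h) (confMap h Θ z)‖ =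
        ‖velocity h m γ Θ Θ₂ z - (γ * (confMap h Θ z).im : ℝ)‖ := by
  obtain ⟨S, N, M, hN, hM, hcN, hNb, hMN, hS, hS'⟩ := hP.exists_inverse
  have hsub := hcN.trans hNb
  set p : ℂ → ℂ := fun ζ => potential h m γ Θ Θ₂ (S ζ) with hp
  set ψ : ℂ → ℝ := fun ζ => (p ζ).im - γ / 2 * ζ.im ^ 2 with hψ
  have hpd : ∀ z ∈ N, HasDerivAt p (velocity h m γ Θ Θ₂ z) (confMap h Θ z) := fun z hz => by
    have h1 := hP.hasDerivAt_potential m γ (hNb hz)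
    rw [← hS z hz] at h1
    have h2 := h1.comp (confMap h Θ z) (hS' z hz)
    rw [hS z hz, mul_assoc, mul_inv_cancel₀ (hP.one_add_deriv_ne (hNb hz)), mul_one] at h2
    exact h2
  have hψd : ∀ z ∈ N, HasFDerivAt ψ
      (imMul (velocity h m γ Θ Θ₂ z - (γ * (confMap h Θ z).im : ℝ))) (confMap h Θ z) :=
    fun z hz => by
    have h1 := Complex.imCLM.hasFDerivAt.comp (confMap h Θ z) (hpd z hz).complexToReal_fderiv
    have h2 : HasFDerivAt (fun ζ : ℂ => γ / 2 * ζ.im ^ 2)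
        ((γ / 2) • ((2 * (confMap h Θ z).im ^ (2 - 1)) • Complex.imCLM)) (confMap h Θ z) := by
      have h3 := (Complex.imCLM.hasFDerivAt (x := confMap h Θ z)).pow 2
      have h4 := h3.const_mul (γ / 2)
      simpa using h4
    refine (h1.fun_sub h2).congr_fderiv ?_
    ext w
    simp [imMul_apply, sub_mul]
    ring
  have hMa : ∀ ζ ∈ M, AnalyticAt ℂ p ζ := by
    refine DifferentiableOn.analyticOnNhd ?_ hM
    intro ζ hζ
    rw [hMN] at hζ
    obtain ⟨z, hz, rfl⟩ := hζ
    exact (hpd z hz).differentiableAt.differentiableWithinAt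
  have hsM : confMap h Θ '' strip h ⊆ M := by
    rw [hMN]; exact image_mono ((strip_subset_closedStrip h).trans hcN)
  have hψc : ∀ ζ ∈ M, ContDiffAt ℝ 2 (fun ζ => (p ζ).im) ζ := fun ζ hζ =>
    contDiff_im.contDiffAt.comp ζ ((hMa ζ hζ).contDiffAt.restrict_scalars ℝ)
  have hfw : ∀ z ∈ closedStrip h, fderivWithin ℝ ψ (confMap h Θ '' closedStrip h) (confMap h Θ z) =
      imMul (velocity h m γ Θ Θ₂ z - (γ * (confMap h Θ z).im : ℝ)) := fun z hz =>
    (hψd z (hcN hz)).hasFDerivWithinAt.fderivWithin (hP.uniqueDiffOn_image _ (mem_image_of_mem _ hz))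
  have hval : ∀ z ∈ closedStrip h, ψ (confMap h Θ z) =
      (potential h m γ Θ Θ₂ z).im - γ / 2 * (confMap h Θ z).im ^ 2 := fun z hz => by
    simp only [hψ, hp, hS z (hcN hz)]
  refine ⟨ψ, ⟨?_, ?_, ?_⟩, ?_, ?_, hval, fun z hz => by rw [hfw z hz, norm_imMul]⟩
  · rintro _ ⟨z, hz, rfl⟩
    exact (hψd z (hcN hz)).differentiableAt.differentiableWithinAt
  · obtain ⟨C, D, hC0, hD0, hC, hD⟩ := hP.velocity_bounds m γ
    obtain ⟨B, hB0, -, hB⟩ := hP.im_confMap_bound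
    have hcont : ContinuousOn (fun z => ψ (confMap h Θ z)) (closedStrip h) := fun z hz => by
      have h1 := (hψd z (hcN hz)).continuousAt
      have h2 := (hP.hasDerivAt_confMap (hsub hz)).continuousAt
      exact (ContinuousAt.comp (g := ψ) h1 h2).continuousWithinAt
    have hcont2 : ContinuousOn (fun z => (potential h m γ Θ Θ₂ z).im) (closedStrip h) :=
      fun z hz => (Complex.continuous_im.continuousAt.comp
        (hP.hasDerivAt_potential m γ (hsub hz)).continuousAt).continuousWithinAt
    have hper : Function.Periodic (fun z => (potential h m γ Θ Θ₂ z).im)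
        ((2 * Real.pi : ℝ) : ℂ) := fun z => by
      obtain ⟨c, hc⟩ := hP.periodic₂
      have e : potential h m γ Θ Θ₂ (z + (2 * Real.pi : ℝ)) = potential h m γ Θ Θ₂ z +
          ((m / h * (2 * Real.pi) + γ * (h / 2 * (2 * Real.pi) + c) : ℝ) : ℂ) := by
        simp only [potential, hc, hP.periodic z]
        push_cast
        ring
      simp only [e, Complex.add_im, Complex.ofReal_im, add_zero]
    obtain ⟨E, hE⟩ := exists_bound_of_periodic hcont2 hper
    refine ⟨max (E + |γ / 2| * B ^ 2) (C + |γ| * B), ?_⟩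
    rintro _ ⟨z, hz, rfl⟩
    refine ⟨le_max_of_le_left ?_, le_max_of_le_right ?_⟩
    · rw [hval z hz]
      refine abs_sub_le_add (hE z hz) (abs_mul_le_mul le_rfl ?_)
      rw [abs_pow]
      exact pow_le_pow_left₀ (abs_nonneg _) (hB z hz) 2
    · rw [hfw z hz, norm_imMul]
      refine (_root_.norm_sub_le _ _).trans (add_le_add (hC z hz) ?_)
      rw [Complex.norm_real, Real.norm_eq_abs]
      exact abs_mul_le_mul le_rfl (hB z hz)
  · obtain ⟨C, D, hC0, hD0, hC, hD⟩ := hP.velocity_bounds m γ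
    obtain ⟨B, hB0, -, hB⟩ := hP.im_confMap_bound
    refine ⟨⟨2 * D + |γ| + (2 * C + |γ| * (2 * B)), by positivity⟩, holderOnWith_of_bound ?_⟩
    rintro _ ⟨z, hz, rfl⟩ _ ⟨w, hw, rfl⟩
    rw [hfw z hz, hfw w hw, dist_eq_norm, dist_eq_norm, ← imMul_sub, norm_imMul]
    have e : velocity h m γ Θ Θ₂ z - (γ * (confMap h Θ z).im : ℝ) -
        (velocity h m γ Θ Θ₂ w - (γ * (confMap h Θ w).im : ℝ)) =
        (velocity h m γ Θ Θ₂ z - velocity h m γ Θ Θ₂ w) -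
          (γ * ((confMap h Θ z).im - (confMap h Θ w).im) : ℝ) := by push_cast; ring
    rw [e]
    refine min_le_rpow (norm_nonneg _) α.coe_nonneg (by exact_mod_cast hα) (by positivity)
      (by positivity) ?_ ?_
    · refine (_root_.norm_sub_le _ _).trans ?_
      rw [Complex.norm_real, Real.norm_eq_abs, add_mul]
      refine add_le_add ?_ ?_
      · refine (hD z hz w hw).trans ?_
        have := mul_le_mul_of_nonneg_left (hP.norm_sub_le_confMap (hsub hz) (hsub hw)) hD0
        linarith
      · rw [← Complex.sub_im]
        exact abs_mul_le_mul le_rfl (Complex.abs_im_le_norm _)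
    · refine (_root_.norm_sub_le _ _).trans (add_le_add ?_ ?_)
      · refine (_root_.norm_sub_le _ _).trans ?_
        linarith [hC z hz, hC w hw]
      · rw [Complex.norm_real, Real.norm_eq_abs]
        refine abs_mul_le_mul le_rfl ?_
        have := abs_sub_le_add (hB z hz) (hB w hw)
        linarith
  · exact fun ζ hζ => ((hψc ζ (hsM hζ)).sub (contDiff_half_sq_im γ).contDiffAt).contDiffWithinAt
  · intro ζ hζ
    have h1 := (hψc ζ (hsM hζ)).laplacian_sub (contDiff_half_sq_im γ).contDiffAt
    rw [laplacian_half_sq_im] at h1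
    have h2 : Laplacian.laplacian ((fun ζ => (p ζ).im) : ℂ → ℝ) ζ = 0 :=
      (hMa ζ (hsM hζ)).harmonicAt_im.2.eq_of_nhds
    rw [h2, zero_sub] at h1
    exact h1

end Data

/-! ### Solutions of the free-boundary problem -/

section Data

variable {h : ℝ} {Θ Θ₂ : ℂ → ℂ} {v : ℝ → ℝ}

theorem IsConformalData.top_mem (hP : IsConformalData h Θ Θ₂ v) (x : ℝ) :
    (⟨x, 0⟩ : ℂ) ∈ closedStrip h := ⟨by simpa using hP.depth_pos.le, le_rfl⟩

theorem IsConformalData.bottom_mem (hP : IsConformalData h Θ Θ₂ v) (x : ℝ) :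
    (⟨x, -h⟩ : ℂ) ∈ closedStrip h := ⟨le_rfl, by simpa using hP.depth_pos.le⟩

theorem IsConformalData.closedStrip_subset (hP : IsConformalData h Θ Θ₂ v) :
    closedStrip h ⊆ bigStrip h (1 / 2) :=
  closedStrip_subset_bigStrip hP.depth_pos (by norm_num)

theorem IsConformalData.contDiff_line (hP : IsConformalData h Θ Θ₂ v) :
    ContDiff ℝ 2 fun x : ℝ => Θ ⟨x, 0⟩ := by
  rw [contDiff_iff_contDiffAt]
  intro x
  have h1 : ContDiffAt ℂ 2 Θ (x : ℂ) := (hP.diff.analyticOnNhd (isOpen_bigStrip h _) _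
    (hP.closedStrip_subset (hP.top_mem x))).contDiffAt
  exact (h1.restrict_scalars ℝ).comp x Complex.ofRealCLM.contDiff.contDiffAt

theorem IsConformalData.contDiff_elevation (hP : IsConformalData h Θ Θ₂ v) : ContDiff ℝ 2 v := by
  rw [show v = fun x => (Θ ⟨x, 0⟩).im from funext fun x => (hP.top x).symm]
  exact Complex.imCLM.contDiff.comp hP.contDiff_line

theorem IsConformalData.hasDerivAt_line (hP : IsConformalData h Θ Θ₂ v) (x : ℝ) :
    HasDerivAt (fun x : ℝ => Θ ⟨x, 0⟩) (deriv Θ x) x :=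
  (hP.hasDerivAt (hP.closedStrip_subset (hP.top_mem x))).comp_ofReal

theorem IsConformalData.hasDerivAt_elevation (hP : IsConformalData h Θ Θ₂ v) (x : ℝ) :
    HasDerivAt v (deriv Θ x).im x := by
  rw [show v = fun x => (Θ ⟨x, 0⟩).im from funext fun x => (hP.top x).symm]
  exact Complex.imCLM.hasFDerivAt.comp_hasDerivAt x (hP.hasDerivAt_line x)

theorem IsConformalData.im_deriv₂ (hP : IsConformalData h Θ Θ₂ v) (x : ℝ) :
    (deriv Θ₂ x).im = v x * (deriv Θ x).im := by
  have h1 : HasDerivAt (fun x : ℝ => Θ₂ ⟨x, 0⟩) (deriv Θ₂ x) x :=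
    (hP.hasDerivAt₂ (hP.closedStrip_subset (hP.top_mem x))).comp_ofReal
  have h2 : HasDerivAt (fun x => v x ^ 2 / 2) (deriv Θ₂ x).im x := by
    rw [show (fun x => v x ^ 2 / 2) = fun x => (Θ₂ ⟨x, 0⟩).im from
      funext fun x => (hP.top₂ x).symm]
    exact Complex.imCLM.hasFDerivAt.comp_hasDerivAt x h1
  rw [h2.unique (((hP.hasDerivAt_elevation x).fun_pow 2).div_const 2)]
  push_cast
  ring

/-- After multiplication by `1 + Θ'` the quantity becomes real on the top: `im_deriv₂` makes the
imaginary parts cancel, and the real part is the bracket in (*). Dividing by `|1 + Θ'|²` gives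
Bernoulli's law. -/
theorem IsConformalData.norm_velocity_sq (hP : IsConformalData h Θ Θ₂ v) {g γ m lam μ : ℝ}
    (hlam : lam = m / h - γ * h / 2) (hB : ∀ x : ℝ,
      (lam + γ * ((deriv Θ₂ x).re - v x - v x * (deriv Θ x).re)) ^ 2 =
        (lam ^ 2 + μ - 2 * g * v x) * ‖1 + deriv Θ x‖ ^ 2) (x : ℝ) :
    ‖velocity h m γ Θ Θ₂ x - (γ * (h + v x) : ℝ)‖ ^ 2 = lam ^ 2 + μ - 2 * g * v x := by
  have hne : 1 + deriv Θ x ≠ 0 :=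
    hP.one_add_deriv_ne (hP.closedStrip_subset (hP.top_mem x))
  have e : (velocity h m γ Θ Θ₂ x - (γ * (h + v x) : ℝ)) * (1 + deriv Θ x) =
      ((lam + γ * ((deriv Θ₂ x).re - v x - v x * (deriv Θ x).re) : ℝ) : ℂ) := by
    rw [sub_mul, velocity, div_mul_cancel₀ _ hne]
    apply Complex.ext
    · simp [hlam]; ring
    · simp [hP.im_deriv₂ x]; ring
  have h1 := congrArg (fun z => ‖z‖ ^ 2) e
  simp only [norm_mul, mul_pow, Complex.norm_real, Real.norm_eq_abs, sq_abs] at h1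
  rw [hB x] at h1
  exact mul_right_cancel₀ (pow_ne_zero 2 (norm_ne_zero_iff.2 hne)) h1

theorem IsConformalData.exists_freeBoundary (hP : IsConformalData h Θ Θ₂ v) {α : ℝ≥0} (hα : α ≤ 1)
    {g γ m Q lam μ : ℝ} (hlam : lam = m / h - γ * h / 2) (hμ : μ = Q - 2 * g * h - lam ^ 2)
    (hB : ∀ x : ℝ, (lam + γ * ((deriv Θ₂ x).re - v x - v x * (deriv Θ x).re)) ^ 2 =
      (lam ^ 2 + μ - 2 * g * v x) * ‖1 + deriv Θ x‖ ^ 2) :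
    ∃ (η : ℝ → ℝ) (ψ : ℂ → ℝ), SolvesFreeBoundary g γ m Q α η ψ ∧ IsConformalElevation h v η ∧
      Function.Periodic η (2 * Real.pi) ∧ (∀ x : ℝ, η (x + (Θ ⟨x, 0⟩).re) = h + v x) ∧
      ∀ X : ℝ, ∃ x : ℝ, x + (Θ ⟨x, 0⟩).re = X := by
  have hh := hP.depth_pos
  obtain ⟨U, hU, hdom, hcl⟩ := hP.exists_graph
  obtain ⟨B, hBl⟩ := hP.exists_lineHomeo (y := -h) ⟨by linarith, by linarith⟩
  obtain ⟨ψ, hψ, hψ2, hlap, hval, hgrad⟩ := hP.exists_stream m γ hα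
  set η : ℝ → ℝ := fun X => h + v (U.symm X) with hη
  have htop : ∀ x : ℝ, confMap h Θ ⟨x, 0⟩ = ⟨U x, h + v x⟩ := fun x => by
    rw [hU, ← hP.top, confMap]
    apply Complex.ext <;> simp
  have hbot : ∀ x : ℝ, confMap h Θ ⟨x, -h⟩ = ⟨B x, 0⟩ := fun x => by
    rw [hBl, confMap]
    apply Complex.ext <;> simp [hP.bottom]
  have hηU : ∀ x, η (U x) = h + v x := fun x => by simp only [hη, U.symm_apply_apply]
  have hUc : ContDiff ℝ 2 U := by
    rw [show (U : ℝ → ℝ) = fun x => x + (Θ ⟨x, 0⟩).re from funext hU]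
    exact contDiff_id.add (Complex.reCLM.contDiff.comp hP.contDiff_line)
  have hUd : ∀ x : ℝ, HasDerivAt U (1 + (deriv Θ x).re) x := fun x => by
    rw [show (U : ℝ → ℝ) = fun x => x + (Θ ⟨x, 0⟩).re from funext hU]
    exact (hasDerivAt_id x).fun_add
      (Complex.reCLM.hasFDerivAt.comp_hasDerivAt x (hP.hasDerivAt_line x))
  have hUne : ∀ x : ℝ, 1 + (deriv Θ x).re ≠ 0 := fun x => by
    have h1 := (Complex.abs_re_le_norm _).trans
      (hP.bound x (hP.closedStrip_subset (hP.top_mem x)))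
    have h2 := (abs_le.1 h1).1
    linarith
  have hUs : ContDiff ℝ 2 U.symm := U.contDiff_symm_deriv hUne hUd hUc
  have hΘp : ∀ x : ℝ, Θ ⟨x + 2 * Real.pi, 0⟩ = Θ ⟨x, 0⟩ := fun x => by
    rw [← hP.periodic ⟨x, 0⟩]
    congr 1
    apply Complex.ext <;> simp
  have hvp : ∀ x, v (x + 2 * Real.pi) = v x := fun x => by rw [← hP.top, ← hP.top, hΘp]
  have hUp : ∀ x, U (x + 2 * Real.pi) = U x + 2 * Real.pi := fun x => by
    rw [hU, hU, hΘp]; ring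
  have hηp : Function.Periodic η (2 * Real.pi) := fun X => by
    obtain ⟨x, rfl⟩ := U.surjective X
    rw [← hUp, hηU, hηU, hvp]
  have hηc : ContDiff ℝ 2 η := contDiff_const.add (hP.contDiff_elevation.comp hUs)
  refine ⟨η, ψ, ⟨isHolder_of_periodic (by positivity) hηp hηc hα, fun X => hP.pos _, by rwa [hcl],
    by rwa [hdom], by rwa [hdom], fun X => ?_, fun X => ?_, fun X => ?_⟩,
    ⟨confMap h Θ, ?_, ?_, ?_, ?_, ?_, ?_⟩, hηp, ?_, ?_⟩
  · obtain ⟨x, rfl⟩ := B.surjective X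
    rw [← hbot, hval _ (hP.bottom_mem x), hbot, potential]
    simp [hP.bottom, hP.bottom₂]
    field_simp
  · obtain ⟨x, rfl⟩ := U.surjective X
    rw [hηU, ← htop, hval _ (hP.top_mem x), htop, potential]
    simp [hP.top, hP.top₂]
    ring
  · obtain ⟨x, rfl⟩ := U.surjective X
    rw [hcl, hηU, ← htop, hgrad _ (hP.top_mem x), htop]
    have h1 := hP.norm_velocity_sq hlam hB x
    rw [show ((⟨x, 0⟩ : ℂ)) = (x : ℂ) from rfl, h1, hμ]
    ring
  · exact fun z hz => (hP.hasDerivAt_confMap (hP.closedStrip_subset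
      (strip_subset_closedStrip h hz))).differentiableAt.differentiableWithinAt
  · exact fun z hz => (hP.hasDerivAt_confMap
      (hP.closedStrip_subset hz)).continuousAt.continuousWithinAt
  · rw [hdom]
    refine InjOn.bijOn_image fun z hz w hw hzw => ?_
    have h1 := hP.norm_sub_le_confMap (hP.closedStrip_subset (strip_subset_closedStrip h hz))
      (hP.closedStrip_subset (strip_subset_closedStrip h hw))
    rw [hzw, sub_self, norm_zero, mul_zero] at h1
    exact sub_eq_zero.1 (norm_le_zero_iff.1 h1)
  · obtain ⟨C, -, hC, -⟩ := hP.im_confMap_bound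
    refine ⟨h + C, fun z hz => ?_⟩
    rw [confMap, add_sub_cancel_left]
    refine (norm_add_le _ _).trans (add_le_add ?_ (hC z hz))
    simp [abs_of_pos hh]
  · exact fun x => by rw [hbot]
  · exact fun x => by rw [htop]; exact ⟨rfl, hηU x⟩
  · exact fun x => by rw [← hU, hηU]
  · intro X
    obtain ⟨x, rfl⟩ := U.surjective X
    exact ⟨x, (hU x).symm⟩

end Data

/-! ### Conformal data of a wave -/

theorem HasDN.unique {h : ℝ} (hh : 0 < h) {f u v : ℝ → ℝ} (hu : HasDN h f u) (hv : HasDN h f v)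
    (x : ℝ) : u x = v x := by
  obtain ⟨W₁, h1, h1'⟩ := hu
  obtain ⟨W₂, h2, h2'⟩ := hv
  refine (uniqueDiffWithinAt_Iic (0 : ℝ)).eq_deriv (𝕜 := ℝ) _ (h1' x)
    ((h2' x).congr_of_eventuallyEq ?_ ?_)
  · filter_upwards [inter_mem_nhdsWithin (Iic (0 : ℝ)) (Ioi_mem_nhds (show -h < 0 by linarith))]
      with y hy
    exact h1.unique hh h2 _ ⟨le_of_lt hy.2, hy.1⟩
  · exact h1.unique hh h2 _ ⟨by simpa using hh.le, le_rfl⟩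

theorem stripMode_add_two_pi (h : ℝ) (k : ℕ) (z : ℂ) :
    stripMode h k (z + (2 * Real.pi : ℝ)) = stripMode h k z := by
  rw [stripMode, stripMode, ← Complex.sin_add_nat_mul_two_pi (k * (z + h * Complex.I)) k]
  congr 2
  push_cast
  ring

theorem stripHol_add_two_pi (h : ℝ) (c : ℕ → ℝ) (z : ℂ) :
    stripHol h c (z + (2 * Real.pi : ℝ)) = stripHol h c z + (c 0 * (2 * Real.pi) / h : ℝ) := by
  simp only [stripHol, stripMode_add_two_pi]
  push_cast
  ring

/-- Reflection in the imaginary axis: real coefficients make the horizontal displacement odd, so an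
even elevation in the conformal variable gives an even surface. -/
theorem stripMode_neg_conj (h : ℝ) (k : ℕ) (z : ℂ) :
    stripMode h k (-(starRingEnd ℂ) z) = -(starRingEnd ℂ) (stripMode h k z) := by
  have e : (k : ℂ) * (-(starRingEnd ℂ) z + h * Complex.I) =
      -(starRingEnd ℂ) (k * (z + h * Complex.I)) := by
    simp only [map_mul, map_add, Complex.conj_I, Complex.conj_ofReal, map_natCast]
    ring
  rw [stripMode, stripMode, e, Complex.sin_neg, Complex.sin_conj, map_div₀, Complex.conj_ofReal,
    neg_div]

theorem stripHol_neg_conj (h : ℝ) (c : ℕ → ℝ) (z : ℂ) :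
    stripHol h c (-(starRingEnd ℂ) z) = -(starRingEnd ℂ) (stripHol h c z) := by
  simp only [stripHol, stripMode_neg_conj, mul_neg, tsum_neg, map_add, map_mul, map_div₀,
    Complex.conj_ofReal, Complex.conj_I, Complex.conj_tsum]
  ring

theorem re_stripHol_neg (h : ℝ) (c : ℕ → ℝ) (x : ℝ) :
    (stripHol h c ⟨-x, 0⟩).re = -(stripHol h c ⟨x, 0⟩).re := by
  have e : (⟨-x, 0⟩ : ℂ) = -(starRingEnd ℂ) ⟨x, 0⟩ := by apply Complex.ext <;> simp
  rw [e, stripHol_neg_conj]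
  simp

theorem cosSeries_neg (c : ℕ → ℝ) (x : ℝ) : cosSeries c (-x) = cosSeries c x := by
  simp only [cosSeries, mul_neg, Real.cos_neg]

theorem cosSeries_periodic (c : ℕ → ℝ) : Function.Periodic (cosSeries c) (2 * Real.pi) :=
  fun x => by
  simp only [cosSeries, mul_add, Real.cos_add_nat_mul_two_pi]

theorem isConformalData_stripHol {h : ℝ} (hh : 0 < h) {c e : ℕ → ℝ}
    (hc : Summable fun k => |c k| * Real.exp (k * (1 / 2 : ℝ))) (hc0 : c 0 = 0)
    (he : Summable fun k => |e k| * Real.exp (k * (1 / 2 : ℝ)))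
    (hce : ∀ x, cosSeries e x = cosSeries c x ^ 2 / 2)
    (hb : ∀ z ∈ bigStrip h (1 / 2), ‖deriv (stripHol h c) z‖ ≤ 1 / 2)
    (hpos : ∀ x, 0 < h + cosSeries c x) :
    IsConformalData h (stripHol h c) (stripHol h e) (cosSeries c) :=
  have h1 := isStripExtension_stripHol hh (summable_of_summable_exp (by norm_num) hc)
  have h2 := isStripExtension_stripHol hh (summable_of_summable_exp (by norm_num) he)
  { depth_pos := hh
    diff := differentiableOn_stripHol hh hc
    diff₂ := differentiableOn_stripHol hh he
    bound := hb
    periodic := fun z => by rw [stripHol_add_two_pi, hc0]; simp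
    periodic₂ := ⟨_, stripHol_add_two_pi h e⟩
    bottom := h1.bottom
    bottom₂ := h2.bottom
    top := h1.top
    top₂ := fun x => (h2.top x).trans (hce x)
    pos := hpos }

theorem IsConformalData.comp_add_const {h : ℝ} {Θ Θ₂ : ℂ → ℂ} {v : ℝ → ℝ}
    (hP : IsConformalData h Θ Θ₂ v) (a : ℝ) :
    IsConformalData h (fun z => Θ (z + a)) (fun z => Θ₂ (z + a)) fun x => v (x + a) := by
  have hmem : ∀ z, z ∈ bigStrip h (1 / 2) → z + a ∈ bigStrip h (1 / 2) := fun z hz => by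
    simpa [bigStrip] using hz
  have hadd : ∀ x y : ℝ, (⟨x, y⟩ : ℂ) + a = ⟨x + a, y⟩ := fun x y => by
    apply Complex.ext <;> simp
  have hd : Differentiable ℂ fun z : ℂ => z + a := differentiable_id.add_const _
  refine ⟨hP.depth_pos, hP.diff.comp hd.differentiableOn hmem,
    hP.diff₂.comp hd.differentiableOn hmem, fun z hz => ?_, fun z => ?_, ?_, fun x => ?_,
    fun x => ?_, fun x => ?_, fun x => ?_, fun x => hP.pos _⟩
  · rw [deriv_comp_add_const]
    exact hP.bound _ (hmem z hz)
  · simp only [add_right_comm z _ (a : ℂ)]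
    exact hP.periodic _
  · obtain ⟨c, hc⟩ := hP.periodic₂
    exact ⟨c, fun z => by rw [add_right_comm, hc]⟩
  · rw [hadd]; exact hP.bottom _
  · rw [hadd]; exact hP.bottom₂ _
  · rw [hadd]; exact hP.top _
  · rw [hadd]; exact hP.top₂ _

theorem exists_waveCoeff_half_sq (b : L1) :
    ∃ e : ℕ → ℝ, (Summable fun k => |e k| * Real.exp (k * (1 / 2 : ℝ))) ∧
      ∀ x, cosSeries e x = wave b x ^ 2 / 2 := by
  refine ⟨_, summable_weighted ((1 / 2 : ℝ) • cosMul isWeight_wbase (opJ b) (opJ b)), fun x => ?_⟩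
  rw [← evalCos_eq_cosSeries isWeight_wbase, map_smul, evalCos_cosMul, ← wave_eq_evalCos,
    smul_eq_mul]
  ring

theorem waveCoeff_mul_le (b : L1) (k : ℕ) :
    |waveCoeff b k| * (k * Real.exp (k * (1 / 2 : ℝ))) ≤ |cf b k| := by
  rcases eq_or_ne k 0 with rfl | hk
  · simp
  · have hk' : (0 : ℝ) < k := by exact_mod_cast Nat.pos_of_ne_zero hk
    have h1 := wbase_pow_mul_exp_le k
    rw [waveCoeff, cf_opJ, abs_mul, abs_mul, abs_of_pos (inv_pos.2 hk'),
      abs_of_nonneg (pow_nonneg isWeight_wbase.1 k)]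
    have e : (k : ℝ)⁻¹ * |cf b k| * wbase ^ k * (k * Real.exp (k * (1 / 2 : ℝ))) =
        |cf b k| * (wbase ^ k * Real.exp (k * (1 / 2 : ℝ))) := by field_simp
    rw [e]
    exact mul_le_of_le_one_right (abs_nonneg _) h1

/-- Turns smallness in `ℓ¹` into the bound `1/2` on `Θ'` required of conformal data. -/
theorem norm_deriv_stripHol_wave_le {h : ℝ} (hh : 0 < h) {b : L1}
    (hb : ‖b‖ ≤ 1 / (2 * modeConst h)) (hb0 : waveCoeff b 0 = 0) {z : ℂ}
    (hz : z ∈ bigStrip h (1 / 2)) : ‖deriv (stripHol h (waveCoeff b)) z‖ ≤ 1 / 2 := by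
  have h1 : Summable fun k => |waveCoeff b k| * (k * Real.exp (k * (1 / 2 : ℝ))) :=
    (summable_abs_cf b).of_nonneg_of_le (fun k => by positivity) (waveCoeff_mul_le b)
  have h2 : ∑' k, |waveCoeff b k| * (k * Real.exp (k * (1 / 2 : ℝ))) ≤ ‖b‖ := by
    rw [L1.norm_eq]
    exact h1.tsum_le_tsum (waveCoeff_mul_le b) (summable_abs_cf b)
  have h3 := modeConst_pos hh
  refine (norm_deriv_stripHol_le hh h1 hz).trans ?_
  rw [hb0, abs_zero, zero_div, zero_add]
  calc _ ≤ modeConst h * (1 / (2 * modeConst h)) := by gcongr; exact h2.trans hb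
    _ = 1 / 2 := by field_simp

/-- Bernoulli's law for the conformal data of a solution. -/
theorem SolvesEq.bernoulli {g γ h lam μ : ℝ} (hh : 0 < h) {c e : ℕ → ℝ}
    (hc : Summable fun k => |c k| * Real.exp (k * (1 / 2 : ℝ)))
    (he : Summable fun k => |e k| * Real.exp (k * (1 / 2 : ℝ)))
    (hce : ∀ x, cosSeries e x = cosSeries c x ^ 2 / 2)
    (hs : SolvesEq g γ h lam μ (cosSeries c)) (x : ℝ) :
    (lam + γ * ((deriv (stripHol h e) x).re - cosSeries c x -
        cosSeries c x * (deriv (stripHol h c) x).re)) ^ 2 =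
      (lam ^ 2 + μ - 2 * g * cosSeries c x) * ‖1 + deriv (stripHol h c) x‖ ^ 2 := by
  obtain ⟨G, G₂, h1, h2, h3⟩ := hs
  have e1 := h1.unique hh (hasDN_stripHol hh (by norm_num) hc) x
  have h4 := hasDN_stripHol hh (by norm_num) he
  rw [show cosSeries e = fun x => cosSeries c x ^ 2 / 2 from funext hce] at h4
  have e2 := h2.unique hh h4 x
  have h5 := h3 x
  rw [(hasDerivAt_cosSeries hh (by norm_num) hc x).deriv, e1, e2] at h5
  rw [h5, ← Complex.normSq_eq_norm_sq, Complex.normSq_apply]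
  simp only [Complex.add_re, Complex.one_re, Complex.add_im, Complex.one_im]
  ring

/-! ### Two solutions of the free-boundary problem -/

/-- The values `s` and `-s` of `s cos` at the two points are `2|s|` apart, and the errors add up to
at most `|s|`. -/
theorem ne_of_abs_sub_cos_le {f : ℝ → ℝ} {s : ℝ} (hs : s ≠ 0)
    (hf : ∀ x, |f x - s * Real.cos x| ≤ |s| / 2) : f 0 ≠ f (-Real.pi) := by
  intro h0
  have h1 := hf 0
  have h2 := hf (-Real.pi)
  rw [Real.cos_zero, mul_one] at h1
  rw [Real.cos_neg, Real.cos_pi, ← h0] at h2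
  have h3 := abs_sub_le_add h2 h1
  rw [show f 0 - s * -1 - (f 0 - s) = 2 * s by ring, abs_mul, abs_two] at h3
  linarith [abs_pos.2 hs]

theorem not_even_shift {f : ℝ → ℝ} (hf : f 0 ≠ f (-Real.pi)) :
    ¬ Function.Even fun x => f (x + -(Real.pi / 2)) := fun he => by
  have h1 := he (Real.pi / 2)
  simp only [add_neg_cancel] at h1
  rw [show -(Real.pi / 2) + -(Real.pi / 2) = -Real.pi by ring] at h1
  exact hf h1.symm

theorem re_stripHol_zero (h : ℝ) (c : ℕ → ℝ) : (stripHol h c ⟨0, 0⟩).re = 0 := by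
  have h1 := re_stripHol_neg h c 0
  rw [neg_zero] at h1
  linarith

theorem re_stripHol_neg_pi (h : ℝ) {c : ℕ → ℝ} (hc0 : c 0 = 0) :
    (stripHol h c ⟨-Real.pi, 0⟩).re = 0 := by
  have h1 := re_stripHol_neg h c Real.pi
  have h2 := stripHol_add_two_pi h c ⟨-Real.pi, 0⟩
  have e : (⟨-Real.pi, 0⟩ : ℂ) + (2 * Real.pi : ℝ) = ⟨Real.pi, 0⟩ := by
    apply Complex.ext <;> simp
    ring
  rw [e, hc0] at h2
  simp only [zero_mul, zero_div, Complex.ofReal_zero, add_zero] at h2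
  rw [h2] at h1
  linarith

/-- A solution and its translate by a quarter period yield an even and a non-even surface. -/
theorem exists_two_freeBoundary {g γ h lam μ m Q : ℝ} (hh : 0 < h) {α : ℝ≥0} (hα : α ≤ 1) {b : L1}
    (hb : ‖b‖ ≤ 1 / (2 * modeConst h)) (hb0 : waveCoeff b 0 = 0)
    (hne : wave b 0 ≠ wave b (-Real.pi)) (hpos : ∀ x, -h < wave b x)
    (hs : SolvesEq g γ h lam μ (wave b))
    (hlam : lam = m / h - γ * h / 2) (hμ : μ = Q - 2 * g * h - lam ^ 2) :
    ∃ (η₁ η₂ : ℝ → ℝ) (ψ₁ ψ₂ : ℂ → ℝ),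
      SolvesFreeBoundary g γ m Q α η₁ ψ₁ ∧ SolvesFreeBoundary g γ m Q α η₂ ψ₂ ∧
      IsConformalElevation h (wave b) η₁ ∧
      IsConformalElevation h (fun x => wave b (x + -(Real.pi / 2))) η₂ ∧
      Function.Periodic η₁ (2 * Real.pi) ∧ Function.Periodic η₂ (2 * Real.pi) ∧
      Function.Even η₁ ∧ ¬ Function.Even η₂ ∧ η₁ ≠ η₂ := by
  obtain ⟨e, he, hce⟩ := exists_waveCoeff_half_sq b
  have hP := isConformalData_stripHol hh (summable_waveCoeff b) hb0 he hce
    (fun z hz => norm_deriv_stripHol_wave_le hh hb hb0 hz) fun x => neg_lt_iff_pos_add'.1 (hpos x)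
  have hB := hs.bernoulli hh (summable_waveCoeff b) he hce
  obtain ⟨η₁, ψ₁, hS₁, hE₁, hp₁, hη₁, hsurj⟩ := hP.exists_freeBoundary hα hlam hμ hB
  obtain ⟨η₂, ψ₂, hS₂, hE₂, hp₂, hη₂, -⟩ := (hP.comp_add_const (-(Real.pi / 2))).exists_freeBoundary
    hα hlam hμ fun x => by
      rw [deriv_comp_add_const, deriv_comp_add_const, ← Complex.ofReal_add]
      exact hB _
  have heven : Function.Even η₁ := fun X => by
    obtain ⟨x, rfl⟩ := hsurj X
    have h1 := hη₁ (-x)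
    rw [re_stripHol_neg, cosSeries_neg, ← neg_add] at h1
    rw [h1, hη₁]
  -- The shifted conformal variables are `0` and `-π`, where the horizontal displacement vanishes by
  -- symmetry and periodicity. Hence the surface heights at `X = ±π/2` are known exactly, and they
  -- differ.
  have hnot : ¬ Function.Even η₂ := fun h2 => by
    have a1 : (⟨Real.pi / 2, 0⟩ : ℂ) + (-(Real.pi / 2) : ℝ) = ⟨0, 0⟩ := by
      apply Complex.ext <;> simp
    have a2 : (⟨-(Real.pi / 2), 0⟩ : ℂ) + (-(Real.pi / 2) : ℝ) = ⟨-Real.pi, 0⟩ := by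
      apply Complex.ext <;> simp
      ring
    have h3 := hη₂ (Real.pi / 2)
    have h4 := hη₂ (-(Real.pi / 2))
    rw [a1, re_stripHol_zero, add_zero, add_neg_cancel] at h3
    rw [a2, re_stripHol_neg_pi h hb0, add_zero, h2, h3,
      show -(Real.pi / 2) + -(Real.pi / 2) = -Real.pi by ring] at h4
    exact hne (add_left_cancel h4)
  exact ⟨η₁, η₂, ψ₁, ψ₂, hS₁, hS₂, hE₁, hE₂, hp₁, hp₂, heven, hnot, fun h => hnot (h ▸ heven)⟩

end WaterWave

end

/-! ### Assembly of the two curves and the two surfaces -/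

theorem mainTheorem3 (g γ h : ℝ) (hg : 0 < g) (hh : 0 < h) (n : ℕ) (hn : 1 ≤ n)
    (α : ℝ≥0) (hα0 : 0 < α) (hα1 : α < 1) (lamStar : ℝ)
    (hlam : lamStar = -(γ * Real.tanh h / 2) -
      Real.sqrt (γ ^ 2 * Real.tanh h ^ 2 / 4 + g * Real.tanh h)) :
    WaterWave.IsAdmissible (fun k : ℕ => 2 * (k : ℝ)) (fun k : ℕ => 2 * (k : ℝ) + 1) ∧
    ∃ (ε : ℝ) (lam μ : ℝ → ℝ) (w v : ℝ → ℝ → ℝ),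
      -- the curve of solutions that are not even
      WaterWave.IsBifurcationCurve g γ h (fun k : ℕ => 2 * (k : ℝ)) (fun k : ℕ => 2 * (k : ℝ) + 1)
        n α lamStar Real.sin ε lam μ w ∧
      -- the curve of even solutions at the same value, with the same parameters
      WaterWave.IsBifurcationCurve g γ h (fun k : ℕ => (k : ℝ)) (fun _ : ℕ => (0 : ℝ))
        n α lamStar Real.cos ε lam μ v ∧
      ∀ s ∈ Set.Ioo (-ε) ε,
        Function.Periodic (w s) (2 * Real.pi) ∧ Function.Periodic (v s) (2 * Real.pi) ∧
        Function.Even (v s) ∧ (s ≠ 0 → ¬ Function.Even (w s)) ∧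
        -- two distinct solutions of the free-boundary problem with the same data
        (s ≠ 0 → ∀ m Q : ℝ, lam s = m / h - γ * h / 2 → μ s = Q - 2 * g * h - lam s ^ 2 →
          ∃ (η₁ η₂ : ℝ → ℝ) (ψ₁ ψ₂ : ℂ → ℝ),
            WaterWave.SolvesFreeBoundary g γ m Q α η₁ ψ₁ ∧
            WaterWave.SolvesFreeBoundary g γ m Q α η₂ ψ₂ ∧
            WaterWave.IsConformalElevation h (v s) η₁ ∧
            WaterWave.IsConformalElevation h (w s) η₂ ∧
            Function.Periodic η₁ (2 * Real.pi) ∧ Function.Periodic η₂ (2 * Real.pi) ∧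
            Function.Even η₁ ∧ ¬ Function.Even η₂ ∧ η₁ ≠ η₂) := by

  refine ⟨WaterWave.isAdmissible_even_odd, ?_⟩
  -- The curve is cut off at this `ℓ¹` size so that all its waves yield conformal maps.
  have hη : 0 < 1 / (2 * WaterWave.modeConst h) := by
    have := WaterWave.modeConst_pos hh
    positivity
  obtain ⟨ε, lam, μ, b, hcurve, hprop⟩ := WaterWave.exists_even_curve hh
    (WaterWave.isCritical_of_eq hg hh hlam) hn hα0 hα1 hη
  refine ⟨ε, lam, μ, _, _, hcurve.shift, hcurve, fun s hs => ?_⟩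
  obtain ⟨h1, h2, h3⟩ := hprop s hs
  have hper : Function.Periodic (WaterWave.wave (b s)) (2 * Real.pi) :=
    WaterWave.cosSeries_periodic _
  refine ⟨fun x => ?_, hper, WaterWave.cosSeries_neg _,
    fun hs0 => WaterWave.not_even_shift (WaterWave.ne_of_abs_sub_cos_le hs0 h3),
    fun hs0 m Q hm hQ => WaterWave.exists_two_freeBoundary hh hα1.le h1 h2
      (WaterWave.ne_of_abs_sub_cos_le hs0 h3) (hcurve.above_bottom s hs) (hcurve.solves s hs) hm hQ⟩
  simpa only [add_right_comm] using hper (x + -(Real.pi / 2))
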